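/- Let $(\mathcal S,\mathcal A,P,R,\gamma)$ be a Markov decision process with discount factor $\gamma\in[0,1)$, $\pi:\mathcal S\to\mathcal A$ a stationary policy, $r(s)=R(s,\pi(s))$, $\mu$ a stationary distribution of the chain induced by $\pi$, and $\phi:\mathcal S\to\mathbb R^d$ a feature map. Assume $|r(s)|\le 1$ and $\|\phi(s)\|\le 1$ for all $s$, and that the feature matrix $\Phi$ with rows $\phi(s)^\top$ has full column rank, in the sense that $\phi(s)^\top x=0$ for $\mu$-almost every $s$ only if $x=0$ (for finitely many states of positive stationary probability: $\operatorname{rank}\Phi=d$). Let $(s_n,s_n')_{n\ge 0}$ be iid with $s_n\sim\mu$ and $s_n'$ drawn from the induced chain started at $s_n$; write $\phi_n=\phi(s_n)$, $\phi_n'=\phi(s_n')$, $r_n=r(s_n)$, and $$A=\mathbb E[\phi_0(\phi_0-\gamma\phi_0')^\top],\qquad C=\mathbb E[\phi_0\phi_0^\top],\qquad b=\mathbb E[r_0\phi_0].$$ Let $1>\alpha>\beta>0$, $\alpha_n=(n+1)^{-\alpha}$, $\beta_n=(n+1)^{-\beta}$, $p>1$, $R^\theta>0$, $R^w>0$. Let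 $\Pi_R(x)=\min\{1,R/\|x\|\}\,x$, and let $\Pi_{n,R}=\Pi_R$ if $n=k^k-1$ for some integer $k>0$ and $\Pi_{n,R}=I$ otherwise. For arbitrary $\theta_0',w_0'\in\mathbb R^d$ consider the sparsely projected iterates $$\theta'_{n+1}=\Pi_{n+1,R^\theta}\big(\theta_n'+\alpha_n g_n\big),\qquad w'_{n+1}=\Pi_{n+1,R^w}\big(w_n'+\beta_n k_n\big),$$ where, with $\delta_n=r_n+\gamma\theta_n'^\top\phi_n'-\theta_n'^\top\phi_n$, the increments are those of one of the following algorithms: GTD(0): $g_n=(\phi_n-\gamma\phi_n')\phi_n^\top w_n'$ and $k_n=\delta_n\phi_n-w_n'$; GTD2: $g_n=(\phi_n-\gamma\phi_n')\phi_n^\top w_n'$ and $k_n=(\delta_n-\phi_n^\top w_n')\phi_n$; TDC: $g_n=\delta_n\phi_n-\gamma\phi_n'\phi_n^\top w_n'$ and $k_n=(\delta_n-\phi_n^\top w_n')\phi_n$. The mean increments have the form $h_i(\theta,w)=v_i-\Gamma_i\theta-W_iw$, $i=1,2$, with $v_2=b$, $\Gamma_2=A$ in all three cases, $W_2=I$ for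 GTD(0) and $W_2=C$ for GTD2 and TDC, $v_1=0$, $\Gamma_1=0$, $W_1=-A^\top$ for GTD(0) and GTD2, and $v_1=b$, $\Gamma_1=A$, $W_1=C-A^\top$ for TDC. Put $X_1=\Gamma_1-W_1W_2^{-1}\Gamma_2$, $b_1=v_1-W_1W_2^{-1}v_2$, $\theta^*=X_1^{-1}b_1$, $w^*=W_2^{-1}(v_2-\Gamma_2\theta^*)$, and assume that $\theta^*$ lies in the interior of the projection ball, $\|\theta^*\|<R^\theta$. Then there are constants $C_\theta,C_w,K,\kappa$, depending only on the algorithm and on $d,A,C,b,\alpha,\beta,p,R^\theta,R^w$, and for every $\delta\in(0,1)$ an index $N\le K(1+\ln(1/\delta))^{\kappa}$, depending only on $\delta$ and the same data, such that with probability larger than $1-\delta$, for all $n\ge N$, $$\|\theta_n'-\theta^*\|\le C_\theta\,\frac{\sqrt{\ln(4d^2(n+1)^p/\delta)}}{(n+1)^{\alpha/2}},\qquad \|w_n'-w^*\|\le C_w\,\frac{\sqrt{\ln(4d^2(n+1)^p/\delta)}}{(n+1)^{\beta/2}}.$$ In particular $N$, $C_\theta$ and $C_w$ depend neither on the initial values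 nor on the sample path. -/

import Mathlib

open MeasureTheory ProbabilityTheory
open scoped Matrix InnerProductSpace

noncomputable section

namespace GTD

/-- `ℝ^d` with the Euclidean norm. -/
abbrev Vec (d : ℕ) : Type := EuclideanSpace ℝ (Fin d)

/-! ### Linear two-timescale systems and sparse projections -/

/-- The data `(v_i, Γ_i, W_i)` of the drifts `h_i(θ, w) = v_i - Γ_i θ - W_i w`, `i = 1, 2`. -/
structure LinearSystem (d : ℕ) where
  v₁ : Fin d → ℝ
  Γ₁ : Matrix (Fin d) (Fin d) ℝ
  W₁ : Matrix (Fin d) (Fin d) ℝ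
  v₂ : Fin d → ℝ
  Γ₂ : Matrix (Fin d) (Fin d) ℝ
  W₂ : Matrix (Fin d) (Fin d) ℝ

namespace LinearSystem

variable {d : ℕ} (L : LinearSystem d)

/-- `X₁ = Γ₁ - W₁ W₂⁻¹ Γ₂`. -/
def X₁ : Matrix (Fin d) (Fin d) ℝ := L.Γ₁ - L.W₁ * L.W₂⁻¹ * L.Γ₂

/-- `b₁ = v₁ - W₁ W₂⁻¹ v₂`. -/
def b₁ : Fin d → ℝ := L.v₁ - (L.W₁ * L.W₂⁻¹) *ᵥ L.v₂

/-- `θ* = X₁⁻¹ b₁`. -/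
def thetaStar : Vec d := WithLp.toLp 2 (L.X₁⁻¹ *ᵥ L.b₁)

/-- `w* = W₂⁻¹ (v₂ - Γ₂ θ*)`. -/
def wStar : Vec d := WithLp.toLp 2 (L.W₂⁻¹ *ᵥ (L.v₂ - L.Γ₂ *ᵥ L.thetaStar.ofLp))

end LinearSystem

/-- Projection onto the closed ball of radius `R` around the origin, `min {1, R / ‖x‖} x`. -/
def ballProj {d : ℕ} (R : ℝ) (x : Vec d) : Vec d := min 1 (R / ‖x‖) • x

open Classical in
/-- The sparse projection `Π_{n,R}`: it projects if `n = k ^ k - 1` for some integer `k > 0`, and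
is the identity otherwise. -/
def sparseProj {d : ℕ} (n : ℕ) (R : ℝ) (x : Vec d) : Vec d :=
  if ∃ k : ℕ, 0 < k ∧ n = k ^ k - 1 then ballProj R x else x

/-! ### The gradient temporal difference algorithms -/

/-- The members of the gradient temporal difference family. -/
inductive Algorithm where
  | gtd0
  | gtd2
  | tdc

namespace Algorithm

variable {d : ℕ}

/-- The linear system of mean drifts, in terms of `A = E[φ (φ - γ φ')ᵀ]`, `C = E[φ φᵀ]` and
`b = E[r φ]`. -/
def system (A C : Matrix (Fin d) (Fin d) ℝ) (b : Fin d → ℝ) : Algorithm → LinearSystem d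
  | gtd0 => { v₁ := 0, Γ₁ := 0, W₁ := -Aᵀ, v₂ := b, Γ₂ := A, W₂ := 1 }
  | gtd2 => { v₁ := 0, Γ₁ := 0, W₁ := -Aᵀ, v₂ := b, Γ₂ := A, W₂ := C }
  | tdc => { v₁ := b, Γ₁ := A, W₁ := C - Aᵀ, v₂ := b, Γ₂ := A, W₂ := C }

/-- The temporal difference `r + γ θᵀφ' - θᵀφ`. -/
def tdError (γ r : ℝ) (φ φ' θ : Vec d) : ℝ := r + γ * ⟪φ', θ⟫_ℝ - ⟪φ, θ⟫_ℝ

/-- The increment `h₁(θ, w) + M⁽¹⁾` (mean drift plus noise) of the iterate `θ`, as computed from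
one sample `(r, φ, φ')`. -/
def incTheta (γ r : ℝ) (φ φ' θ w : Vec d) : Algorithm → Vec d
  | gtd0 => ⟪φ, w⟫_ℝ • (φ - γ • φ')
  | gtd2 => ⟪φ, w⟫_ℝ • (φ - γ • φ')
  | tdc => tdError γ r φ φ' θ • φ - (γ * ⟪φ, w⟫_ℝ) • φ'

/-- The increment `h₂(θ, w) + M⁽²⁾` (mean drift plus noise) of the iterate `w`, as computed from
one sample `(r, φ, φ')`. -/
def incW (γ r : ℝ) (φ φ' θ w : Vec d) : Algorithm → Vec d
  | gtd0 => tdError γ r φ φ' θ • φ - w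
  | gtd2 => (tdError γ r φ φ' θ - ⟪φ, w⟫_ℝ) • φ
  | tdc => (tdError γ r φ φ' θ - ⟪φ, w⟫_ℝ) • φ

end Algorithm

/-! ### Markov decision processes and policy evaluation with linear features -/

/-- A Markov decision process: transition kernel, reward function and discount factor. -/
structure MDP (S Act : Type*) [MeasurableSpace S] [MeasurableSpace Act] where
  trans : Kernel (S × Act) S
  [markov : IsMarkovKernel trans]
  reward : S × Act → ℝ
  measurable_reward : Measurable reward
  γ : ℝ
  γ_nonneg : 0 ≤ γ
  γ_lt_one : γ < 1

attribute [instance] MDP.markov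

/-- A policy evaluation problem: a Markov decision process, a stationary policy `π`, a feature map
`φ`, and a stationary distribution `μ` of the chain induced by the policy. -/
structure PolicyEval (d : ℕ) (S Act : Type*) [MeasurableSpace S] [MeasurableSpace Act]
    extends MDP S Act where
  π : S → Act
  measurable_π : Measurable π
  φ : S → Vec d
  measurable_φ : Measurable φ
  μ : Measure S
  [prob : IsProbabilityMeasure μ]
  stationary : (trans.comap (fun s => (s, π s)) (measurable_id.prodMk measurable_π)).Invariant μ

attribute [instance] PolicyEval.prob

namespace PolicyEval

variable {d : ℕ} {S Act : Type*} [MeasurableSpace S] [MeasurableSpace Act]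
  (E : PolicyEval d S Act)

/-- The transition kernel of the induced chain. -/
def chain : Kernel S S :=
  E.trans.comap (fun s => (s, E.π s)) (measurable_id.prodMk E.measurable_π)

/-- The reward `r(s)` collected in state `s` under the policy. -/
def r (s : S) : ℝ := E.reward (s, E.π s)

/-- The law of a transition `(s, s')` of the stationary chain: `s` has law `μ` and, given `s`, the
state `s'` is drawn from the induced chain. -/
def pairLaw : Measure (S × S) := E.μ ⊗ₘ E.chain

/-- `A = E[φ (φ - γ φ')ᵀ]`. -/
def A : Matrix (Fin d) (Fin d) ℝ :=
  Matrix.of fun i j => ∫ z, E.φ z.1 i * (E.φ z.1 j - E.γ * E.φ z.2 j) ∂E.pairLaw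

/-- `C = E[φ φᵀ]`. -/
def C : Matrix (Fin d) (Fin d) ℝ := Matrix.of fun i j => ∫ s, E.φ s i * E.φ s j ∂E.μ

/-- `b = E[r φ]`. -/
def b : Fin d → ℝ := fun i => ∫ s, E.r s * E.φ s i ∂E.μ

/-- The feature matrix, whose rows are the vectors `φ(s)ᵀ`, has full column rank: no nonzero
linear combination of its columns vanishes at `μ`-almost every state. -/
def FullRank : Prop := ∀ x : Vec d, (∀ᵐ s ∂E.μ, ⟪E.φ s, x⟫_ℝ = 0) → x = 0

/-- If there are finitely many states, all of positive stationary probability, then `FullRank` says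
that the feature matrix has rank `d`. -/
theorem fullRank_iff_rank [Fintype S] [MeasurableSingletonClass S] (h : ∀ s, E.μ {s} ≠ 0) :
    E.FullRank ↔ (Matrix.of fun s i => E.φ s i : Matrix S (Fin d) ℝ).rank = d := by
  set Φ : Matrix S (Fin d) ℝ := Matrix.of fun s i => E.φ s i with hΦ
  have key : E.FullRank ↔ Function.Injective Φ.mulVecLin := by
    rw [← LinearMap.ker_eq_bot, LinearMap.ker_eq_bot']
    have hae : ∀ x : Vec d, (∀ᵐ s ∂E.μ, ⟪E.φ s, x⟫_ℝ = 0) ↔ Φ.mulVecLin x.ofLp = 0 := by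
      intro x
      rw [ae_iff_of_countable]
      constructor
      · intro hx
        ext s
        have := hx s (h s)
        simpa [hΦ, PiLp.inner_apply, Matrix.mulVec, dotProduct, mul_comm] using this
      · intro hx s _
        have := congrFun hx s
        simpa [hΦ, PiLp.inner_apply, Matrix.mulVec, dotProduct, mul_comm] using this
    constructor
    · intro hF m hm
      have := hF (WithLp.toLp 2 m) ((hae _).2 hm)
      simpa using congrArg WithLp.ofLp this
    · intro hF x hx
      have := hF x.ofLp ((hae x).1 hx)
      exact WithLp.ofLp_injective 2 this
  have hsum := LinearMap.finrank_range_add_finrank_ker Φ.mulVecLin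
  rw [Module.finrank_fin_fun] at hsum
  rw [key, ← LinearMap.ker_eq_bot, ← Submodule.finrank_eq_zero]
  unfold Matrix.rank
  omega

/-- The sparsely projected iterates `(θ'_n, w'_n)` along a sequence `x` of transitions `(s_n, s'_n)`,
with stepsizes `(n + 1) ^ (-α)` and `(n + 1) ^ (-β)`, projection radii `Rθ` and `Rw`, and initial
values `θ₀` and `w₀`. -/
def iterates (alg : Algorithm) (α β Rθ Rw : ℝ) (x : ℕ → S × S) (θ₀ w₀ : Vec d) :
    ℕ → Vec d × Vec d
  | 0 => (θ₀, w₀)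
  | n + 1 =>
    let θ := (iterates alg α β Rθ Rw x θ₀ w₀ n).1
    let w := (iterates alg α β Rθ Rw x θ₀ w₀ n).2
    (sparseProj (n + 1) Rθ (θ + ((n : ℝ) + 1) ^ (-α) •
        alg.incTheta E.γ (E.r (x n).1) (E.φ (x n).1) (E.φ (x n).2) θ w),
      sparseProj (n + 1) Rw (w + ((n : ℝ) + 1) ^ (-β) •
        alg.incW E.γ (E.r (x n).1) (E.φ (x n).1) (E.φ (x n).2) θ w))

end PolicyEval

/-- `√(ln (4 d² (n + 1) ^ p / δ)) / (n + 1) ^ (a / 2)`. -/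
def rate (d : ℕ) (p δ a : ℝ) (n : ℕ) : ℝ :=
  √(Real.log (4 * (d : ℝ) ^ 2 * ((n : ℝ) + 1) ^ p / δ)) / ((n : ℝ) + 1) ^ (a / 2)

end GTD

end

noncomputable section

namespace GTD

/-! ### Polynomial stepsizes and the rate -/

/-! Write `t = θ - θ*` and `u = w + W₂⁻¹ A t`. Since `A θ* = b`, the fast drift is `-W₂ u` and the
slow one is `-X t - W₁ u` with `X = Aᵀ W₂⁻¹ A` for all three algorithms; in particular `w* = 0`.
Full rank makes `C` positive, full rank and stationarity together make `A` positive, and hence `X`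
and `W₂` are coercive (`Algorithm.exists_decoupled`).

The coupling `W₁ u` would spoil the rate of `θ`, because `u` only decays at the slower rate. With
`ρ_n = α_n / β_n`, the corrected coordinate `z = t - ρ_n H u`, where `H = W₁ W₂⁻¹`, cancels it to
leading order: what is left in one step is `O(α_n ρ_n) (‖z‖ + ‖u‖)` for `z` and `O(β_n ρ_n) (‖z‖ +
‖u‖)` for `u`. As `ρ_n` times the `β`-rate is `o(1)` times the `α`-rate, each coordinate keeps its
own rate.

The noise is isolated in linear recursions `Z`, `U` started from zero at a time `n₀` and driven by
the noise cut off at large iterates. The noise is then bounded and conditionally centered, so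
Hoeffding's lemma, iterated along the contraction, gives sub-Gaussian vectors with variance
proportional to the stepsize (`lintegral_exp_inner_recursion_le`); a Chernoff and union bound keeps
them below `K` times the rate at all times `n ≥ n₀` with probability larger than `1 - δ`. On that
event the differences `z - Z` and `u - U` obey perturbed contractions, and an induction bounds them
by a transient `B (n₀ + 1) / (n + 1)` plus a multiple of the rate (`Decoupled.path_le_envelope`).
The same induction shows that neither the cutoff nor a later projection ever acts.

The sparse projection times make this uniform in the initial values. Taking `n₀ + 1 = k ^ k`, the
projection at `n₀` bounds the iterates by the radii alone; the next one comes more than `k` times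
later, when the transient is too small to reach the projection spheres. Moreover the numbers `k ^ k`
are dense enough, one lying in each interval `[T, T ^ 3]`, for `n₀` to be polynomial in `1 + log (1
/ δ)`. A time quadratic in `n₀` then absorbs the transient into the rate. -/

/-- The polynomial stepsize `(n + 1) ^ (-a)`. -/
def step (a : ℝ) (n : ℕ) : ℝ := ((n : ℝ) + 1) ^ (-a)

lemma step_pos (a : ℝ) (n : ℕ) : 0 < step a n := Real.rpow_pos_of_pos (by positivity) _

lemma step_le_one {a : ℝ} (ha : 0 ≤ a) (n : ℕ) : step a n ≤ 1 :=
  Real.rpow_le_one_of_one_le_of_nonpos (by simp) (by linarith)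

lemma step_mul (a b : ℝ) (n : ℕ) : step a n * step b n = step (a + b) n := by
  unfold step
  rw [← Real.rpow_add (by positivity)]
  ring_nf

lemma step_le_step {a b : ℝ} (h : b ≤ a) (n : ℕ) : step a n ≤ step b n :=
  Real.rpow_le_rpow_of_exponent_le (by simp) (by linarith)

lemma step_one (n : ℕ) : step 1 n = 1 / ((n : ℝ) + 1) := by
  simp [step, Real.rpow_neg_one]

lemma step_succ_le {a : ℝ} (ha : 0 ≤ a) (n : ℕ) : step a (n + 1) ≤ step a n := by
  unfold step
  exact Real.rpow_le_rpow_of_nonpos (by positivity) (by push_cast; linarith) (by linarith)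

/-- Stepsizes with exponent at most one lose at most a fraction `1 / (n + 2)` in one step. -/
lemma step_succ_ge {a : ℝ} (ha1 : a ≤ 1) (n : ℕ) :
    (1 - 1 / ((n : ℝ) + 2)) * step a n ≤ step a (n + 1) := by
  have h1 : (0 : ℝ) < (n : ℝ) + 1 := by positivity
  have h2 : (0 : ℝ) < (n : ℝ) + 2 := by positivity
  have e : 1 - 1 / ((n : ℝ) + 2) = ((n : ℝ) + 1) / ((n : ℝ) + 2) := by field_simp; ring
  have e2 : step a (n + 1) = (((n : ℝ) + 1) / ((n : ℝ) + 2)) ^ a * step a n := by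
    unfold step
    rw [Real.div_rpow h1.le h2.le, Real.rpow_neg h1.le, Real.rpow_neg (by positivity)]
    have : ((n + 1 : ℕ) : ℝ) + 1 = (n : ℝ) + 2 := by push_cast; ring
    rw [this]
    have := (Real.rpow_pos_of_pos h1 a).ne'
    field_simp
  rw [e2, e]
  gcongr
  · exact (step_pos a n).le
  · refine Real.self_le_rpow_of_le_one (by positivity) ?_ ha1
    rw [div_le_one h2]; linarith

lemma rate_eq (d : ℕ) (p δ a : ℝ) (n : ℕ) :
    rate d p δ a n = √(Real.log (4 * (d : ℝ) ^ 2 * ((n : ℝ) + 1) ^ p / δ)) * step (a / 2) n := by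
  unfold rate step
  rw [Real.rpow_neg (by positivity), div_eq_mul_inv]

lemma rate_nonneg (d : ℕ) (p δ a : ℝ) (n : ℕ) : 0 ≤ rate d p δ a n := by
  unfold rate; positivity

/-- The argument is at least `4 > e`. Hence the logarithmic factor never makes the rate smaller than
the bare power. -/
lemma one_le_log_arg {d : ℕ} (hd : 0 < d) {p δ : ℝ} (hp : 0 ≤ p) (hδ : 0 < δ) (hδ1 : δ < 1)
    (n : ℕ) : 1 ≤ Real.log (4 * (d : ℝ) ^ 2 * ((n : ℝ) + 1) ^ p / δ) := by
  have h1 : (1 : ℝ) ≤ d := by exact_mod_cast hd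
  have h2 : (1 : ℝ) ≤ ((n : ℝ) + 1) ^ p := Real.one_le_rpow (by simp) hp
  have h3 : (4 : ℝ) ≤ 4 * (d : ℝ) ^ 2 * ((n : ℝ) + 1) ^ p / δ := by
    rw [le_div_iff₀ hδ]
    nlinarith [one_le_mul_of_one_le_of_one_le (one_le_pow₀ h1 : (1 : ℝ) ≤ (d : ℝ) ^ 2) h2]
  rw [Real.le_log_iff_exp_le (by linarith)]
  linarith [Real.exp_one_lt_d9]

lemma rate_sq {d : ℕ} (hd : 0 < d) {p δ : ℝ} (hp : 0 ≤ p) (hδ : 0 < δ) (hδ1 : δ < 1)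
    (a : ℝ) (n : ℕ) : rate d p δ a n ^ 2 =
      Real.log (4 * (d : ℝ) ^ 2 * ((n : ℝ) + 1) ^ p / δ) * step a n := by
  rw [rate_eq, mul_pow, Real.sq_sqrt (by linarith [one_le_log_arg hd hp hδ hδ1 n]), sq (step _ _),
    step_mul]
  ring_nf

lemma step_half_le_rate {d : ℕ} (hd : 0 < d) {p δ : ℝ} (hp : 0 ≤ p) (hδ : 0 < δ) (hδ1 : δ < 1)
    (a : ℝ) (n : ℕ) : step (a / 2) n ≤ rate d p δ a n := by
  rw [rate_eq]
  refine le_mul_of_one_le_left (step_pos _ _).le ?_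
  rw [Real.one_le_sqrt]
  exact one_le_log_arg hd hp hδ hδ1 n

/-- The logarithmic factor grows with `n`, so the rate loses no larger fraction in one step than its
power does. -/
lemma rate_succ_ge {d : ℕ} (hd : 0 < d) {p δ a : ℝ} (hp : 0 ≤ p) (hδ : 0 < δ)
    (ha1 : a ≤ 1) (n : ℕ) :
    (1 - 1 / ((n : ℝ) + 2)) * rate d p δ a n ≤ rate d p δ a (n + 1) := by
  have hd' : (0 : ℝ) < d := by exact_mod_cast hd
  rw [rate_eq, rate_eq, mul_left_comm]
  have := step_succ_ge (a := a / 2) (by linarith) n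
  have h0 : 0 ≤ 1 - 1 / ((n : ℝ) + 2) := by
    rw [sub_nonneg, div_le_one (by positivity)]; linarith [(Nat.cast_nonneg n : (0 : ℝ) ≤ n)]
  have h1 := step_pos (a / 2) n
  refine mul_le_mul (Real.sqrt_le_sqrt (Real.log_le_log (by positivity) ?_)) this (by positivity)
    (by positivity)
  push_cast
  gcongr
  linarith

lemma rate_anti (d : ℕ) (p δ : ℝ) {a b : ℝ} (h : b ≤ a) (n : ℕ) :
    rate d p δ a n ≤ rate d p δ b n := by
  rw [rate_eq, rate_eq]
  exact mul_le_mul_of_nonneg_left (step_le_step (by linarith) n) (by positivity)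

/-- Multiplying by the ratio of the stepsizes more than compensates for the slower rate. -/
lemma step_mul_rate (d : ℕ) (p δ a b : ℝ) (n : ℕ) :
    step (a - b) n * rate d p δ b n = step ((a - b) / 2) n * rate d p δ a n := by
  rw [rate_eq, rate_eq, mul_left_comm, mul_left_comm (step ((a - b) / 2) n), step_mul, step_mul]
  ring_nf

/-- The rate is uniformly small beyond a time which is polynomial in `1 + log (1 / δ)`. -/
lemma exists_rate_sq_le {d : ℕ} (hd : 0 < d) {p a : ℝ} (hp : 0 ≤ p) (ha : 0 < a) :
    ∃ c : ℝ, 0 < c ∧ ∀ δ : ℝ, 0 < δ → δ < 1 → ∀ n : ℕ,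
      rate d p δ a n ^ 2 ≤ c * (1 + Real.log (1 / δ)) * step (a / 2) n := by
  have hd' : (1 : ℝ) ≤ d := by exact_mod_cast hd
  have hlog : 0 ≤ Real.log (4 * (d : ℝ) ^ 2) := Real.log_nonneg (by nlinarith)
  -- The summands of the constant pay for the three parts of the logarithm: `log (4 d²)`, `p log (n
  -- + 1)` (through `log y ≤ y ^ (a / 2) / (a / 2)`) and `log (1 / δ)`.
  refine ⟨Real.log (4 * (d : ℝ) ^ 2) + p / (a / 2) + 1, by positivity, fun δ hδ hδ1 n => ?_⟩
  have hx : (0 : ℝ) < (n : ℝ) + 1 := by positivity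
  have hl : 0 ≤ Real.log (1 / δ) := Real.log_nonneg (by rw [le_div_iff₀ hδ]; linarith)
  rw [rate_sq hd hp hδ hδ1]
  have e : Real.log (4 * (d : ℝ) ^ 2 * ((n : ℝ) + 1) ^ p / δ) =
      Real.log (4 * (d : ℝ) ^ 2) + p * Real.log ((n : ℝ) + 1) + Real.log (1 / δ) := by
    rw [Real.log_div (by positivity) hδ.ne', Real.log_mul (by positivity) (by positivity),
      Real.log_rpow hx, one_div, Real.log_inv]
    ring
  have h1 : Real.log ((n : ℝ) + 1) ≤ ((n : ℝ) + 1) ^ (a / 2) / (a / 2) :=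
    Real.log_le_rpow_div hx.le (by positivity)
  have h2 : (1 : ℝ) ≤ ((n : ℝ) + 1) ^ (a / 2) := Real.one_le_rpow (by simp) (by positivity)
  have h3 : step a n = step (a / 2) n * step (a / 2) n := by rw [step_mul]; ring_nf
  have h4 : ((n : ℝ) + 1) ^ (a / 2) * step (a / 2) n = 1 := by
    unfold step; rw [← Real.rpow_add hx]; simp
  rw [h3, ← mul_assoc]
  refine mul_le_mul_of_nonneg_right ?_ (step_pos _ _).le
  rw [e]
  set Y := ((n : ℝ) + 1) ^ (a / 2)
  set l := Real.log (1 / δ)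
  set q := Real.log (4 * (d : ℝ) ^ 2)
  have h5 : q + p * Real.log ((n : ℝ) + 1) + l ≤ (q + p / (a / 2) + 1) * (1 + l) * Y := by
    have h6 : p * Real.log ((n : ℝ) + 1) ≤ p / (a / 2) * Y := by
      calc _ ≤ p * (Y / (a / 2)) := mul_le_mul_of_nonneg_left h1 hp
        _ = _ := by ring
    have h7 : 0 ≤ p / (a / 2) := by positivity
    set P := p / (a / 2)
    have h8 : (q + P + 1) * (1 + l) * Y = q * Y + P * Y + Y + q * l * Y + P * l * Y + l * Y := by
      ring
    have h9 : q ≤ q * Y := le_mul_of_one_le_right hlog h2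
    have h10 : l ≤ l * Y := le_mul_of_one_le_right hl h2
    have : 0 ≤ q * l * Y + P * l * Y := by positivity
    rw [h8]; linarith
  calc _ ≤ (q + p / (a / 2) + 1) * (1 + l) * Y * step (a / 2) n :=
        mul_le_mul_of_nonneg_right h5 (step_pos _ _).le
    _ = _ := by rw [mul_assoc, h4, mul_one]

/-- Among the numbers `k ^ k` there is one between `T` and `T ^ 3`. -/
lemma exists_self_pow_between {T : ℝ} (hT : 4 < T) :
    ∃ k : ℕ, 3 ≤ k ∧ T ≤ (k : ℝ) ^ k ∧ (k : ℝ) ^ k ≤ T ^ 3 := by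
  have hex : ∃ k : ℕ, T ≤ (k : ℝ) ^ k := by
    obtain ⟨m, hm⟩ := exists_nat_ge T
    refine ⟨m + 1, hm.trans ?_⟩
    have : (m : ℝ) ≤ ((m + 1 : ℕ) : ℝ) := by push_cast; linarith
    exact this.trans (le_self_pow₀ (by push_cast; linarith [(Nat.cast_nonneg m : (0 : ℝ) ≤ m)])
      (by omega))
  classical
  have hk := Nat.find_spec hex
  have hmin := fun m => Nat.find_min (H := hex) (m := m)
  set k := Nat.find hex
  have hk3 : 3 ≤ k := by
    by_contra hlt
    have : k = 0 ∨ k = 1 ∨ k = 2 := by omega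
    rcases this with h | h | h <;> rw [h] at hk <;> norm_num at hk <;> linarith
  refine ⟨k, hk3, hk, ?_⟩
  -- By minimality of `k = j + 1`, `j ^ j < T`. It remains to see that `(j + 1) ^ (j + 1) ≤ (j ^ j)
  -- ^ 3`, which follows from `j + 1 ≤ j²` and `j + 1 ≤ 2 j ≤ j ^ j`, valid since `j ≥ 2`.
  obtain ⟨j, hj⟩ : ∃ j, k = j + 1 := ⟨k - 1, by omega⟩
  have hjT : (j : ℝ) ^ j < T := not_le.1 (hmin j (by omega))
  have hj2 : 2 ≤ j := by omega
  rw [hj]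
  have h2 : 2 * j ≤ j ^ j := by
    calc 2 * j ≤ j * j := Nat.mul_le_mul_right _ hj2
      _ = j ^ 2 := by ring
      _ ≤ j ^ j := Nat.pow_le_pow_right (by omega) hj2
  have h3 : (j + 1) ^ (j + 1) ≤ (j ^ j) ^ 3 := by
    calc (j + 1) ^ (j + 1) = (j + 1) ^ j * (j + 1) := pow_succ _ _
      _ ≤ (j * j) ^ j * (2 * j) := Nat.mul_le_mul (Nat.pow_le_pow_left (by nlinarith) _) (by omega)
      _ ≤ (j * j) ^ j * (j ^ j) := Nat.mul_le_mul_left _ h2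
      _ = (j ^ j) ^ 3 := by rw [mul_pow]; ring
  calc (((j + 1 : ℕ) : ℝ)) ^ (j + 1) ≤ ((j : ℝ) ^ j) ^ 3 := by exact_mod_cast h3
    _ ≤ T ^ 3 := by gcongr

end GTD

namespace GTD

/-! ### Exponential moments of linear recursions -/

/-- Hoeffding's lemma for a centered random variable bounded by `m`. -/
lemma lintegral_exp_le {𝒳 : Type*} [MeasurableSpace 𝒳] {ν : Measure 𝒳} [IsProbabilityMeasure ν]
    {f : 𝒳 → ℝ} (hf : Measurable f) {m : ℝ} (hm : 0 ≤ m) (hb : ∀ x, |f x| ≤ m)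
    (h0 : ∫ x, f x ∂ν = 0) :
    ∫⁻ x, ENNReal.ofReal (Real.exp (f x)) ∂ν ≤ ENNReal.ofReal (Real.exp (m ^ 2 / 2)) := by
  have h := hasSubgaussianMGF_of_mem_Icc_of_integral_eq_zero (μ := ν) (X := f) (a := -m) (b := m)
    hf.aemeasurable (ae_of_all _ fun x => abs_le.1 (hb x)) h0
  have hint := h.integrable_exp_mul 1
  have hle := h.mgf_le 1
  simp only [one_mul] at hint
  rw [← ofReal_integral_eq_lintegral_ofReal hint (ae_of_all _ fun x => (Real.exp_pos _).le)]
  refine ENNReal.ofReal_le_ofReal ?_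
  have e1 : mgf f ν 1 = ∫ x, Real.exp (f x) ∂ν := by simp [mgf]
  rw [← e1]
  refine hle.trans (Real.exp_le_exp.2 ?_)
  have : ‖m - -m‖ = 2 * m := by rw [Real.norm_eq_abs, abs_of_nonneg (by linarith)]; ring
  push_cast
  rw [this]
  apply le_of_eq; ring

/-- One step of a linear recursion driven by conditionally centered, bounded noise. -/
lemma lintegral_exp_inner_step {V T 𝒳 Ω : Type*} [NormedAddCommGroup V] [InnerProductSpace ℝ V]
    [MeasurableSpace V] [BorelSpace V] [SecondCountableTopology V] [MeasurableSpace T]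
    [MeasurableSpace 𝒳] [MeasurableSpace Ω]
    {P : Measure Ω} [IsProbabilityMeasure P] {s : Ω → T} {x : Ω → 𝒳} (hs : Measurable s)
    (hx : Measurable x) (hind : IndepFun s x P) {ζ ξ : T → V} (hζ : Measurable ζ)
    (hξ : Measurable ξ) {N : T → 𝒳 → V} (hN : Measurable (Function.uncurry N)) {m a q σ : ℝ} (ha : 0 ≤ a)
    (hm : 0 ≤ m) (hb : ∀ t y, ‖N t y‖ ≤ m) (h0 : ∀ t v, ∫ y, ⟪v, N t y⟫_ℝ ∂(P.map x) = 0)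
    (hσ : ∀ v : V, ∫⁻ ω, ENNReal.ofReal (Real.exp ⟪v, ζ (s ω)⟫_ℝ) ∂P ≤
      ENNReal.ofReal (Real.exp (‖v‖ ^ 2 * σ / 2))) (hσ0 : 0 ≤ σ)
    (hξζ : ∀ v : V, ∃ v' : V, ‖v'‖ ^ 2 ≤ q * ‖v‖ ^ 2 ∧ ∀ t, ⟪v, ξ t⟫_ℝ = ⟪v', ζ t⟫_ℝ) (v : V) :
    ∫⁻ ω, ENNReal.ofReal (Real.exp ⟪v, ξ (s ω) + a • N (s ω) (x ω)⟫_ℝ) ∂P ≤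
      ENNReal.ofReal (Real.exp (‖v‖ ^ 2 * (q * σ + a ^ 2 * m ^ 2) / 2)) := by
  -- Testing the contracted state against `v` is testing the old state against a shorter `v'`. By
  -- independence the fresh sample can be integrated first, with the state frozen, where Hoeffding
  -- applies.
  obtain ⟨v', hv', hvv'⟩ := hξζ v
  have : IsProbabilityMeasure (P.map x) := Measure.isProbabilityMeasure_map hx.aemeasurable
  have hmap := (indepFun_iff_map_prod_eq_prod_map_map hs.aemeasurable hx.aemeasurable).1 hind
  have hmeas : Measurable fun z : T × 𝒳 =>
      ENNReal.ofReal (Real.exp ⟪v, ξ z.1 + a • N z.1 z.2⟫_ℝ) := by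
    have hN' : Measurable fun z : T × 𝒳 => N z.1 z.2 := hN
    fun_prop
  calc ∫⁻ ω, ENNReal.ofReal (Real.exp ⟪v, ξ (s ω) + a • N (s ω) (x ω)⟫_ℝ) ∂P
      = ∫⁻ z, ENNReal.ofReal (Real.exp ⟪v, ξ z.1 + a • N z.1 z.2⟫_ℝ)
          ∂(P.map fun ω => (s ω, x ω)) := (lintegral_map hmeas (hs.prodMk hx)).symm
    _ = ∫⁻ t, ∫⁻ y, ENNReal.ofReal (Real.exp ⟪v, ξ t + a • N t y⟫_ℝ) ∂(P.map x) ∂(P.map s) := by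
        rw [hmap, lintegral_prod _ hmeas.aemeasurable]
    _ ≤ ∫⁻ t, ENNReal.ofReal (Real.exp ⟪v', ζ t⟫_ℝ) *
          ENNReal.ofReal (Real.exp ((a * (‖v‖ * m)) ^ 2 / 2)) ∂(P.map s) := by
        refine lintegral_mono fun t => ?_
        have hNt : Measurable (N t) := hN.comp measurable_prodMk_left
        have e : ∀ y, ENNReal.ofReal (Real.exp ⟪v, ξ t + a • N t y⟫_ℝ) =
            ENNReal.ofReal (Real.exp ⟪v', ζ t⟫_ℝ) *
              ENNReal.ofReal (Real.exp (a * ⟪v, N t y⟫_ℝ)) := fun y => by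
          rw [inner_add_right, inner_smul_right, Real.exp_add, hvv',
            ENNReal.ofReal_mul (Real.exp_pos _).le]
        simp only [e]
        rw [lintegral_const_mul _ (by fun_prop)]
        refine mul_le_mul_right ?_ _
        refine lintegral_exp_le (by fun_prop) (by positivity) (fun y => ?_) ?_
        · rw [abs_mul, abs_of_nonneg ha]
          refine mul_le_mul_of_nonneg_left ((abs_real_inner_le_norm _ _).trans ?_) ha
          exact mul_le_mul_of_nonneg_left (hb t y) (norm_nonneg _)
        · rw [integral_const_mul, h0, mul_zero]
    _ = (∫⁻ ω, ENNReal.ofReal (Real.exp ⟪v', ζ (s ω)⟫_ℝ) ∂P) *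
          ENNReal.ofReal (Real.exp ((a * (‖v‖ * m)) ^ 2 / 2)) := by
        rw [lintegral_mul_const _ (by fun_prop), lintegral_map (by fun_prop) hs]
    _ ≤ ENNReal.ofReal (Real.exp (‖v'‖ ^ 2 * σ / 2)) *
          ENNReal.ofReal (Real.exp ((a * (‖v‖ * m)) ^ 2 / 2)) := mul_le_mul_left (hσ v') _
    _ ≤ _ := by
        rw [← ENNReal.ofReal_mul (Real.exp_pos _).le, ← Real.exp_add]
        refine ENNReal.ofReal_le_ofReal (Real.exp_le_exp.2 ?_)
        have := mul_le_mul_of_nonneg_right hv' hσ0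
        nlinarith

/-- Chernoff bound for one coordinate. -/
lemma measure_inner_ge_le {V Ω : Type*} [NormedAddCommGroup V] [InnerProductSpace ℝ V]
    [MeasurableSpace V] [BorelSpace V] [SecondCountableTopology V] [MeasurableSpace Ω]
    {P : Measure Ω} {Z : Ω → V} (hZ : Measurable Z) {σ : ℝ} (hσ : 0 < σ)
    (h : ∀ v : V, ∫⁻ ω, ENNReal.ofReal (Real.exp ⟪v, Z ω⟫_ℝ) ∂P ≤
      ENNReal.ofReal (Real.exp (‖v‖ ^ 2 * σ / 2))) {e : V} (he : ‖e‖ = 1) {c : ℝ} (hc : 0 ≤ c) :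
    P {ω | c ≤ ⟪e, Z ω⟫_ℝ} ≤ ENNReal.ofReal (Real.exp (-(c ^ 2 / (2 * σ)))) := by
  -- The multiplier `c / σ` minimizes the Chernoff exponent `λ² σ / 2 - λ c`.
  have h1 := h ((c / σ) • e)
  have h2 := mul_meas_ge_le_lintegral (μ := P)
    (f := fun ω => ENNReal.ofReal (Real.exp ⟪(c / σ) • e, Z ω⟫_ℝ)) (by fun_prop)
    (ENNReal.ofReal (Real.exp (c / σ * c)))
  have hsub : {ω | c ≤ ⟪e, Z ω⟫_ℝ} ⊆ {ω | ENNReal.ofReal (Real.exp (c / σ * c)) ≤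
      ENNReal.ofReal (Real.exp ⟪(c / σ) • e, Z ω⟫_ℝ)} := fun ω hω => by
    refine ENNReal.ofReal_le_ofReal (Real.exp_le_exp.2 ?_)
    rw [real_inner_smul_left]
    exact mul_le_mul_of_nonneg_left hω (by positivity)
  have h3 : ENNReal.ofReal (Real.exp (c / σ * c)) * P {ω | c ≤ ⟪e, Z ω⟫_ℝ} ≤
      ENNReal.ofReal (Real.exp (c ^ 2 / (2 * σ))) := by
    refine (mul_le_mul_right (measure_mono hsub) _).trans (h2.trans (h1.trans (le_of_eq ?_)))
    rw [norm_smul, he, Real.norm_eq_abs, mul_one, sq_abs]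
    congr 2
    field_simp
  calc P {ω | c ≤ ⟪e, Z ω⟫_ℝ}
      = ENNReal.ofReal (Real.exp (-(c / σ * c))) *
          (ENNReal.ofReal (Real.exp (c / σ * c)) * P {ω | c ≤ ⟪e, Z ω⟫_ℝ}) := by
        rw [← mul_assoc, ← ENNReal.ofReal_mul (Real.exp_pos _).le, ← Real.exp_add]
        simp
    _ ≤ ENNReal.ofReal (Real.exp (-(c / σ * c))) * ENNReal.ofReal (Real.exp (c ^ 2 / (2 * σ))) :=
        mul_le_mul_right h3 _
    _ = _ := by
        rw [← ENNReal.ofReal_mul (Real.exp_pos _).le, ← Real.exp_add]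
        congr 2
        field_simp
        ring

/-- Tail bound for the norm of a sub-Gaussian vector. -/
lemma measure_norm_gt_le {d : ℕ} (hd : 0 < d) {Ω : Type*} [MeasurableSpace Ω] {P : Measure Ω}
    {Z : Ω → Vec d} (hZ : Measurable Z) {σ : ℝ} (hσ : 0 < σ)
    (h : ∀ v : Vec d, ∫⁻ ω, ENNReal.ofReal (Real.exp ⟪v, Z ω⟫_ℝ) ∂P ≤
      ENNReal.ofReal (Real.exp (‖v‖ ^ 2 * σ / 2))) {r : ℝ} (hr : 0 ≤ r) :
    P {ω | r < ‖Z ω‖} ≤ ENNReal.ofReal (2 * d * Real.exp (-(r ^ 2 / (2 * d * σ)))) := by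
  have hd' : (0 : ℝ) < d := by exact_mod_cast hd
  -- A vector of norm larger than `r` has a coordinate of modulus larger than `r / √d`; with both
  -- signs this gives `2 d` events.
  set c := r / √d with hcdef
  have hc : 0 ≤ c := by positivity
  have hc2 : c ^ 2 = r ^ 2 / d := by rw [hcdef, div_pow, Real.sq_sqrt hd'.le]
  let e : Fin d → Vec d := fun i => EuclideanSpace.single i 1
  have he : ∀ i, ‖e i‖ = 1 := fun i => by simp [e]
  have hsub : {ω | r < ‖Z ω‖} ⊆
      ⋃ i : Fin d, ({ω | c ≤ ⟪e i, Z ω⟫_ℝ} ∪ {ω | c ≤ ⟪-e i, Z ω⟫_ℝ}) := by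
    intro ω hω
    by_contra hno
    simp only [Set.mem_iUnion, Set.mem_union, Set.mem_ofPred_eq, not_exists, not_or, not_le,
      inner_neg_left] at hno
    have hi : ∀ i, (Z ω i) ^ 2 ≤ r ^ 2 / d := fun i => by
      have h1 := hno i
      have h2 : ⟪e i, Z ω⟫_ℝ = Z ω i := by simp [e, EuclideanSpace.inner_single_left]
      rw [h2] at h1
      rw [← hc2]
      exact sq_le_sq' (by linarith [h1.2]) h1.1.le
    have hn : ‖Z ω‖ ^ 2 ≤ r ^ 2 := by
      rw [EuclideanSpace.real_norm_sq_eq]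
      calc ∑ i, (Z ω i) ^ 2 ≤ ∑ _i : Fin d, r ^ 2 / d := Finset.sum_le_sum fun i _ => hi i
        _ = r ^ 2 := by simp; field_simp
    have : ‖Z ω‖ ≤ r := abs_le_of_sq_le_sq' hn hr |>.2
    exact absurd hω (not_lt.2 this)
  have hex : c ^ 2 / (2 * σ) = r ^ 2 / (2 * d * σ) := by rw [hc2]; field_simp
  refine (measure_mono hsub).trans ((measure_iUnion_le _).trans ?_)
  rw [tsum_fintype]
  calc ∑ i : Fin d, P ({ω | c ≤ ⟪e i, Z ω⟫_ℝ} ∪ {ω | c ≤ ⟪-e i, Z ω⟫_ℝ})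
      ≤ ∑ _i : Fin d, ENNReal.ofReal (2 * Real.exp (-(r ^ 2 / (2 * d * σ)))) := by
        refine Finset.sum_le_sum fun i _ => (measure_union_le _ _).trans ?_
        rw [two_mul, ENNReal.ofReal_add (Real.exp_pos _).le (Real.exp_pos _).le, ← hex]
        exact add_le_add (measure_inner_ge_le hZ hσ h (he i) hc)
          (measure_inner_ge_le hZ hσ h (by rw [norm_neg, he i]) hc)
    _ = _ := by
        rw [Finset.sum_const, Finset.card_univ, Fintype.card_fin, nsmul_eq_mul,
          ← ENNReal.ofReal_natCast, ← ENNReal.ofReal_mul hd'.le]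
        congr 1; ring

/-! ### Recursions driven by independent variables -/

/-- The state of a recursion driven by independent variables is independent of the next one. -/
lemma exists_measurable_of_recursion {T 𝒳 Ω : Type*} [MeasurableSpace T] [MeasurableSpace 𝒳]
    {x : ℕ → Ω → 𝒳} {s : ℕ → Ω → T} {F : ℕ → T → 𝒳 → T}
    (hF : ∀ n, Measurable (Function.uncurry (F n))) {t₀ : T} (h0 : ∀ ω, s 0 ω = t₀)
    (hs : ∀ n ω, s (n + 1) ω = F n (s n ω) (x n ω)) (n : ℕ) :
    ∃ g : (Finset.range n → 𝒳) → T, Measurable g ∧ ∀ ω, s n ω = g fun i => x i ω := by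
  induction n with
  | zero => exact ⟨fun _ => t₀, measurable_const, h0⟩
  | succ n ih =>
    obtain ⟨g, hg, hgs⟩ := ih
    refine ⟨fun y => F n (g fun i => y ⟨i, Finset.mem_range.2 (by
      have := Finset.mem_range.1 i.2; omega)⟩) (y ⟨n, by simp⟩), ?_, fun ω => ?_⟩
    · have h1 : Measurable fun y : Finset.range (n + 1) → 𝒳 => g fun i => y ⟨i, Finset.mem_range.2 (by
          have := Finset.mem_range.1 i.2; omega)⟩ :=
        hg.comp (measurable_pi_lambda _ fun i => measurable_pi_apply _)
      exact (hF n).comp (h1.prodMk (measurable_pi_apply _))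
    · rw [hs, hgs]

lemma measurable_of_recursion {T 𝒳 Ω : Type*} [MeasurableSpace T] [MeasurableSpace 𝒳]
    [MeasurableSpace Ω] {x : ℕ → Ω → 𝒳} (hx : ∀ n, Measurable (x n)) {s : ℕ → Ω → T}
    {F : ℕ → T → 𝒳 → T} (hF : ∀ n, Measurable (Function.uncurry (F n))) {t₀ : T}
    (h0 : ∀ ω, s 0 ω = t₀) (hs : ∀ n ω, s (n + 1) ω = F n (s n ω) (x n ω)) (n : ℕ) :
    Measurable (s n) := by
  obtain ⟨g, hg, hgs⟩ := exists_measurable_of_recursion hF h0 hs n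
  rw [funext hgs]
  exact hg.comp (measurable_pi_lambda _ fun i => hx i)

/-- The state at time `n` is a function of the samples before `n`, a block of indices disjoint from
`{n}`. -/
lemma indepFun_of_recursion {T 𝒳 Ω : Type*} [MeasurableSpace T] [MeasurableSpace 𝒳]
    [MeasurableSpace Ω] {P : Measure Ω} {x : ℕ → Ω → 𝒳} (hx : ∀ n, Measurable (x n))
    (hind : iIndepFun x P) {s : ℕ → Ω → T} {F : ℕ → T → 𝒳 → T}
    (hF : ∀ n, Measurable (Function.uncurry (F n))) {t₀ : T} (h0 : ∀ ω, s 0 ω = t₀)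
    (hs : ∀ n ω, s (n + 1) ω = F n (s n ω) (x n ω)) (n : ℕ) : IndepFun (s n) (x n) P := by
  obtain ⟨g, hg, hgs⟩ := exists_measurable_of_recursion hF h0 hs n
  have h := hind.indepFun_finset (Finset.range n) {n} (by simp) hx
  have h2 := h.comp hg (measurable_pi_apply (⟨n, by simp⟩ : ({n} : Finset ℕ)))
  rw [funext hgs]
  exact h2

end GTD

namespace GTD

/-! ### Decoupled two-timescale dynamics -/

lemma ballProj_of_norm_le {d : ℕ} {R : ℝ} {x : Vec d} (h : ‖x‖ ≤ R) : ballProj R x = x := by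
  unfold ballProj
  rcases eq_or_ne x 0 with rfl | hx
  · simp
  · rw [min_eq_left, one_smul]
    rwa [le_div_iff₀ (norm_pos_iff.2 hx), one_mul]

lemma norm_ballProj_le {d : ℕ} {R : ℝ} (hR : 0 ≤ R) (x : Vec d) : ‖ballProj R x‖ ≤ R := by
  unfold ballProj
  rcases eq_or_ne x 0 with rfl | hx
  · simpa
  · have hx' := norm_pos_iff.2 hx
    rw [norm_smul, Real.norm_eq_abs, abs_of_nonneg (le_min zero_le_one (by positivity))]
    calc _ ≤ R / ‖x‖ * ‖x‖ := by gcongr; exact min_le_right _ _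
      _ = R := by field_simp

/-- Expanding the square, coercivity gains `2 a l` and the quadratic term costs `a² M² ≤ a l`. No
symmetry of `X` is needed. -/
lemma norm_sub_smul_sq_le {V : Type*} [NormedAddCommGroup V] [InnerProductSpace ℝ V]
    {X : V →L[ℝ] V} {l M a : ℝ} (hX : ‖X‖ ≤ M) (hl : ∀ v, l * ‖v‖ ^ 2 ≤ ⟪X v, v⟫_ℝ) (ha : 0 ≤ a)
    (haM : a * M ^ 2 ≤ l) (v : V) : ‖v - a • X v‖ ^ 2 ≤ (1 - a * l) * ‖v‖ ^ 2 := by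
  have h1 : ‖X v‖ ≤ M * ‖v‖ := X.le_of_opNorm_le hX v
  have h2 : ‖X v‖ ^ 2 ≤ M ^ 2 * ‖v‖ ^ 2 := by
    rw [← mul_pow]; exact pow_le_pow_left₀ (norm_nonneg _) h1 2
  rw [norm_sub_sq_real, inner_smul_right, norm_smul, Real.norm_eq_abs, mul_pow, sq_abs,
    real_inner_comm]
  have h3 := mul_le_mul_of_nonneg_left (hl v) ha
  have h4 : a ^ 2 * ‖X v‖ ^ 2 ≤ a * l * ‖v‖ ^ 2 := by
    calc a ^ 2 * ‖X v‖ ^ 2 ≤ a ^ 2 * (M ^ 2 * ‖v‖ ^ 2) := by gcongr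
      _ = a * (a * M ^ 2) * ‖v‖ ^ 2 := by ring
      _ ≤ _ := by gcongr
  linarith

lemma norm_sub_smul_le {V : Type*} [NormedAddCommGroup V] [InnerProductSpace ℝ V]
    {X : V →L[ℝ] V} {l M a : ℝ} (hX : ‖X‖ ≤ M) (hl : ∀ v, l * ‖v‖ ^ 2 ≤ ⟪X v, v⟫_ℝ) (ha : 0 ≤ a)
    (haM : a * M ^ 2 ≤ l) (hal : a * l ≤ 1) (v : V) :
    ‖v - a • X v‖ ≤ (1 - a * l / 2) * ‖v‖ := by
  refine abs_le_of_sq_le_sq' ?_ (mul_nonneg (by linarith) (norm_nonneg _)) |>.2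
  rw [mul_pow]
  refine (norm_sub_smul_sq_le hX hl ha haM v).trans ?_
  gcongr
  nlinarith [sq_nonneg (a * l)]

/-- The data of a linear two-timescale system in decoupled coordinates: for `t = θ - θs` and
`u = w + G t`, the mean drifts are `-(X t) - H (Y u)` and `-(Y u)`, with `X` and `Y` coercive. -/
structure Decoupled (d : ℕ) where
  X : Vec d →L[ℝ] Vec d
  Y : Vec d →L[ℝ] Vec d
  G : Vec d →L[ℝ] Vec d
  H : Vec d →L[ℝ] Vec d
  θs : Vec d
  l : ℝ
  M : ℝ
  l_pos : 0 < l
  l_le_one : l ≤ 1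
  one_le_M : 1 ≤ M
  norm_X : ‖X‖ ≤ M
  norm_Y : ‖Y‖ ≤ M
  norm_G : ‖G‖ ≤ M
  norm_H : ‖H‖ ≤ M
  coercive_X : ∀ v, l * ‖v‖ ^ 2 ≤ ⟪X v, v⟫_ℝ
  coercive_Y : ∀ v, l * ‖v‖ ^ 2 ≤ ⟪Y v, v⟫_ℝ

namespace Decoupled

variable {d : ℕ} (D : Decoupled d)

/-- The fast coordinate. -/
def fast (θ w : Vec d) : Vec d := w + D.G (θ - D.θs)

/-- The slow coordinate, with the leading influence of the fast one removed. -/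
def slow (ρ : ℝ) (θ w : Vec d) : Vec d := θ - D.θs - ρ • D.H (D.fast θ w)

/-- The mean drift of `θ`. -/
def driftθ (θ w : Vec d) : Vec d := -D.X (θ - D.θs) - D.H (D.Y (D.fast θ w))

/-- The mean drift of `w`. -/
def driftW (θ w : Vec d) : Vec d := -D.Y (D.fast θ w)

/-- The noise in the slow coordinate. -/
def noiseSlow (ρ κ : ℝ) (m₁ m₂ : Vec d) : Vec d := m₁ - κ • D.H m₂ - (κ * ρ) • D.H (D.G m₁)

/-- The noise in the fast coordinate. -/
def noiseFast (ρ : ℝ) (m₁ m₂ : Vec d) : Vec d := m₂ + ρ • D.G m₁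

lemma norm_X_le (v : Vec d) : ‖D.X v‖ ≤ D.M * ‖v‖ := D.X.le_of_opNorm_le D.norm_X v
lemma norm_Y_le (v : Vec d) : ‖D.Y v‖ ≤ D.M * ‖v‖ := D.Y.le_of_opNorm_le D.norm_Y v
lemma norm_G_le (v : Vec d) : ‖D.G v‖ ≤ D.M * ‖v‖ := D.G.le_of_opNorm_le D.norm_G v
lemma norm_H_le (v : Vec d) : ‖D.H v‖ ≤ D.M * ‖v‖ := D.H.le_of_opNorm_le D.norm_H v

lemma slow_add_smul (ρ : ℝ) (θ w : Vec d) :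
    D.slow ρ θ w + ρ • D.H (D.fast θ w) = θ - D.θs := by simp [slow]

lemma M_nonneg : 0 ≤ D.M := zero_le_one.trans D.one_le_M

/-- The recursion of the slow coordinate. -/
lemma norm_slow_step_le {ρ κ b : ℝ} (θ w m₁ m₂ : Vec d) (hρ : 0 ≤ ρ) (hρ1 : ρ ≤ 1) (hκ : 0 ≤ κ)
    (hκ1 : κ ≤ 1) (hb : 0 ≤ b) (hb1 : b ≤ 1) (hρκ : ρ - κ * ρ ≤ ρ * b * ρ) :
    ‖D.slow (κ * ρ) (θ + (ρ * b) • (D.driftθ θ w + m₁)) (w + b • (D.driftW θ w + m₂)) -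
      (D.slow ρ θ w - (ρ * b) • D.X (D.slow ρ θ w) + (ρ * b) • D.noiseSlow ρ κ m₁ m₂)‖ ≤
    5 * D.M ^ 4 * (ρ * b) * ρ * (‖D.slow ρ θ w‖ + ‖D.fast θ w‖) := by
  have hM := D.one_le_M
  have hM0 := D.M_nonneg
  set u := D.fast θ w with hu
  set z := D.slow ρ θ w with hz
  -- The terms `(ρ * b) • H (Y u)` from the drift of `θ` and from the corrector cancel. What remains
  -- comes from the change of `ρ` (two terms), from `X t - X z = ρ X (H u)`, and from the reaction
  -- of `u` to the motion of `θ` through `G`.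
  have key : D.slow (κ * ρ) (θ + (ρ * b) • (D.driftθ θ w + m₁)) (w + b • (D.driftW θ w + m₂)) -
      (z - (ρ * b) • D.X z + (ρ * b) • D.noiseSlow ρ κ m₁ m₂) =
      (ρ - κ * ρ) • D.H u - (ρ * b * ρ) • D.X (D.H u) - ((ρ - κ * ρ) * b) • D.H (D.Y u) +
        (κ * ρ * (ρ * b)) • D.H (D.G (D.X (z + ρ • D.H u) + D.H (D.Y u))) := by
    rw [hz, slow_add_smul]
    simp only [hu, slow, fast, driftθ, driftW, noiseSlow, map_add, map_sub, map_smul, map_neg]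
    module
  rw [key]
  have hd0 : 0 ≤ ρ - κ * ρ := by nlinarith
  have hκρ : κ * ρ ≤ ρ := by nlinarith
  have hu0 := norm_nonneg u
  have hz0 := norm_nonneg z
  have hHu := D.norm_H_le u
  have hYu := D.norm_Y_le u
  have hHY : ‖D.H (D.Y u)‖ ≤ D.M ^ 2 * ‖u‖ := by
    calc _ ≤ D.M * ‖D.Y u‖ := D.norm_H_le _
      _ ≤ D.M * (D.M * ‖u‖) := by gcongr
      _ = _ := by ring
  have hXH : ‖D.X (D.H u)‖ ≤ D.M ^ 2 * ‖u‖ := by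
    calc _ ≤ D.M * ‖D.H u‖ := D.norm_X_le _
      _ ≤ D.M * (D.M * ‖u‖) := by gcongr
      _ = _ := by ring
  have hX : ‖D.X (z + ρ • D.H u)‖ ≤ D.M * (‖z‖ + D.M * ‖u‖) := by
    refine (D.norm_X_le _).trans ?_
    gcongr
    refine (norm_add_le _ _).trans ?_
    gcongr
    rw [norm_smul, Real.norm_eq_abs, abs_of_nonneg hρ]
    calc _ ≤ 1 * (D.M * ‖u‖) := by gcongr
      _ = _ := one_mul _
  have hlast : ‖D.H (D.G (D.X (z + ρ • D.H u) + D.H (D.Y u)))‖ ≤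
      D.M ^ 2 * (D.M * (‖z‖ + D.M * ‖u‖) + D.M ^ 2 * ‖u‖) := by
    calc _ ≤ D.M * ‖D.G (D.X (z + ρ • D.H u) + D.H (D.Y u))‖ := D.norm_H_le _
      _ ≤ D.M * (D.M * ‖D.X (z + ρ • D.H u) + D.H (D.Y u)‖) := by
        gcongr; exact D.norm_G_le _
      _ ≤ D.M * (D.M * (D.M * (‖z‖ + D.M * ‖u‖) + D.M ^ 2 * ‖u‖)) := by
        gcongr; exact (norm_add_le _ _).trans (add_le_add hX hHY)
      _ = _ := by ring
  have t1 : ‖(ρ - κ * ρ) • D.H u‖ ≤ ρ * b * ρ * (D.M * ‖u‖) := by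
    rw [norm_smul, Real.norm_eq_abs, abs_of_nonneg hd0]; gcongr
  have t2 : ‖(ρ * b * ρ) • D.X (D.H u)‖ ≤ ρ * b * ρ * (D.M ^ 2 * ‖u‖) := by
    rw [norm_smul, Real.norm_eq_abs, abs_of_nonneg (by positivity)]; gcongr
  have t3 : ‖((ρ - κ * ρ) * b) • D.H (D.Y u)‖ ≤ ρ * b * ρ * (D.M ^ 2 * ‖u‖) := by
    rw [norm_smul, Real.norm_eq_abs, abs_of_nonneg (by positivity)]
    exact mul_le_mul ((mul_le_of_le_one_right hd0 hb1).trans hρκ) hHY (norm_nonneg _)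
      (by positivity)
  have t4 : ‖(κ * ρ * (ρ * b)) • D.H (D.G (D.X (z + ρ • D.H u) + D.H (D.Y u)))‖ ≤
      ρ * b * ρ * (D.M ^ 2 * (D.M * (‖z‖ + D.M * ‖u‖) + D.M ^ 2 * ‖u‖)) := by
    rw [norm_smul, Real.norm_eq_abs, abs_of_nonneg (by positivity)]
    refine mul_le_mul ?_ hlast (norm_nonneg _) (by positivity)
    calc κ * ρ * (ρ * b) ≤ ρ * (ρ * b) := by gcongr
      _ = _ := by ring
  have htri := (norm_add_le ((ρ - κ * ρ) • D.H u - (ρ * b * ρ) • D.X (D.H u) -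
    ((ρ - κ * ρ) * b) • D.H (D.Y u)) ((κ * ρ * (ρ * b)) •
      D.H (D.G (D.X (z + ρ • D.H u) + D.H (D.Y u))))).trans (add_le_add_left
        ((norm_sub_le _ _).trans (add_le_add_left (norm_sub_le _ _) _)) _)
  have m1 : D.M ≤ D.M ^ 4 := le_self_pow₀ hM (by norm_num)
  have m2 : D.M ^ 2 ≤ D.M ^ 4 := pow_le_pow_right₀ hM (by norm_num)
  have m3 : D.M ^ 3 ≤ D.M ^ 4 := pow_le_pow_right₀ hM (by norm_num)
  have hc : 0 ≤ ρ * b * ρ := by positivity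
  have hsum : D.M * ‖u‖ + D.M ^ 2 * ‖u‖ + D.M ^ 2 * ‖u‖ +
      D.M ^ 2 * (D.M * (‖z‖ + D.M * ‖u‖) + D.M ^ 2 * ‖u‖) ≤ 5 * D.M ^ 4 * (‖z‖ + ‖u‖) := by
    nlinarith [mul_le_mul_of_nonneg_right m1 hu0, mul_le_mul_of_nonneg_right m2 hu0,
      mul_le_mul_of_nonneg_right m3 hz0, mul_nonneg (pow_nonneg hM0 4) hz0]
  have := mul_le_mul_of_nonneg_left hsum hc
  linarith

/-- The recursion of the fast coordinate. -/
lemma norm_fast_step_le {ρ b : ℝ} (θ w m₁ m₂ : Vec d) (hρ : 0 ≤ ρ) (hρ1 : ρ ≤ 1)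
    (hb : 0 ≤ b) :
    ‖D.fast (θ + (ρ * b) • (D.driftθ θ w + m₁)) (w + b • (D.driftW θ w + m₂)) -
      (D.fast θ w - b • D.Y (D.fast θ w) + b • D.noiseFast ρ m₁ m₂)‖ ≤
    5 * D.M ^ 4 * b * ρ * (‖D.slow ρ θ w‖ + ‖D.fast θ w‖) := by
  have hM := D.one_le_M
  have hM0 := D.M_nonneg
  set u := D.fast θ w with hu
  set z := D.slow ρ θ w with hz
  -- The only perturbation of the fast recursion is the drift of `θ` seen through `G`, which is
  -- smaller than the fast step by the factor `ρ`.
  have key : D.fast (θ + (ρ * b) • (D.driftθ θ w + m₁)) (w + b • (D.driftW θ w + m₂)) -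
      (u - b • D.Y u + b • D.noiseFast ρ m₁ m₂) =
      (b * ρ) • -D.G (D.X (z + ρ • D.H u) + D.H (D.Y u)) := by
    rw [hz, slow_add_smul]
    simp only [hu, fast, driftθ, driftW, noiseFast, map_add, map_sub, map_smul, map_neg]
    module
  rw [key, norm_smul, norm_neg, Real.norm_eq_abs, abs_of_nonneg (by positivity)]
  have hu0 := norm_nonneg u
  have hz0 := norm_nonneg z
  have hHY : ‖D.H (D.Y u)‖ ≤ D.M ^ 2 * ‖u‖ := by
    calc _ ≤ D.M * ‖D.Y u‖ := D.norm_H_le _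
      _ ≤ D.M * (D.M * ‖u‖) := by gcongr; exact D.norm_Y_le _
      _ = _ := by ring
  have hX : ‖D.X (z + ρ • D.H u)‖ ≤ D.M * (‖z‖ + D.M * ‖u‖) := by
    refine (D.norm_X_le _).trans ?_
    gcongr
    refine (norm_add_le _ _).trans ?_
    gcongr
    rw [norm_smul, Real.norm_eq_abs, abs_of_nonneg hρ]
    calc _ ≤ 1 * (D.M * ‖u‖) := by gcongr; exact D.norm_H_le _
      _ = _ := one_mul _
  have hlast : ‖D.G (D.X (z + ρ • D.H u) + D.H (D.Y u))‖ ≤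
      D.M * (D.M * (‖z‖ + D.M * ‖u‖) + D.M ^ 2 * ‖u‖) := by
    refine (D.norm_G_le _).trans ?_
    gcongr
    exact (norm_add_le _ _).trans (add_le_add hX hHY)
  have m2 : D.M ^ 2 ≤ D.M ^ 4 := pow_le_pow_right₀ hM (by norm_num)
  have m3 : D.M ^ 3 ≤ D.M ^ 4 := pow_le_pow_right₀ hM (by norm_num)
  have hsum : D.M * (D.M * (‖z‖ + D.M * ‖u‖) + D.M ^ 2 * ‖u‖) ≤
      5 * D.M ^ 4 * (‖z‖ + ‖u‖) := by
    nlinarith [mul_le_mul_of_nonneg_right m2 hz0, mul_le_mul_of_nonneg_right m3 hu0,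
      mul_nonneg (pow_nonneg hM0 4) hz0, mul_nonneg (pow_nonneg hM0 4) hu0]
  calc _ ≤ b * ρ * (5 * D.M ^ 4 * (‖z‖ + ‖u‖)) := by gcongr; exact hlast.trans hsum
    _ = _ := by ring

/-- This and the next lemma invert the change of coordinates, `θ - θs = z + ρ H u` and `w = u - G (θ
- θs)`, to compare iterates with the cutoff and projection radii. -/
lemma norm_sub_θs_le {ρ : ℝ} (hρ : 0 ≤ ρ) (hρ1 : ρ ≤ 1) {θ w : Vec d} {r : ℝ}
    (hz : ‖D.slow ρ θ w‖ ≤ r) (hu : ‖D.fast θ w‖ ≤ r) : ‖θ - D.θs‖ ≤ 3 * D.M ^ 2 * r := by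
  have hM := D.one_le_M
  have hr : 0 ≤ r := (norm_nonneg _).trans hz
  rw [← D.slow_add_smul ρ θ w]
  have h1 : ‖ρ • D.H (D.fast θ w)‖ ≤ D.M * r := by
    rw [norm_smul, Real.norm_eq_abs, abs_of_nonneg hρ]
    calc _ ≤ 1 * (D.M * r) := by
          gcongr; exact (D.norm_H_le _).trans (mul_le_mul_of_nonneg_left hu D.M_nonneg)
      _ = _ := one_mul _
  refine (norm_add_le _ _).trans ((add_le_add hz h1).trans ?_)
  nlinarith [mul_le_mul_of_nonneg_right (le_self_pow₀ hM two_ne_zero) hr,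
    mul_le_mul_of_nonneg_right (one_le_pow₀ hM : 1 ≤ D.M ^ 2) hr]

lemma norm_w_le {ρ : ℝ} (hρ : 0 ≤ ρ) (hρ1 : ρ ≤ 1) {θ w : Vec d} {r : ℝ}
    (hz : ‖D.slow ρ θ w‖ ≤ r) (hu : ‖D.fast θ w‖ ≤ r) : ‖w‖ ≤ 3 * D.M ^ 2 * r := by
  have hM := D.one_le_M
  have hM0 := D.M_nonneg
  have hr : 0 ≤ r := (norm_nonneg _).trans hz
  have e : w = D.fast θ w - D.G (D.slow ρ θ w + ρ • D.H (D.fast θ w)) := by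
    rw [slow_add_smul]; simp [fast]
  have h1 : ‖ρ • D.H (D.fast θ w)‖ ≤ D.M * r := by
    rw [norm_smul, Real.norm_eq_abs, abs_of_nonneg hρ]
    calc _ ≤ 1 * (D.M * r) := by
          gcongr; exact (D.norm_H_le _).trans (mul_le_mul_of_nonneg_left hu D.M_nonneg)
      _ = _ := one_mul _
  have h2 : ‖D.G (D.slow ρ θ w + ρ • D.H (D.fast θ w))‖ ≤ D.M * (r + D.M * r) := by
    refine (D.norm_G_le _).trans ?_
    gcongr
    exact (norm_add_le _ _).trans (add_le_add hz h1)
  rw [e]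
  refine (norm_sub_le _ _).trans ((add_le_add hu h2).trans ?_)
  nlinarith [mul_le_mul_of_nonneg_right (le_self_pow₀ hM two_ne_zero) hr,
    mul_le_mul_of_nonneg_right (one_le_pow₀ hM : 1 ≤ D.M ^ 2) hr]

end Decoupled

end GTD

namespace GTD

/-! ### Pathwise analysis on the event that the noise is small -/

/-- An envelope: a transient that decays from `B` at time `n₀`, plus a multiple of the rate. -/
def envelope (B K : ℝ) (n₀ : ℕ) (e : ℕ → ℝ) (n : ℕ) : ℝ :=
  B * (((n₀ : ℝ) + 1) / ((n : ℝ) + 1)) + K * e n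

/-- The transient part satisfies this with equality, because `(1 - 1 / (n + 2)) / (n + 1) = 1 / (n +
2)`. -/
lemma envelope_succ_ge {B K : ℝ} (hK : 0 ≤ K) (n₀ : ℕ) {e : ℕ → ℝ} {n : ℕ}
    (he : (1 - 1 / ((n : ℝ) + 2)) * e n ≤ e (n + 1)) :
    (1 - 1 / ((n : ℝ) + 2)) * envelope B K n₀ e n ≤ envelope B K n₀ e (n + 1) := by
  unfold envelope
  have h1 : (1 - 1 / ((n : ℝ) + 2)) * (B * (((n₀ : ℝ) + 1) / ((n : ℝ) + 1))) =
      B * (((n₀ : ℝ) + 1) / (((n + 1 : ℕ) : ℝ) + 1)) := by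
    push_cast
    have : (n : ℝ) + 1 + 1 = n + 2 := by ring
    rw [this]
    field_simp
    ring
  rw [mul_add, h1]
  have := mul_le_mul_of_nonneg_left he hK
  linarith

lemma envelope_nonneg {B K : ℝ} (hB : 0 ≤ B) (hK : 0 ≤ K) (n₀ : ℕ) {e : ℕ → ℝ}
    (he : ∀ n, 0 ≤ e n) (n : ℕ) : 0 ≤ envelope B K n₀ e n := by
  unfold envelope
  have := he n
  positivity

/-- The contraction gains `a l / 2`. One half of it pays for the coupling (`hη`, with the envelopes
`Ez`, `Eu` of both coordinates brought to `E` by a factor `ρ`), the other half for the decay of the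
envelope itself (`hq`). -/
lemma envelope_step {a l c ρ η q y zn un E E' Ez Eu : ℝ} (ha : 0 ≤ a) (hc : 0 ≤ c) (hρ : 0 ≤ ρ)
    (hal : a * l ≤ 1) (hy : y ≤ E) (hE : 0 ≤ E) (hz : zn ≤ 2 * Ez) (hu : un ≤ 2 * Eu)
    (hEz : ρ * Ez ≤ η * E) (hEu : ρ * Eu ≤ η * E) (hη : 16 * c * η ≤ l) (hq : q ≤ a * l / 4)
    (hE' : (1 - q) * E ≤ E') : (1 - a * l / 2) * y + c * a * ρ * (zn + un) ≤ E' := by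
  have h1 : (1 - a * l / 2) * y ≤ (1 - a * l / 2) * E := by gcongr; linarith
  have h2 : c * a * ρ * (zn + un) ≤ a * l / 4 * E := by
    calc c * a * ρ * (zn + un) ≤ c * a * ρ * (2 * Ez + 2 * Eu) := by gcongr
      _ = 2 * c * a * (ρ * Ez + ρ * Eu) := by ring
      _ ≤ 2 * c * a * (η * E + η * E) := by gcongr
      _ = a / 4 * (16 * c * η) * E := by ring
      _ ≤ a / 4 * l * E := by gcongr
      _ = _ := by ring
  have h3 : q * E ≤ a * l / 4 * E := by gcongr
  linarith

lemma sparseProj_eq_self {d n : ℕ} {R : ℝ} {x : Vec d}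
    (h : ∀ k : ℕ, 0 < k → n = k ^ k - 1 → ‖x‖ ≤ R) : sparseProj n R x = x := by
  unfold sparseProj
  split_ifs with hk
  · obtain ⟨k, hk0, hk⟩ := hk
    exact ballProj_of_norm_le (h k hk0 hk)
  · rfl

/-- Projection times after `k ^ k - 1` come late. -/
lemma projection_time_ratio {k j n₀ n : ℕ} (hk : 0 < k) (h0 : n₀ + 1 = k ^ k) (hj : 0 < j)
    (hn : n = j ^ j - 1) (hlt : n₀ < n) : ((n₀ : ℝ) + 1) / ((n : ℝ) + 1) ≤ 1 / ((k : ℝ) + 1) := by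
  have hj1 : 0 < j ^ j := pow_pos hj j
  have hn1 : n + 1 = j ^ j := by omega
  have hkj : k < j := by
    by_contra hle
    have : j ^ j ≤ k ^ k :=
      (Nat.pow_le_pow_left (not_lt.1 hle) j).trans (Nat.pow_le_pow_right hk (not_lt.1 hle))
    omega
  have h1 : (n₀ + 1) * (k + 1) ≤ n + 1 := by
    rw [h0, hn1]
    calc k ^ k * (k + 1) ≤ (k + 1) ^ k * (k + 1) :=
          Nat.mul_le_mul_right _ (Nat.pow_le_pow_left (by omega) k)
      _ = (k + 1) ^ (k + 1) := (pow_succ _ _).symm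
      _ ≤ j ^ (k + 1) := Nat.pow_le_pow_left hkj _
      _ ≤ j ^ j := Nat.pow_le_pow_right hj hkj
  rw [div_le_div_iff₀ (by positivity) (by positivity), one_mul]
  exact_mod_cast h1

/-- The time `n` is so large that the asymptotic regime of the stepsizes has been reached. -/
structure Decoupled.Late {d : ℕ} (D : Decoupled d) (α β : ℝ) (n : ℕ) : Prop where
  fast : step β n * D.M ^ 2 ≤ D.l
  slow : 1 / ((n : ℝ) + 2) ≤ step α n * D.l / 4
  ratio : 16 * (5 * D.M ^ 4) * step ((α - β) / 2) n ≤ D.l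

/-- Sequences `θ`, `w` that follow the sparsely projected recursion with noise `m₁`, `m₂`. -/
structure Decoupled.IsPath {d : ℕ} (D : Decoupled d) (α β Rθ Rw : ℝ) (θ w m₁ m₂ : ℕ → Vec d) :
    Prop where
  succ_θ : ∀ n, θ (n + 1) =
    sparseProj (n + 1) Rθ (θ n + step α n • (D.driftθ (θ n) (w n) + m₁ n))
  succ_w : ∀ n, w (n + 1) =
    sparseProj (n + 1) Rw (w n + step β n • (D.driftW (θ n) (w n) + m₂ n))

/-- The noise in the slow coordinate at time `n`. -/
def Decoupled.noiseSlowAt {d : ℕ} (D : Decoupled d) (α β : ℝ) (n : ℕ) (m₁ m₂ : Vec d) : Vec d :=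
  D.noiseSlow (step (α - β) n) (step (α - β) (n + 1) / step (α - β) n) m₁ m₂

/-- The noise in the fast coordinate at time `n`. -/
def Decoupled.noiseFastAt {d : ℕ} (D : Decoupled d) (α β : ℝ) (n : ℕ) (m₁ m₂ : Vec d) : Vec d :=
  D.noiseFast (step (α - β) n) m₁ m₂

/-- If the linear recursions driven by the (truncated) noise stay within a multiple of the rate,
then the decoupled coordinates stay within the envelopes. -/
lemma Decoupled.path_le_envelope {d : ℕ} (hd : 0 < d) (D : Decoupled d) {α β Rθ Rw p δ : ℝ}
    (hβ : 0 < β) (hβα : β < α) (hα : α < 1) (hp : 0 ≤ p) (hδ : 0 < δ)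
    {θ w m₁ m₂ : ℕ → Vec d} (hpath : D.IsPath α β Rθ Rw θ w m₁ m₂) {k n₀ : ℕ} (hk : 0 < k)
    (hn₀ : n₀ + 1 = k ^ k) (hlate : ∀ n ≥ n₀, D.Late α β n) {B K B' r : ℝ} (hB : 0 ≤ B)
    (hK : 0 ≤ K) (hB' : ‖D.θs‖ + 3 * D.M ^ 2 * (B + r) ≤ B')
    (hRθ : ‖D.θs‖ + 3 * D.M ^ 2 * (B / (k + 1) + r) ≤ Rθ)
    (hRw : 3 * D.M ^ 2 * (B / (k + 1) + r) ≤ Rw) {Z U : ℕ → Vec d}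
    (hr : ∀ n ≥ n₀, 2 * K * rate d p δ β n ≤ r)
    (hZ0 : Z n₀ = 0) (hU0 : U n₀ = 0)
    (hZs : ∀ n ≥ n₀, ‖θ n‖ ≤ B' → ‖w n‖ ≤ B' → Z (n + 1) =
      Z n - step α n • D.X (Z n) + step α n • D.noiseSlowAt α β n (m₁ n) (m₂ n))
    (hUs : ∀ n ≥ n₀, ‖θ n‖ ≤ B' → ‖w n‖ ≤ B' → U (n + 1) =
      U n - step β n • D.Y (U n) + step β n • D.noiseFastAt α β n (m₁ n) (m₂ n))
    (hZ : ∀ n ≥ n₀, ‖Z n‖ ≤ K * rate d p δ α n) (hU : ∀ n ≥ n₀, ‖U n‖ ≤ K * rate d p δ β n)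
    (hz0 : ‖D.slow (step (α - β) n₀) (θ n₀) (w n₀)‖ ≤ B) (hu0 : ‖D.fast (θ n₀) (w n₀)‖ ≤ B)
    {n : ℕ} (hn : n₀ ≤ n) :
    ‖D.slow (step (α - β) n) (θ n) (w n) - Z n‖ ≤ envelope B K n₀ (rate d p δ α) n ∧
      ‖D.fast (θ n) (w n) - U n‖ ≤ envelope B K n₀ (rate d p δ β) n := by
  have hM := D.one_le_M
  have hM0 := D.M_nonneg
  have hE0 : ∀ a n, 0 ≤ envelope B K n₀ (rate d p δ a) n := fun a =>
    envelope_nonneg hB hK n₀ (rate_nonneg d p δ a)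
  -- from envelope bounds to bounds on the coordinates
  have hcoord : ∀ n ≥ n₀, ∀ z u : Vec d, ‖z - Z n‖ ≤ envelope B K n₀ (rate d p δ α) n →
      ‖u - U n‖ ≤ envelope B K n₀ (rate d p δ β) n →
      ‖z‖ ≤ B * (((n₀ : ℝ) + 1) / ((n : ℝ) + 1)) + r ∧
        ‖u‖ ≤ B * (((n₀ : ℝ) + 1) / ((n : ℝ) + 1)) + r := by
    intro n hn z u h1 h2
    have h3 : ‖z‖ ≤ ‖z - Z n‖ + ‖Z n‖ := by simpa using norm_add_le (z - Z n) (Z n)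
    have h4 : ‖u‖ ≤ ‖u - U n‖ + ‖U n‖ := by simpa using norm_add_le (u - U n) (U n)
    have h5 := mul_le_mul_of_nonneg_left (rate_anti d p δ hβα.le n) hK
    have h6 := hr n hn
    have h7 := hZ n hn
    have h8 := hU n hn
    unfold envelope at h1 h2
    constructor <;> linarith
  induction n, hn using Nat.le_induction with
  | base =>
    rw [hZ0, hU0, sub_zero, sub_zero]
    have : ∀ a, B ≤ envelope B K n₀ (rate d p δ a) n₀ := fun a => by
      unfold envelope
      rw [div_self (by positivity), mul_one]
      have := mul_nonneg hK (rate_nonneg d p δ a n₀)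
      linarith
    exact ⟨hz0.trans (this α), hu0.trans (this β)⟩
  | succ n hn ih =>
    obtain ⟨ihz, ihu⟩ := ih
    have hL := hlate n hn
    set ρ := step (α - β) n with hρdef
    set b := step β n with hbdef
    set κ := step (α - β) (n + 1) / ρ with hκdef
    have hρ : 0 < ρ := step_pos _ _
    have hb : 0 < b := step_pos _ _
    have hρ1 : ρ ≤ 1 := step_le_one (by linarith) n
    have hb1 : b ≤ 1 := step_le_one hβ.le n
    have ha : step α n = ρ * b := by rw [hρdef, hbdef, step_mul]; ring_nf
    have ha1 : step α n ≤ 1 := step_le_one (by linarith) n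
    have hab : step α n ≤ step β n := step_le_step hβα.le n
    have hκρ : κ * ρ = step (α - β) (n + 1) := div_mul_cancel₀ _ hρ.ne'
    have hκ0 : 0 ≤ κ := (div_pos (step_pos _ _) hρ).le
    have hκ1 : κ ≤ 1 := div_le_one_of_le₀ (step_succ_le (by linarith) n) hρ.le
    -- The ratio of the stepsizes loses at most the fraction `1 / (n + 2)`, and `α < 1` puts this
    -- below the slow stepsize `ρ * b`.
    have hdiff : ρ - κ * ρ ≤ ρ * b * ρ := by
      rw [hκρ, ← ha]
      have h1 := step_succ_ge (a := α - β) (by linarith) n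
      have h2 : 1 / ((n : ℝ) + 2) ≤ step α n := by
        refine le_trans ?_ (step_le_step hα.le n)
        rw [step_one]
        gcongr
        norm_num
      have h3 := mul_le_mul_of_nonneg_right h2 hρ.le
      rw [← hρdef] at h1
      linarith
    have hratio : ((n₀ : ℝ) + 1) / ((n : ℝ) + 1) ≤ 1 := by
      rw [div_le_one (by positivity)]
      exact_mod_cast Nat.succ_le_succ hn
    have hBr := mul_le_of_le_one_right hB hratio
    obtain ⟨hzr, hur⟩ := hcoord n hn _ _ ihz ihu
    have hzB : ‖D.slow ρ (θ n) (w n)‖ ≤ B + r := by linarith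
    have huB : ‖D.fast (θ n) (w n)‖ ≤ B + r := by linarith
    -- Staying below `B'` means that the cutoff is inactive, so `Z` and `U` are driven by the true
    -- noise in this step.
    have hθB : ‖θ n‖ ≤ B' := by
      have h1 := D.norm_sub_θs_le hρ.le hρ1 hzB huB
      have h2 : ‖θ n‖ ≤ ‖θ n - D.θs‖ + ‖D.θs‖ := by
        simpa using norm_add_le (θ n - D.θs) D.θs
      linarith
    have hwB : ‖w n‖ ≤ B' := by
      have h1 := D.norm_w_le hρ.le hρ1 hzB huB
      have := norm_nonneg D.θs
      linarith
    have hZn := hZs n hn hθB hwB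
    have hUn := hUs n hn hθB hwB
    -- the iterates before projection
    set θ' := θ n + (ρ * b) • (D.driftθ (θ n) (w n) + m₁ n) with hθ'
    set w' := w n + b • (D.driftW (θ n) (w n) + m₂ n) with hw'
    have hal : step α n * D.l ≤ 1 := mul_le_one₀ ha1 D.l_pos.le D.l_le_one
    have hbl : b * D.l ≤ 1 := mul_le_one₀ hb1 D.l_pos.le D.l_le_one
    have hzn2 : ‖D.slow ρ (θ n) (w n)‖ ≤ 2 * envelope B K n₀ (rate d p δ α) n := by
      have h3 : ‖D.slow ρ (θ n) (w n)‖ ≤ ‖D.slow ρ (θ n) (w n) - Z n‖ + ‖Z n‖ := by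
        simpa using norm_add_le (D.slow ρ (θ n) (w n) - Z n) (Z n)
      have h4 := hZ n hn
      have h5 : K * rate d p δ α n ≤ envelope B K n₀ (rate d p δ α) n := by
        unfold envelope
        have : 0 ≤ B * (((n₀ : ℝ) + 1) / ((n : ℝ) + 1)) := by positivity
        linarith
      linarith
    have hun2 : ‖D.fast (θ n) (w n)‖ ≤ 2 * envelope B K n₀ (rate d p δ β) n := by
      have h3 : ‖D.fast (θ n) (w n)‖ ≤ ‖D.fast (θ n) (w n) - U n‖ + ‖U n‖ := by
        simpa using norm_add_le (D.fast (θ n) (w n) - U n) (U n)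
      have h4 := hU n hn
      have h5 : K * rate d p δ β n ≤ envelope B K n₀ (rate d p δ β) n := by
        unfold envelope
        have : 0 ≤ B * (((n₀ : ℝ) + 1) / ((n : ℝ) + 1)) := by positivity
        linarith
      linarith
    have hEαβ : envelope B K n₀ (rate d p δ α) n ≤ envelope B K n₀ (rate d p δ β) n := by
      unfold envelope
      have := mul_le_mul_of_nonneg_left (rate_anti d p δ hβα.le n) hK
      linarith
    set η := step ((α - β) / 2) n with hη
    have hρη : ρ ≤ η := step_le_step (by linarith) n
    have hη0 : 0 < η := step_pos _ _
    -- This is where the slow coordinate keeps the `α`-rate: `ρ` times the `β`-rate is `η` times the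
    -- `α`-rate, and `η → 0` leaves room to absorb the constants.
    have hρβ : ρ * envelope B K n₀ (rate d p δ β) n ≤ η * envelope B K n₀ (rate d p δ α) n := by
      unfold envelope
      have h1 := step_mul_rate d p δ α β n
      rw [← hρdef, ← hη] at h1
      have h2 : 0 ≤ B * (((n₀ : ℝ) + 1) / ((n : ℝ) + 1)) := by positivity
      have h3 := mul_le_mul_of_nonneg_right hρη h2
      calc _ = ρ * (B * (((n₀ : ℝ) + 1) / ((n : ℝ) + 1))) + K * (ρ * rate d p δ β n) := by ring
        _ ≤ η * (B * (((n₀ : ℝ) + 1) / ((n : ℝ) + 1))) + K * (ρ * rate d p δ β n) := by linarith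
        _ = _ := by rw [h1]; ring
    have hslow : ‖D.slow (step (α - β) (n + 1)) θ' w' - Z (n + 1)‖ ≤
        envelope B K n₀ (rate d p δ α) (n + 1) := by
      have h1 := D.norm_slow_step_le (θ n) (w n) (m₁ n) (m₂ n) hρ.le hρ1 hκ0 hκ1 hb.le hb1 hdiff
      have h2 := norm_sub_smul_le D.norm_X D.coercive_X (step_pos α n).le
        ((mul_le_mul_of_nonneg_right hab (by positivity)).trans hL.fast) hal
        (D.slow ρ (θ n) (w n) - Z n)
      have h3 : D.slow (step (α - β) (n + 1)) θ' w' - Z (n + 1) =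
          (D.slow (κ * ρ) θ' w' - (D.slow ρ (θ n) (w n) - (ρ * b) • D.X (D.slow ρ (θ n) (w n)) +
            (ρ * b) • D.noiseSlow ρ κ (m₁ n) (m₂ n))) +
          ((D.slow ρ (θ n) (w n) - Z n) - step α n • D.X (D.slow ρ (θ n) (w n) - Z n)) := by
        rw [hZn, hκρ, ha, map_sub, Decoupled.noiseSlowAt]
        module
      rw [h3]
      refine (norm_add_le _ _).trans ((add_le_add h1 h2).trans ?_)
      rw [add_comm, ← ha]
      exact envelope_step (step_pos α n).le (by positivity) hρ.le hal ihz (hE0 α n) hzn2 hun2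
        (mul_le_mul_of_nonneg_right hρη (hE0 α n)) hρβ hL.ratio hL.slow
        (envelope_succ_ge hK n₀ (rate_succ_ge hd hp hδ (hα.le) n))
    have hfast : ‖D.fast θ' w' - U (n + 1)‖ ≤ envelope B K n₀ (rate d p δ β) (n + 1) := by
      have h1 := D.norm_fast_step_le (θ n) (w n) (m₁ n) (m₂ n) hρ.le hρ1 hb.le
      have h2 := norm_sub_smul_le D.norm_Y D.coercive_Y hb.le hL.fast hbl
        (D.fast (θ n) (w n) - U n)
      have h3 : D.fast θ' w' - U (n + 1) =
          (D.fast θ' w' - (D.fast (θ n) (w n) - b • D.Y (D.fast (θ n) (w n)) +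
            b • D.noiseFast ρ (m₁ n) (m₂ n))) +
          ((D.fast (θ n) (w n) - U n) - b • D.Y (D.fast (θ n) (w n) - U n)) := by
        rw [hUn, map_sub, Decoupled.noiseFastAt]
        module
      rw [h3]
      refine (norm_add_le _ _).trans ((add_le_add h1 h2).trans ?_)
      rw [add_comm]
      refine envelope_step hb.le (by positivity) hρ.le hbl ihu (hE0 β n) hzn2 hun2
        ((mul_le_mul hρη hEαβ (hE0 α n) hη0.le))
        (mul_le_mul_of_nonneg_right hρη (hE0 β n)) hL.ratio (hL.slow.trans ?_)
        (envelope_succ_ge hK n₀ (rate_succ_ge hd hp hδ (hβα.trans hα).le n))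
      have := mul_le_mul_of_nonneg_right hab D.l_pos.le
      linarith
    obtain ⟨hz', hu'⟩ := hcoord (n + 1) (by omega) _ _ hslow hfast
    -- At a later projection time the transient has shrunk to at most `B / (k + 1)`, so the
    -- unprojected iterates already lie in the balls and the projection is the identity.
    have hproj : ∀ j : ℕ, 0 < j → n + 1 = j ^ j - 1 → ‖θ'‖ ≤ Rθ ∧ ‖w'‖ ≤ Rw := by
      intro j hj hnj
      have h1 := mul_le_mul_of_nonneg_left (projection_time_ratio hk hn₀ hj hnj (by omega)) hB
      rw [mul_one_div] at h1
      have hz'' := hz'.trans (add_le_add_left h1 r)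
      have hu'' := hu'.trans (add_le_add_left h1 r)
      have hρ' : (0 : ℝ) ≤ step (α - β) (n + 1) := (step_pos _ _).le
      have hρ1' : step (α - β) (n + 1) ≤ 1 := step_le_one (by linarith) _
      have h2 := D.norm_sub_θs_le hρ' hρ1' hz'' hu''
      have h3 : ‖θ'‖ ≤ ‖θ' - D.θs‖ + ‖D.θs‖ := by
        simpa using norm_add_le (θ' - D.θs) D.θs
      exact ⟨by linarith, (D.norm_w_le hρ' hρ1' hz'' hu'').trans hRw⟩
    have hθn : θ (n + 1) = θ' := by
      rw [hpath.succ_θ, ha]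
      exact sparseProj_eq_self fun j hj hnj => (hproj j hj hnj).1
    have hwn : w (n + 1) = w' := by
      rw [hpath.succ_w]
      exact sparseProj_eq_self fun j hj hnj => (hproj j hj hnj).2
    rw [hθn, hwn]
    exact ⟨hslow, hfast⟩

end GTD

namespace GTD

/-! ### Concentration of the noise -/

/-- The exponential moments of a linear recursion driven by bounded, conditionally centered noise
are those of a vector whose variance is proportional to the stepsize. -/
lemma lintegral_exp_inner_recursion_le {d : ℕ} {T 𝒳 Ω : Type*} [MeasurableSpace T]
    [MeasurableSpace 𝒳] [MeasurableSpace Ω] {P : Measure Ω} [IsProbabilityMeasure P]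
    {s : ℕ → Ω → T} {x : ℕ → Ω → 𝒳} (hs : ∀ n, Measurable (s n)) (hx : ∀ n, Measurable (x n))
    (hind : ∀ n, IndepFun (s n) (x n) P) {ζ : T → Vec d} (hζ : Measurable ζ)
    {N : ℕ → T → 𝒳 → Vec d} (hN : ∀ n, Measurable (Function.uncurry (N n))) {m : ℝ} (hm : 0 ≤ m)
    (hb : ∀ n t y, ‖N n t y‖ ≤ m) (h0 : ∀ n t v, ∫ y, ⟪v, N n t y⟫_ℝ ∂(P.map (x n)) = 0)
    {X : Vec d →L[ℝ] Vec d} {l M a : ℝ} (hl0 : 0 < l) (hX : ‖X‖ ≤ M)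
    (hl : ∀ v, l * ‖v‖ ^ 2 ≤ ⟪X v, v⟫_ℝ) (ha1 : a ≤ 1) {n₀ : ℕ}
    (hM : ∀ n ≥ n₀, step a n * M ^ 2 ≤ l)
    (hq : ∀ n ≥ n₀, 1 / ((n : ℝ) + 2) ≤ step a n * l / 4) (hinit : ∀ ω, ζ (s n₀ ω) = 0)
    (hrec : ∀ n ≥ n₀, ∀ ω, ζ (s (n + 1) ω) =
      ζ (s n ω) - step a n • X (ζ (s n ω)) + step a n • N n (s n ω) (x n ω))
    {n : ℕ} (hn : n₀ ≤ n) (v : Vec d) :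
    ∫⁻ ω, ENNReal.ofReal (Real.exp ⟪v, ζ (s n ω)⟫_ℝ) ∂P ≤
      ENNReal.ofReal (Real.exp (‖v‖ ^ 2 * (2 * m ^ 2 / l * step a n) / 2)) := by
  induction n, hn using Nat.le_induction generalizing v with
  | base =>
    simp only [hinit, inner_zero_right, Real.exp_zero, ENNReal.ofReal_one, lintegral_one,
      measure_univ]
    rw [← ENNReal.ofReal_one]
    refine ENNReal.ofReal_le_ofReal (Real.one_le_exp ?_)
    have := step_pos a n₀
    positivity
  | succ n hn ih =>
    have hsp := step_pos a n
    -- The test vector moves by `1 - step a n • X*`, and the adjoint has the same norm and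
    -- coercivity constants as `X`.
    have hX' : ‖ContinuousLinearMap.adjoint X‖ ≤ M := by simpa using hX
    have hl' : ∀ v, l * ‖v‖ ^ 2 ≤ ⟪ContinuousLinearMap.adjoint X v, v⟫_ℝ := fun v => by
      rw [ContinuousLinearMap.adjoint_inner_left, real_inner_comm]; exact hl v
    have h := lintegral_exp_inner_step (P := P) (q := 1 - step a n * l) (hs n) (hx n) (hind n) hζ
      (ξ := fun t => ζ t - step a n • X (ζ t)) (by fun_prop) (hN n) hsp.le hm (hb n) (h0 n) ih
      (by positivity)
      (fun v => ⟨v - step a n • ContinuousLinearMap.adjoint X v,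
        norm_sub_smul_sq_le hX' hl' hsp.le (hM n hn) v, fun t => by
          rw [inner_sub_right, inner_sub_left, inner_smul_right, inner_smul_left,
            ContinuousLinearMap.adjoint_inner_left]
          simp⟩) v
    simp only [hrec n hn]
    refine h.trans (ENNReal.ofReal_le_ofReal (Real.exp_le_exp.2 ?_))
    gcongr
    have h1 := step_succ_ge ha1 n
    have h2 := hq n hn
    have h3 : 0 ≤ 2 * m ^ 2 / l := by positivity
    have h4 : 2 * m ^ 2 / l * ((1 - step a n * l / 4) * step a n) ≤
        2 * m ^ 2 / l * step a (n + 1) := by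
      refine mul_le_mul_of_nonneg_left (le_trans ?_ h1) h3
      gcongr
    refine le_trans (le_of_sub_nonneg ?_) h4
    -- The variance factor `τ = 2 m² / l` solves the variance recursion with room to spare: with `s`
    -- the stepsize, `(1 - s l) τ s + s² m² ≤ (1 - s l / 4) τ s`, and the right side is at most `τ`
    -- times the next stepsize.
    have : 2 * m ^ 2 / l * ((1 - step a n * l / 4) * step a n) -
        ((1 - step a n * l) * (2 * m ^ 2 / l * step a n) + step a n ^ 2 * m ^ 2) =
        step a n ^ 2 * m ^ 2 / 2 := by
      field_simp; ring
    rw [this]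
    positivity

/-- The probability that such a recursion exceeds a multiple of the rate is summable. -/
lemma measure_rate_lt_norm_le {d : ℕ} (hd : 0 < d) {Ω : Type*} [MeasurableSpace Ω]
    {P : Measure Ω} {Z : Ω → Vec d} (hZ : Measurable Z) {τ p δ a K : ℝ} (hτ : 0 < τ) (hp : 0 ≤ p)
    (hδ : 0 < δ) (hδ1 : δ < 1) (hK : 0 ≤ K) (hKτ : 2 * d * τ ≤ K ^ 2) (n : ℕ)
    (h : ∀ v : Vec d, ∫⁻ ω, ENNReal.ofReal (Real.exp ⟪v, Z ω⟫_ℝ) ∂P ≤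
      ENNReal.ofReal (Real.exp (‖v‖ ^ 2 * (τ * step a n) / 2))) :
    P {ω | K * rate d p δ a n < ‖Z ω‖} ≤ ENNReal.ofReal (δ / 2 * step p n) := by
  have hd' : (0 : ℝ) < d := by exact_mod_cast hd
  have hd1 : (1 : ℝ) ≤ d := by exact_mod_cast hd
  have hsp := step_pos a n
  refine (measure_norm_gt_le hd hZ (by positivity) h
    (mul_nonneg hK (rate_nonneg d p δ a n))).trans (ENNReal.ofReal_le_ofReal ?_)
  have hL := one_le_log_arg hd hp hδ hδ1 n
  rw [mul_pow, rate_sq hd hp hδ hδ1]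
  set L := Real.log (4 * (d : ℝ) ^ 2 * ((n : ℝ) + 1) ^ p / δ) with hLdef
  -- The choice `K² ≥ 2 d τ` turns the tail into `2 d exp (-L)`. The factor `4 d² (n + 1) ^ p / δ`
  -- inside the logarithm of the rate then makes this at most `δ / 2 * (n + 1) ^ (-p)`.
  have h1 : L ≤ K ^ 2 * (L * step a n) / (2 * d * (τ * step a n)) := by
    rw [le_div_iff₀ (by positivity)]
    calc L * (2 * d * (τ * step a n)) = 2 * d * τ * (L * step a n) := by ring
      _ ≤ _ := by gcongr
  have h2 : Real.exp (-L) = δ / (4 * (d : ℝ) ^ 2) * step p n := by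
    rw [hLdef, Real.exp_neg, Real.exp_log (by positivity), step, Real.rpow_neg (by positivity)]
    have : (0 : ℝ) < ((n : ℝ) + 1) ^ p := by positivity
    field_simp
  calc 2 * d * Real.exp (-(K ^ 2 * (L * step a n) / (2 * d * (τ * step a n))))
      ≤ 2 * d * Real.exp (-L) := by gcongr
    _ = δ / 2 * step p n / d := by rw [h2]; field_simp; ring
    _ ≤ δ / 2 * step p n := div_le_self (by have := step_pos p n; positivity) hd1

/-! ### Size, truncation and centering of the noise in decoupled coordinates -/

namespace Decoupled

variable {d : ℕ} (D : Decoupled d)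

lemma norm_noiseSlowAt_le {α β : ℝ} (h : β ≤ α) (n : ℕ) {m₁ m₂ : Vec d} {c : ℝ}
    (h1 : ‖m₁‖ ≤ c) (h2 : ‖m₂‖ ≤ c) : ‖D.noiseSlowAt α β n m₁ m₂‖ ≤ 3 * D.M ^ 2 * c := by
  have hM := D.one_le_M
  have hM0 := D.M_nonneg
  have hc : 0 ≤ c := (norm_nonneg _).trans h1
  unfold noiseSlowAt noiseSlow
  have hρ : 0 < step (α - β) n := step_pos _ _
  rw [div_mul_cancel₀ _ hρ.ne']
  have hκ0 : 0 ≤ step (α - β) (n + 1) / step (α - β) n := (div_pos (step_pos _ _) hρ).le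
  have hκ1 : step (α - β) (n + 1) / step (α - β) n ≤ 1 :=
    div_le_one_of_le₀ (step_succ_le (by linarith) n) hρ.le
  have e1 : ‖(step (α - β) (n + 1) / step (α - β) n) • D.H m₂‖ ≤ D.M * c := by
    rw [norm_smul, Real.norm_eq_abs, abs_of_nonneg hκ0]
    exact (mul_le_of_le_one_left (norm_nonneg _) hκ1).trans
      ((D.norm_H_le _).trans (mul_le_mul_of_nonneg_left h2 hM0))
  have e2 : ‖step (α - β) (n + 1) • D.H (D.G m₁)‖ ≤ D.M * (D.M * c) := by
    rw [norm_smul, Real.norm_eq_abs, abs_of_nonneg (step_pos _ _).le]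
    refine (mul_le_of_le_one_left (norm_nonneg _) (step_le_one (by linarith) _)).trans
      ((D.norm_H_le _).trans (mul_le_mul_of_nonneg_left ?_ hM0))
    exact (D.norm_G_le _).trans (mul_le_mul_of_nonneg_left h1 hM0)
  refine (norm_sub_le _ _).trans ((add_le_add ((norm_sub_le _ _).trans (add_le_add h1 e1))
    e2).trans ?_)
  nlinarith [mul_le_mul_of_nonneg_right (le_self_pow₀ hM two_ne_zero) hc,
    mul_le_mul_of_nonneg_right (one_le_pow₀ hM : 1 ≤ D.M ^ 2) hc]

lemma norm_noiseFastAt_le {α β : ℝ} (h : β ≤ α) (n : ℕ) {m₁ m₂ : Vec d} {c : ℝ}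
    (h1 : ‖m₁‖ ≤ c) (h2 : ‖m₂‖ ≤ c) : ‖D.noiseFastAt α β n m₁ m₂‖ ≤ 3 * D.M ^ 2 * c := by
  have hM := D.one_le_M
  have hM0 := D.M_nonneg
  have hc : 0 ≤ c := (norm_nonneg _).trans h1
  unfold noiseFastAt noiseFast
  have e2 : ‖step (α - β) n • D.G m₁‖ ≤ D.M * c := by
    rw [norm_smul, Real.norm_eq_abs, abs_of_nonneg (step_pos _ _).le]
    exact (mul_le_of_le_one_left (norm_nonneg _) (step_le_one (by linarith) _)).trans
      ((D.norm_G_le _).trans (mul_le_mul_of_nonneg_left h1 hM0))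
  refine (norm_add_le _ _).trans ((add_le_add h2 e2).trans ?_)
  nlinarith [mul_le_mul_of_nonneg_right (le_self_pow₀ hM two_ne_zero) hc,
    mul_le_mul_of_nonneg_right (one_le_pow₀ hM : 1 ≤ D.M ^ 2) hc]

section Noise

variable {𝒳 : Type*}

open Classical in
/-- A function of the iterates and the sample, cut off at iterates of norm larger than `B`. -/
def truncate (B : ℝ) (f : Vec d × Vec d → 𝒳 → Vec d) (q : Vec d × Vec d) (y : 𝒳) : Vec d :=
  if ‖q.1‖ ≤ B ∧ ‖q.2‖ ≤ B then f q y else 0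

lemma norm_truncate_le {B m : ℝ} (hm : 0 ≤ m) {f : Vec d × Vec d → 𝒳 → Vec d}
    (hf : ∀ q y, ‖q.1‖ ≤ B → ‖q.2‖ ≤ B → ‖f q y‖ ≤ m) (q : Vec d × Vec d) (y : 𝒳) :
    ‖truncate B f q y‖ ≤ m := by
  unfold truncate
  split_ifs with h
  · exact hf q y h.1 h.2
  · simpa

variable [MeasurableSpace 𝒳]

lemma measurable_truncate {B : ℝ} {f : Vec d × Vec d → 𝒳 → Vec d}
    (hf : Measurable (Function.uncurry f)) : Measurable (Function.uncurry (truncate B f)) := by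
  classical
  have h1 : MeasurableSet {z : (Vec d × Vec d) × 𝒳 | ‖z.1.1‖ ≤ B} :=
    measurableSet_le (by fun_prop) measurable_const
  have h2 : MeasurableSet {z : (Vec d × Vec d) × 𝒳 | ‖z.1.2‖ ≤ B} :=
    measurableSet_le (by fun_prop) measurable_const
  have e : Function.uncurry (truncate B f) = fun z : (Vec d × Vec d) × 𝒳 =>
      if z ∈ {z : (Vec d × Vec d) × 𝒳 | ‖z.1.1‖ ≤ B} ∩ {z | ‖z.1.2‖ ≤ B} then
        Function.uncurry f z else 0 := by
    funext z
    simp [truncate, Function.uncurry]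
  rw [e]
  exact Measurable.ite (h1.inter h2) hf measurable_const

/-- The cutoff depends on the iterates only and not on the fresh sample, so it does not destroy the
centering. -/
lemma integral_inner_truncate {ν : Measure 𝒳} {B : ℝ} {f : Vec d × Vec d → 𝒳 → Vec d}
    (hint : ∀ q, Integrable (f q) ν) (h0 : ∀ q, ∫ y, f q y ∂ν = 0) (q : Vec d × Vec d)
    (v : Vec d) : ∫ y, ⟪v, truncate B f q y⟫_ℝ ∂ν = 0 := by
  unfold truncate
  by_cases h : ‖q.1‖ ≤ B ∧ ‖q.2‖ ≤ B
  · simp only [h, and_self, if_true]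
    rw [integral_inner (hint q), h0, inner_zero_right]
  · simp only [h, if_false, inner_zero_right, integral_zero]

variable {ν : Measure 𝒳} {f g : 𝒳 → Vec d}

lemma integral_noiseSlowAt (α β : ℝ) (n : ℕ) (hf : Integrable f ν) (hg : Integrable g ν)
    (hf0 : ∫ y, f y ∂ν = 0) (hg0 : ∫ y, g y ∂ν = 0) :
    Integrable (fun y => D.noiseSlowAt α β n (f y) (g y)) ν ∧
      ∫ y, D.noiseSlowAt α β n (f y) (g y) ∂ν = 0 := by
  unfold noiseSlowAt noiseSlow
  set κ := step (α - β) (n + 1) / step (α - β) n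
  set ρ := step (α - β) n
  have i1 : Integrable (fun y => κ • D.H (g y)) ν := (D.H.integrable_comp hg).smul κ
  have i2 : Integrable (fun y => (κ * ρ) • D.H (D.G (f y))) ν :=
    (D.H.integrable_comp (D.G.integrable_comp hf)).smul (κ * ρ)
  have i3 : Integrable (fun y => f y - κ • D.H (g y)) ν := hf.sub i1
  refine ⟨i3.sub i2, ?_⟩
  rw [integral_sub i3 i2, integral_sub hf i1, integral_smul, integral_smul,
    D.H.integral_comp_comm hg, D.H.integral_comp_comm (D.G.integrable_comp hf),
    D.G.integral_comp_comm hf, hf0, hg0]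
  simp

lemma integral_noiseFastAt (α β : ℝ) (n : ℕ) (hf : Integrable f ν) (hg : Integrable g ν)
    (hf0 : ∫ y, f y ∂ν = 0) (hg0 : ∫ y, g y ∂ν = 0) :
    Integrable (fun y => D.noiseFastAt α β n (f y) (g y)) ν ∧
      ∫ y, D.noiseFastAt α β n (f y) (g y) ∂ν = 0 := by
  unfold noiseFastAt noiseFast
  set ρ := step (α - β) n
  have i1 : Integrable (fun y => ρ • D.G (f y)) ν := (D.G.integrable_comp hf).smul ρ
  refine ⟨hg.add i1, ?_⟩
  rw [integral_add hg i1, integral_smul, D.G.integral_comp_comm hf, hf0, hg0]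
  simp

end Noise

end Decoupled

lemma measurable_sparseProj {d : ℕ} (n : ℕ) (R : ℝ) :
    Measurable (sparseProj n R : Vec d → Vec d) := by
  unfold sparseProj
  split_ifs
  · unfold ballProj
    fun_prop
  · exact measurable_id

end GTD

namespace GTD

/-! ### The high-probability bound from a projection time on -/

lemma norm_sparseProj_le {d n k : ℕ} (hk : 0 < k) (hn : n = k ^ k - 1) {R : ℝ} (hR : 0 ≤ R)
    (x : Vec d) : ‖sparseProj n R x‖ ≤ R := by
  unfold sparseProj
  rw [if_pos ⟨k, hk, hn⟩]
  exact norm_ballProj_le hR x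

/-- The union bound over two families of events with summable probabilities. -/
lemma one_sub_lt_measureReal {d : ℕ} {Ω : Type*} [MeasurableSpace Ω] {P : Measure Ω}
    [IsProbabilityMeasure P] {p δ : ℝ} (hp : 1 < p) (hδ : 0 < δ) {n₀ : ℕ}
    (htail : ∑' k, step p (k + n₀) ≤ 1 / 2) {Z U : ℕ → Ω → Vec d} {f g : ℕ → ℝ}
    (hZ : ∀ n ≥ n₀, P {ω | f n < ‖Z n ω‖} ≤ ENNReal.ofReal (δ / 2 * step p n))
    (hU : ∀ n ≥ n₀, P {ω | g n < ‖U n ω‖} ≤ ENNReal.ofReal (δ / 2 * step p n)) {S : Set Ω}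
    (hS : ∀ ω, (∀ n ≥ n₀, ‖Z n ω‖ ≤ f n) → (∀ n ≥ n₀, ‖U n ω‖ ≤ g n) → ω ∈ S) :
    1 - δ < P.real S := by
  have hsum : Summable fun k => step p (k + n₀) := by
    have h : Summable fun n : ℕ => step p n := by
      have := (summable_nat_add_iff 1).2 (Real.summable_nat_rpow.2 (by linarith : -p < -1))
      simpa [step] using this
    exact (summable_nat_add_iff n₀).2 h
  have hsp : ∀ k, 0 ≤ δ * step p (k + n₀) := fun k =>
    mul_nonneg hδ.le (step_pos _ _).le
  set bad : Set Ω := ⋃ k, ({ω | f (k + n₀) < ‖Z (k + n₀) ω‖} ∪ {ω | g (k + n₀) < ‖U (k + n₀) ω‖})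
    with hbad
  -- The two families contribute `δ` times the tail sum, which is at most `1 / 2`; the spare `δ / 2`
  -- makes the final inequality strict.
  have hP : P bad ≤ ENNReal.ofReal (δ / 2) := by
    refine (measure_iUnion_le _).trans ?_
    calc ∑' k, P ({ω | f (k + n₀) < ‖Z (k + n₀) ω‖} ∪ {ω | g (k + n₀) < ‖U (k + n₀) ω‖})
        ≤ ∑' k, ENNReal.ofReal (δ * step p (k + n₀)) := by
          refine ENNReal.tsum_le_tsum fun k => (measure_union_le _ _).trans ?_
          have h2 : δ * step p (k + n₀) = δ / 2 * step p (k + n₀) + δ / 2 * step p (k + n₀) := by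
            ring
          have h3 : 0 ≤ δ / 2 * step p (k + n₀) := by linarith [hsp k]
          rw [h2, ENNReal.ofReal_add h3 h3]
          exact add_le_add (hZ _ (by omega)) (hU _ (by omega))
      _ = ENNReal.ofReal (∑' k, δ * step p (k + n₀)) :=
          (ENNReal.ofReal_tsum_of_nonneg hsp (hsum.mul_left δ)).symm
      _ ≤ ENNReal.ofReal (δ / 2) := by
          refine ENNReal.ofReal_le_ofReal ?_
          rw [tsum_mul_left]
          have := mul_le_mul_of_nonneg_left htail hδ.le
          linarith
  -- Covering the whole space and using subadditivity avoids any measurability of `S`.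
  have hcover : (Set.univ : Set Ω) ⊆ S ∪ bad := by
    intro ω _
    by_cases hω : ω ∈ bad
    · exact Or.inr hω
    · left
      have hno : ∀ k, ω ∉ {ω | f (k + n₀) < ‖Z (k + n₀) ω‖} ∪
          {ω | g (k + n₀) < ‖U (k + n₀) ω‖} := fun k hk =>
        hω (Set.mem_iUnion.2 ⟨k, hk⟩)
      refine hS ω (fun n hn => ?_) (fun n hn => ?_)
      · have h1 : n - n₀ + n₀ = n := by omega
        have h2 := fun h => hno (n - n₀) (Or.inl h)
        rw [h1] at h2
        exact not_lt.1 h2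
      · have h1 : n - n₀ + n₀ = n := by omega
        have h2 := fun h => hno (n - n₀) (Or.inr h)
        rw [h1] at h2
        exact not_lt.1 h2
  have h1 : (1 : ℝ) ≤ P.real S + P.real bad := by
    have h2 : P.real Set.univ ≤ P.real (S ∪ bad) := measureReal_mono hcover
    rw [probReal_univ] at h2
    exact h2.trans (measureReal_union_le _ _)
  have h2 : P.real bad ≤ δ / 2 := ENNReal.toReal_le_of_le_ofReal (by linarith) hP
  linarith

namespace Decoupled

variable {d : ℕ} (D : Decoupled d)

/-! ### The joint recursion of iterates and noise processes -/

section JointRecursion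

variable {𝒳 : Type*} (α β Rθ Rw B : ℝ) (n₀ : ℕ) (m₁ m₂ : Vec d × Vec d → 𝒳 → Vec d)

/-- One step of the joint recursion of the iterates and of the linear recursions driven by the
truncated noise, which are started at time `n₀`. -/
def jointStep (n : ℕ) (t : (Vec d × Vec d) × Vec d × Vec d) (y : 𝒳) :
    (Vec d × Vec d) × Vec d × Vec d :=
  ((sparseProj (n + 1) Rθ (t.1.1 + step α n • (D.driftθ t.1.1 t.1.2 + m₁ t.1 y)),
      sparseProj (n + 1) Rw (t.1.2 + step β n • (D.driftW t.1.1 t.1.2 + m₂ t.1 y))),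
    (if n < n₀ then 0 else t.2.1 - step α n • D.X t.2.1 + step α n •
        truncate B (fun q y => D.noiseSlowAt α β n (m₁ q y) (m₂ q y)) t.1 y),
    (if n < n₀ then 0 else t.2.2 - step β n • D.Y t.2.2 + step β n •
        truncate B (fun q y => D.noiseFastAt α β n (m₁ q y) (m₂ q y)) t.1 y))

/-- The joint process along a sequence of samples. -/
def joint (x : ℕ → 𝒳) (i₀ : Vec d × Vec d) : ℕ → (Vec d × Vec d) × Vec d × Vec d
  | 0 => (i₀, 0)
  | n + 1 => D.jointStep α β Rθ Rw B n₀ m₁ m₂ n (joint x i₀ n) (x n)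

variable [MeasurableSpace 𝒳] {m₁ m₂}

lemma measurable_noiseSlowAt (hm₁ : Measurable (Function.uncurry m₁))
    (hm₂ : Measurable (Function.uncurry m₂)) (n : ℕ) :
    Measurable (Function.uncurry fun q y => D.noiseSlowAt α β n (m₁ q y) (m₂ q y)) := by
  have h1 : Measurable fun z : (Vec d × Vec d) × 𝒳 => m₁ z.1 z.2 := hm₁
  have h2 : Measurable fun z : (Vec d × Vec d) × 𝒳 => m₂ z.1 z.2 := hm₂
  unfold noiseSlowAt noiseSlow Function.uncurry
  fun_prop

lemma measurable_noiseFastAt (hm₁ : Measurable (Function.uncurry m₁))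
    (hm₂ : Measurable (Function.uncurry m₂)) (n : ℕ) :
    Measurable (Function.uncurry fun q y => D.noiseFastAt α β n (m₁ q y) (m₂ q y)) := by
  have h1 : Measurable fun z : (Vec d × Vec d) × 𝒳 => m₁ z.1 z.2 := hm₁
  have h2 : Measurable fun z : (Vec d × Vec d) × 𝒳 => m₂ z.1 z.2 := hm₂
  unfold noiseFastAt noiseFast Function.uncurry
  fun_prop

lemma measurable_comp_uncurry {T : Type*} [MeasurableSpace T] {f : Vec d × Vec d → 𝒳 → Vec d}
    (hf : Measurable (Function.uncurry f)) {g : T → Vec d × Vec d} (hg : Measurable g) {h : T → 𝒳}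
    (hh : Measurable h) : Measurable fun z => f (g z) (h z) := by
  exact hf.comp (hg.prodMk hh)

lemma measurable_jointStep (hm₁ : Measurable (Function.uncurry m₁))
    (hm₂ : Measurable (Function.uncurry m₂)) (n : ℕ) :
    Measurable (Function.uncurry (D.jointStep α β Rθ Rw B n₀ m₁ m₂ n)) := by
  have hq : Measurable fun z : ((Vec d × Vec d) × Vec d × Vec d) × 𝒳 => z.1.1 := by fun_prop
  have hθ : Measurable fun z : ((Vec d × Vec d) × Vec d × Vec d) × 𝒳 => z.1.1.1 := by fun_prop
  have hw : Measurable fun z : ((Vec d × Vec d) × Vec d × Vec d) × 𝒳 => z.1.1.2 := by fun_prop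
  have hZ : Measurable fun z : ((Vec d × Vec d) × Vec d × Vec d) × 𝒳 => z.1.2.1 := by fun_prop
  have hU : Measurable fun z : ((Vec d × Vec d) × Vec d × Vec d) × 𝒳 => z.1.2.2 := by fun_prop
  have h1 := measurable_comp_uncurry hm₁ hq measurable_snd
  have h2 := measurable_comp_uncurry hm₂ hq measurable_snd
  have h3 := measurable_comp_uncurry (measurable_truncate (B := B)
    (D.measurable_noiseSlowAt α β hm₁ hm₂ n)) hq measurable_snd
  have h4 := measurable_comp_uncurry (measurable_truncate (B := B)
    (D.measurable_noiseFastAt α β hm₁ hm₂ n)) hq measurable_snd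
  have hdθ : Measurable fun z : ((Vec d × Vec d) × Vec d × Vec d) × 𝒳 =>
      D.driftθ z.1.1.1 z.1.1.2 := by
    unfold driftθ fast; fun_prop
  have hdw : Measurable fun z : ((Vec d × Vec d) × Vec d × Vec d) × 𝒳 =>
      D.driftW z.1.1.1 z.1.1.2 := by
    unfold driftW fast; fun_prop
  have hX : Measurable fun z : ((Vec d × Vec d) × Vec d × Vec d) × 𝒳 => D.X z.1.2.1 := by fun_prop
  have hY : Measurable fun z : ((Vec d × Vec d) × Vec d × Vec d) × 𝒳 => D.Y z.1.2.2 := by fun_prop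
  have hite : ∀ (p : Prop) [Decidable p] (f : ((Vec d × Vec d) × Vec d × Vec d) × 𝒳 → Vec d),
      Measurable f → Measurable fun z => if p then 0 else f z := fun p _ f hf => by
    split_ifs
    · exact measurable_const
    · exact hf
  have e1 : Measurable fun z : ((Vec d × Vec d) × Vec d × Vec d) × 𝒳 =>
      sparseProj (n + 1) Rθ (z.1.1.1 + step α n • (D.driftθ z.1.1.1 z.1.1.2 + m₁ z.1.1 z.2)) :=
    (measurable_sparseProj (n + 1) Rθ).comp (hθ.add ((hdθ.add h1).const_smul (step α n)))
  have e2 : Measurable fun z : ((Vec d × Vec d) × Vec d × Vec d) × 𝒳 =>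
      sparseProj (n + 1) Rw (z.1.1.2 + step β n • (D.driftW z.1.1.1 z.1.1.2 + m₂ z.1.1 z.2)) :=
    (measurable_sparseProj (n + 1) Rw).comp (hw.add ((hdw.add h2).const_smul (step β n)))
  have e3 := hite (n < n₀) _ ((hZ.sub (hX.const_smul (step α n))).add (h3.const_smul (step α n)))
  have e4 := hite (n < n₀) _ ((hU.sub (hY.const_smul (step β n))).add (h4.const_smul (step β n)))
  exact (e1.prodMk e2).prodMk (e3.prodMk e4)

end JointRecursion

/-- The linear recursions take their noise from the iterates, so only the joint process is a
recursion driven by the samples alone; its first component is the given path. -/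
lemma joint_fst {𝒳 : Type*} {α β Rθ Rw B : ℝ} {n₀ : ℕ} {m₁ m₂ : Vec d × Vec d → 𝒳 → Vec d}
    {x : ℕ → 𝒳} {it : ℕ → Vec d × Vec d}
    (hit : D.IsPath α β Rθ Rw (fun n => (it n).1) (fun n => (it n).2)
      (fun n => m₁ (it n) (x n)) (fun n => m₂ (it n) (x n))) (n : ℕ) :
    (D.joint α β Rθ Rw B n₀ m₁ m₂ x (it 0) n).1 = it n := by
  induction n with
  | zero => rfl
  | succ n ih =>
    refine Prod.ext ?_ ?_
    · rw [joint, jointStep, ih]; exact (hit.succ_θ n).symm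
    · rw [joint, jointStep, ih]; exact (hit.succ_w n).symm

/-- From a late projection time on, the decoupled coordinates stay within the envelopes with high
probability. -/
lemma one_sub_lt_measureReal_envelope (hd : 0 < d) {α β Rθ Rw p δ : ℝ} (hβ : 0 < β)
    (hβα : β < α) (hα : α < 1) (hp : 1 < p) (hδ : 0 < δ) (hδ1 : δ < 1) {k n₀ : ℕ} (hk : 2 ≤ k)
    (hn₀ : n₀ + 1 = k ^ k) (hlate : ∀ n ≥ n₀, D.Late α β n)
    (htail : ∑' j, step p (j + n₀) ≤ 1 / 2) {B K B' r c : ℝ} (hB : 0 ≤ B) (hc : 0 < c)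
    (hB' : ‖D.θs‖ + 3 * D.M ^ 2 * (B + r) ≤ B') (hRθ0 : 0 ≤ Rθ) (hRw0 : 0 ≤ Rw)
    (hRθ : ‖D.θs‖ + 3 * D.M ^ 2 * (B / (k + 1) + r) ≤ Rθ)
    (hRw : 3 * D.M ^ 2 * (B / (k + 1) + r) ≤ Rw) (hK : 0 ≤ K)
    (hKτ : 2 * d * (2 * (3 * D.M ^ 2 * c) ^ 2 / D.l) ≤ K ^ 2)
    (hr : ∀ n ≥ n₀, 2 * K * rate d p δ β n ≤ r)
    (hinit : ∀ θ w : Vec d, ‖θ‖ ≤ Rθ → ‖w‖ ≤ Rw → ∀ ρ, 0 ≤ ρ → ρ ≤ 1 →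
      ‖D.slow ρ θ w‖ ≤ B ∧ ‖D.fast θ w‖ ≤ B)
    {𝒳 Ω : Type*} [MeasurableSpace 𝒳] [MeasurableSpace Ω] {ν : Measure 𝒳}
    [IsProbabilityMeasure ν] {P : Measure Ω} [IsProbabilityMeasure P]
    {m₁ m₂ : Vec d × Vec d → 𝒳 → Vec d} (hm₁ : Measurable (Function.uncurry m₁))
    (hm₂ : Measurable (Function.uncurry m₂)) (hint₁ : ∀ q, Integrable (m₁ q) ν)
    (hint₂ : ∀ q, Integrable (m₂ q) ν) (h0₁ : ∀ q, ∫ y, m₁ q y ∂ν = 0)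
    (h0₂ : ∀ q, ∫ y, m₂ q y ∂ν = 0) (hb₁ : ∀ q y, ‖q.1‖ ≤ B' → ‖q.2‖ ≤ B' → ‖m₁ q y‖ ≤ c)
    (hb₂ : ∀ q y, ‖q.1‖ ≤ B' → ‖q.2‖ ≤ B' → ‖m₂ q y‖ ≤ c) {x : ℕ → Ω → 𝒳}
    (hx : ∀ n, Measurable (x n)) (hind : iIndepFun x P) (hν : ∀ n, P.map (x n) = ν)
    {it : ℕ → Ω → Vec d × Vec d} {i₀ : Vec d × Vec d} (hi₀ : ∀ ω, it 0 ω = i₀)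
    (hit : ∀ ω, D.IsPath α β Rθ Rw (fun n => (it n ω).1) (fun n => (it n ω).2)
      (fun n => m₁ (it n ω) (x n ω)) (fun n => m₂ (it n ω) (x n ω))) :
    1 - δ < P.real {ω | ∀ n ≥ n₀,
      ‖D.slow (step (α - β) n) (it n ω).1 (it n ω).2‖ ≤
          envelope B K n₀ (rate d p δ α) n + K * rate d p δ α n ∧
        ‖D.fast (it n ω).1 (it n ω).2‖ ≤
          envelope B K n₀ (rate d p δ β) n + K * rate d p δ β n} := by
  have hM := D.one_le_M
  have hd' : (0 : ℝ) < d := by exact_mod_cast hd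
  obtain ⟨s, hs0, hs1, hsit⟩ : ∃ s : ℕ → Ω → (Vec d × Vec d) × Vec d × Vec d,
      (∀ ω, s 0 ω = (i₀, 0)) ∧
      (∀ n ω, s (n + 1) ω = D.jointStep α β Rθ Rw B' n₀ m₁ m₂ n (s n ω) (x n ω)) ∧
      ∀ n ω, (s n ω).1 = it n ω := by
    refine ⟨fun n ω => D.joint α β Rθ Rw B' n₀ m₁ m₂ (fun n => x n ω) i₀ n, fun ω => rfl,
      fun n ω => rfl, fun n ω => ?_⟩
    have := D.joint_fst (B := B') (n₀ := n₀) (hit ω) n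
    rwa [hi₀] at this
  have hF := D.measurable_jointStep α β Rθ Rw B' n₀ hm₁ hm₂
  have hsm := measurable_of_recursion hx hF hs0 hs1
  have hsi := indepFun_of_recursion hx hind hF hs0 hs1
  have hζ : Measurable fun t : (Vec d × Vec d) × Vec d × Vec d => t.2.1 := by fun_prop
  have hξ : Measurable fun t : (Vec d × Vec d) × Vec d × Vec d => t.2.2 := by fun_prop
  have hq : Measurable fun z : ((Vec d × Vec d) × Vec d × Vec d) × 𝒳 => z.1.1 := by fun_prop
  set NZ : ℕ → (Vec d × Vec d) × Vec d × Vec d → 𝒳 → Vec d := fun n t =>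
    truncate B' (fun q y => D.noiseSlowAt α β n (m₁ q y) (m₂ q y)) t.1 with hNZ
  set NU : ℕ → (Vec d × Vec d) × Vec d × Vec d → 𝒳 → Vec d := fun n t =>
    truncate B' (fun q y => D.noiseFastAt α β n (m₁ q y) (m₂ q y)) t.1 with hNU
  have hNZm : ∀ n, Measurable (Function.uncurry (NZ n)) := fun n =>
    measurable_comp_uncurry (measurable_truncate (D.measurable_noiseSlowAt α β hm₁ hm₂ n)) hq
      measurable_snd
  have hNUm : ∀ n, Measurable (Function.uncurry (NU n)) := fun n =>
    measurable_comp_uncurry (measurable_truncate (D.measurable_noiseFastAt α β hm₁ hm₂ n)) hq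
      measurable_snd
  -- As `k ≥ 2`, `n₀` is positive. So step `n₀ - 1` both resets `Z` and `U` to zero and ends with a
  -- projection of the iterates.
  obtain ⟨j, hj⟩ : ∃ j, n₀ = j + 1 := ⟨n₀ - 1, by
    have : 2 ^ 2 ≤ k ^ k := (Nat.pow_le_pow_left hk 2).trans (Nat.pow_le_pow_right (by omega) hk)
    omega⟩
  have hZ0 : ∀ ω, (s n₀ ω).2.1 = 0 := fun ω => by rw [hj, hs1, jointStep]; simp [hj]
  have hU0 : ∀ ω, (s n₀ ω).2.2 = 0 := fun ω => by rw [hj, hs1, jointStep]; simp [hj]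
  have hZs : ∀ n ≥ n₀, ∀ ω, (s (n + 1) ω).2.1 = (s n ω).2.1 - step α n • D.X (s n ω).2.1 +
      step α n • NZ n (s n ω) (x n ω) :=
    fun n hn ω => by rw [hs1, jointStep]; simp [not_lt.2 hn, hNZ]
  have hUs : ∀ n ≥ n₀, ∀ ω, (s (n + 1) ω).2.2 = (s n ω).2.2 - step β n • D.Y (s n ω).2.2 +
      step β n • NU n (s n ω) (x n ω) :=
    fun n hn ω => by rw [hs1, jointStep]; simp [not_lt.2 hn, hNU]
  have hτ : 0 < 2 * (3 * D.M ^ 2 * c) ^ 2 / D.l := by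
    have := D.l_pos
    positivity
  have hc3 : 0 ≤ 3 * D.M ^ 2 * c := by positivity
  have hslow0 := fun n q => D.integral_noiseSlowAt α β n (hint₁ q) (hint₂ q) (h0₁ q) (h0₂ q)
  have hfast0 := fun n q => D.integral_noiseFastAt α β n (hint₁ q) (hint₂ q) (h0₁ q) (h0₂ q)
  have hNZb : ∀ n t y, ‖NZ n t y‖ ≤ 3 * D.M ^ 2 * c := fun n t y =>
    norm_truncate_le hc3 (fun q y h1 h2 =>
      D.norm_noiseSlowAt_le hβα.le n (hb₁ q y h1 h2) (hb₂ q y h1 h2)) _ _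
  have hNUb : ∀ n t y, ‖NU n t y‖ ≤ 3 * D.M ^ 2 * c := fun n t y =>
    norm_truncate_le hc3 (fun q y h1 h2 =>
      D.norm_noiseFastAt_le hβα.le n (hb₁ q y h1 h2) (hb₂ q y h1 h2)) _ _
  have hNZ0 : ∀ n t v, ∫ y, ⟪v, NZ n t y⟫_ℝ ∂(P.map (x n)) = 0 := fun n t v => by
    rw [hν]
    exact integral_inner_truncate (fun q => (hslow0 n q).1) (fun q => (hslow0 n q).2) _ _
  have hNU0 : ∀ n t v, ∫ y, ⟪v, NU n t y⟫_ℝ ∂(P.map (x n)) = 0 := fun n t v => by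
    rw [hν]
    exact integral_inner_truncate (fun q => (hfast0 n q).1) (fun q => (hfast0 n q).2) _ _
  refine one_sub_lt_measureReal (Z := fun n ω => (s n ω).2.1) (U := fun n ω => (s n ω).2.2)
    (f := fun n => K * rate d p δ α n) (g := fun n => K * rate d p δ β n) hp hδ htail ?_ ?_ ?_
  · intro n hn
    exact measure_rate_lt_norm_le hd (hζ.comp (hsm n)) hτ (by linarith) hδ hδ1 hK hKτ n fun v =>
      lintegral_exp_inner_recursion_le hsm hx hsi hζ hNZm hc3 hNZb hNZ0 D.l_pos D.norm_X
        D.coercive_X hα.le (fun n hn => le_trans (mul_le_mul_of_nonneg_right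
          (step_le_step hβα.le n) (by positivity)) (hlate n hn).fast)
        (fun n hn => (hlate n hn).slow) hZ0 hZs hn v
  · intro n hn
    exact measure_rate_lt_norm_le hd (hξ.comp (hsm n)) hτ (by linarith) hδ hδ1 hK hKτ n fun v =>
      lintegral_exp_inner_recursion_le hsm hx hsi hξ hNUm hc3 hNUb hNU0 D.l_pos D.norm_Y
        D.coercive_Y (hβα.trans hα).le (fun n hn => (hlate n hn).fast)
        (fun n hn => (hlate n hn).slow.trans (by
          have := mul_le_mul_of_nonneg_right (step_le_step hβα.le n) D.l_pos.le
          linarith)) hU0 hUs hn v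
  · intro ω hZω hUω n hn
    -- The iterates have just been projected at `n₀`, so their size is controlled whatever the
    -- initial values and the path so far.
    have hproj : ‖(it n₀ ω).1‖ ≤ Rθ ∧ ‖(it n₀ ω).2‖ ≤ Rw := by
      have h1 : j + 1 = k ^ k - 1 := by omega
      have h2 : (it (j + 1) ω).1 = _ := (hit ω).succ_θ j
      have h3 : (it (j + 1) ω).2 = _ := (hit ω).succ_w j
      rw [hj, h2, h3]
      exact ⟨norm_sparseProj_le (by omega) h1 hRθ0 _, norm_sparseProj_le (by omega) h1 hRw0 _⟩
    obtain ⟨hz0, hu0⟩ := hinit _ _ hproj.1 hproj.2 (step (α - β) n₀) (step_pos _ _).le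
      (step_le_one (by linarith) _)
    have h := D.path_le_envelope hd hβ hβα hα (by linarith) hδ (hit ω) (by omega : 0 < k) hn₀ hlate
      hB hK hB' hRθ hRw hr (Z := fun n => (s n ω).2.1) (U := fun n => (s n ω).2.2) (hZ0 ω) (hU0 ω)
      (fun n hn h1 h2 => by
        rw [hZs n hn, hNZ]
        simp only
        rw [hsit, truncate, if_pos ⟨h1, h2⟩])
      (fun n hn h1 h2 => by
        rw [hUs n hn, hNU]
        simp only
        rw [hsit, truncate, if_pos ⟨h1, h2⟩])
      hZω hUω hz0 hu0 hn
    refine ⟨?_, ?_⟩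
    · refine le_trans ?_ (add_le_add h.1 (hZω n hn))
      simpa using norm_add_le (D.slow (step (α - β) n) (it n ω).1 (it n ω).2 - (s n ω).2.1)
        (s n ω).2.1
    · refine le_trans ?_ (add_le_add h.2 (hUω n hn))
      simpa using norm_add_le (D.fast (it n ω).1 (it n ω).2 - (s n ω).2.2) (s n ω).2.2

end Decoupled

end GTD

namespace GTD

/-! ### The convergence rate of decoupled systems -/

lemma tendsto_step {a : ℝ} (ha : 0 < a) : Filter.Tendsto (step a) Filter.atTop (nhds 0) := by
  have h : Filter.Tendsto (fun n : ℕ => (n : ℝ) + 1) Filter.atTop Filter.atTop :=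
    Filter.tendsto_atTop_add_const_right _ _ tendsto_natCast_atTop_atTop
  exact (tendsto_rpow_neg_atTop ha).comp h

lemma eventually_mul_step_le {a : ℝ} (ha : 0 < a) (C : ℝ) {c : ℝ} (hc : 0 < c) :
    ∀ᶠ n in Filter.atTop, C * step a n ≤ c := by
  have h := (tendsto_step ha).const_mul C
  rw [mul_zero] at h
  exact h.eventually_le_const hc

/-- There are projection times which are late enough for the rate to be small, yet polynomial in
`1 + log (1 / δ)`. -/
lemma exists_projection_time {d : ℕ} (hd : 0 < d) {p β : ℝ} (hp : 0 ≤ p) (hβ : 0 < β) (n₁ : ℕ)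
    {B K r : ℝ} (hr : 0 < r) :
    ∃ A : ℝ, 1 ≤ A ∧ ∀ δ : ℝ, 0 < δ → δ < 1 → ∃ k n₀ : ℕ, 2 ≤ k ∧ n₀ + 1 = k ^ k ∧ n₁ ≤ n₀ ∧
      B / (k + 1) ≤ r ∧ (∀ n ≥ n₀, 2 * K * rate d p δ β n ≤ r) ∧
      (n₀ : ℝ) + 1 ≤ A * (1 + Real.log (1 / δ)) ^ (6 / β) := by
  obtain ⟨cr, hcr, hrate⟩ := exists_rate_sq_le hd hp hβ
  obtain ⟨k₀, hk₀⟩ := exists_nat_ge (B / r)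
  -- With this `Q`, `(2 K rate)² ≤ r²` follows from `Q ℓ ≤ (n + 1) ^ (β / 2)`, where `ℓ = 1 + log (1
  -- / δ)`; hence the power `2 / β` below.
  obtain ⟨Q, hQ⟩ : ∃ Q, Q = 4 * K ^ 2 * cr / r ^ 2 := ⟨_, rfl⟩
  have hQ0 : 0 ≤ Q := by rw [hQ]; positivity
  -- The summands ensure, in order, `T > 4`, `n₁ ≤ n₀`, `k ≥ k₀` (by monotonicity of `k ^ k`) and
  -- smallness of the rate.
  obtain ⟨T₀, hT₀⟩ : ∃ T₀, T₀ = 5 + ((n₁ : ℝ) + 1) + (k₀ : ℝ) ^ k₀ + Q ^ (2 / β) := ⟨_, rfl⟩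
  have hQp : 0 ≤ Q ^ (2 / β) := Real.rpow_nonneg hQ0 _
  have hk0p : (0 : ℝ) ≤ (k₀ : ℝ) ^ k₀ := by positivity
  have hn1p : (0 : ℝ) ≤ n₁ := Nat.cast_nonneg _
  have hT₀5 : 5 ≤ T₀ := by linarith
  refine ⟨T₀ ^ 3, one_le_pow₀ (by linarith), fun δ hδ hδ1 => ?_⟩
  have hrate' := hrate δ hδ hδ1
  have hℓ1 : 1 ≤ 1 + Real.log (1 / δ) := by
    have : 0 ≤ Real.log (1 / δ) := Real.log_nonneg (by rw [le_div_iff₀ hδ]; linarith)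
    linarith
  generalize 1 + Real.log (1 / δ) = ℓ at hℓ1 hrate' ⊢
  have hℓ0 : 0 < ℓ := by linarith
  have hℓp : 1 ≤ ℓ ^ (2 / β) := Real.one_le_rpow hℓ1 (by positivity)
  obtain ⟨T, hT⟩ : ∃ T, T = T₀ * ℓ ^ (2 / β) := ⟨_, rfl⟩
  have hTT₀ : T₀ ≤ T := hT ▸ le_mul_of_one_le_right (by linarith) hℓp
  obtain ⟨k, hk3, hkT, hkT3⟩ := exists_self_pow_between (by linarith : 4 < T)
  obtain ⟨n₀, hn₀⟩ : ∃ n₀, n₀ + 1 = k ^ k := ⟨k ^ k - 1, by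
    have : 0 < k ^ k := pow_pos (by omega) k
    omega⟩
  have hn₀R : (n₀ : ℝ) + 1 = (k : ℝ) ^ k := by exact_mod_cast hn₀
  refine ⟨k, n₀, by omega, hn₀, ?_, ?_, ?_, ?_⟩
  · have : (n₁ : ℝ) ≤ n₀ := by linarith
    exact_mod_cast this
  · have hkk₀ : k₀ ≤ k := by
      by_contra hlt
      have h1 : k ^ k ≤ k₀ ^ k₀ :=
        (Nat.pow_le_pow_left (not_le.1 hlt).le k).trans
          (Nat.pow_le_pow_right (by omega) (not_le.1 hlt).le)
      have h2 : (k : ℝ) ^ k ≤ (k₀ : ℝ) ^ k₀ := by exact_mod_cast h1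
      linarith
    rw [div_le_iff₀ (by positivity)]
    have h1 : B ≤ k₀ * r := (div_le_iff₀ hr).1 hk₀
    have h2 : (k₀ : ℝ) ≤ (k : ℝ) + 1 := by exact_mod_cast hkk₀.trans (Nat.le_succ k)
    rw [mul_comm]
    exact h1.trans (mul_le_mul_of_nonneg_right h2 hr.le)
  · intro n hn
    refine abs_le_of_sq_le_sq' ?_ hr.le |>.2
    have hTn : T ≤ (n : ℝ) + 1 := by
      have : (n₀ : ℝ) ≤ n := by exact_mod_cast hn
      linarith
    have h1 : Q * ℓ ≤ ((n : ℝ) + 1) ^ (β / 2) := by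
      calc Q * ℓ = (Q ^ (2 / β) * ℓ ^ (2 / β)) ^ (β / 2) := by
            rw [← Real.mul_rpow hQ0 hℓ0.le, ← Real.rpow_mul (by positivity)]
            have : 2 / β * (β / 2) = 1 := by field_simp
            rw [this, Real.rpow_one]
        _ ≤ ((n : ℝ) + 1) ^ (β / 2) := by
            refine Real.rpow_le_rpow (by positivity) (le_trans ?_ hTn) (by positivity)
            rw [hT]
            gcongr
            linarith
    have h2 : Q * ℓ * step (β / 2) n ≤ 1 := by
      calc _ ≤ ((n : ℝ) + 1) ^ (β / 2) * step (β / 2) n :=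
            mul_le_mul_of_nonneg_right h1 (step_pos _ _).le
        _ = 1 := by unfold step; rw [← Real.rpow_add (by positivity)]; simp
    calc (2 * K * rate d p δ β n) ^ 2 = 4 * K ^ 2 * rate d p δ β n ^ 2 := by ring
      _ ≤ 4 * K ^ 2 * (cr * ℓ * step (β / 2) n) :=
          mul_le_mul_of_nonneg_left (hrate' n) (by positivity)
      _ = r ^ 2 * (Q * ℓ * step (β / 2) n) := by rw [hQ]; field_simp
      _ ≤ r ^ 2 * 1 := by gcongr
      _ = r ^ 2 := mul_one _
  · rw [hn₀R]
    refine hkT3.trans (le_of_eq ?_)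
    rw [hT, mul_pow, ← Real.rpow_natCast (ℓ ^ (2 / β)) 3, ← Real.rpow_mul hℓ0.le]
    congr 2
    push_cast; ring

/-- After a time quadratic in `n₀`, the transient is below the rate. -/
lemma transient_le_rate {d : ℕ} (hd : 0 < d) {p δ a : ℝ} (hp : 0 ≤ p) (hδ : 0 < δ) (hδ1 : δ < 1)
    (ha : a ≤ 1) {B : ℝ} {n₀ n : ℕ} (hn : ((B + 1) * ((n₀ : ℝ) + 1)) ^ 2 ≤ (n : ℝ) + 1) :
    B * (((n₀ : ℝ) + 1) / ((n : ℝ) + 1)) ≤ rate d p δ a n := by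
  -- As `a ≤ 1`, the rate is at least `(n + 1) ^ (-1/2)`, whereas the transient is of order `1 / (n
  -- + 1)`.
  refine le_trans ?_ ((step_le_step (by linarith : a / 2 ≤ 1 / 2) n).trans
    (step_half_le_rate hd hp hδ hδ1 a n))
  have hn1 : (0 : ℝ) < (n : ℝ) + 1 := by positivity
  have hsq : (B + 1) * ((n₀ : ℝ) + 1) ≤ ((n : ℝ) + 1) ^ (1 / 2 : ℝ) := by
    rw [← Real.sqrt_eq_rpow]
    exact Real.le_sqrt_of_sq_le hn
  calc B * (((n₀ : ℝ) + 1) / ((n : ℝ) + 1)) ≤ (B + 1) * ((n₀ : ℝ) + 1) / ((n : ℝ) + 1) := by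
        rw [mul_div_assoc]
        gcongr
        linarith
    _ ≤ ((n : ℝ) + 1) ^ (1 / 2 : ℝ) / ((n : ℝ) + 1) := by gcongr
    _ = step (1 / 2) n := by
        unfold step
        nth_rewrite 2 [← Real.rpow_one ((n : ℝ) + 1)]
        rw [← Real.rpow_sub hn1]
        norm_num

namespace Decoupled

variable {d : ℕ} (D : Decoupled d)

/-- Each condition asks a power `(n + 1) ^ (-c)` to be small, with `c` equal to `β`, `1 - α` and `(α
- β) / 2`; this is where `0 < β < α < 1` enters. -/
lemma eventually_late {α β : ℝ} (hβ : 0 < β) (hβα : β < α) (hα : α < 1) :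
    ∀ᶠ n in Filter.atTop, D.Late α β n := by
  have hl := D.l_pos
  filter_upwards [eventually_mul_step_le hβ (D.M ^ 2) hl,
    eventually_mul_step_le (by linarith : 0 < 1 - α) 1 (by positivity : 0 < D.l / 4),
    eventually_mul_step_le (by linarith : 0 < (α - β) / 2) (16 * (5 * D.M ^ 4)) hl] with n h1 h2 h3
  refine ⟨by linarith, ?_, h3⟩
  calc 1 / ((n : ℝ) + 2) ≤ 1 / ((n : ℝ) + 1) := by gcongr; norm_num
    _ = step α n * step (1 - α) n := by rw [step_mul, ← step_one]; ring_nf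
    _ ≤ step α n * (D.l / 4) := mul_le_mul_of_nonneg_left (by linarith) (step_pos _ _).le
    _ = _ := by ring

lemma eventually_tail_le {p : ℝ} {c : ℝ} (hc : 0 < c) :
    ∀ᶠ n : ℕ in Filter.atTop, ∑' j, step p (j + n) ≤ c :=
  (tendsto_sum_nat_add (step p)).eventually_le_const hc

/-- A bound for the decoupled coordinates on the projection balls. -/
lemma coord_le_of_norm_le {Rθ Rw : ℝ} (hθs : ‖D.θs‖ ≤ Rθ) {θ w : Vec d} (hθ : ‖θ‖ ≤ Rθ)
    (hw : ‖w‖ ≤ Rw) {ρ : ℝ} (hρ : 0 ≤ ρ) (hρ1 : ρ ≤ 1) :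
    ‖D.slow ρ θ w‖ ≤ 2 * Rθ + D.M * (Rw + D.M * (2 * Rθ)) + (Rw + D.M * (2 * Rθ)) ∧
      ‖D.fast θ w‖ ≤ 2 * Rθ + D.M * (Rw + D.M * (2 * Rθ)) + (Rw + D.M * (2 * Rθ)) := by
  have hM := D.M_nonneg
  have hR : 0 ≤ Rθ := (norm_nonneg _).trans hθ
  have hRw : 0 ≤ Rw := (norm_nonneg _).trans hw
  have h1 : ‖θ - D.θs‖ ≤ 2 * Rθ := (norm_sub_le _ _).trans (by linarith)
  have h2 : ‖D.fast θ w‖ ≤ Rw + D.M * (2 * Rθ) :=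
    (norm_add_le _ _).trans (add_le_add hw
      ((D.norm_G_le _).trans (mul_le_mul_of_nonneg_left h1 hM)))
  have h3 : ‖ρ • D.H (D.fast θ w)‖ ≤ D.M * (Rw + D.M * (2 * Rθ)) := by
    rw [norm_smul, Real.norm_eq_abs, abs_of_nonneg hρ]
    exact (mul_le_of_le_one_left (norm_nonneg _) hρ1).trans
      ((D.norm_H_le _).trans (mul_le_mul_of_nonneg_left h2 hM))
  have h4 : 0 ≤ Rw + D.M * (2 * Rθ) := by positivity
  refine ⟨(norm_sub_le _ _).trans ((add_le_add h1 h3).trans (by linarith)), h2.trans ?_⟩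
  have : 0 ≤ 2 * Rθ + D.M * (Rw + D.M * (2 * Rθ)) := by positivity
  linarith

/-- Bounds on the coordinates translate into the rates of the iterates. -/
lemma iterate_le_of_coord_le {α β p δ C : ℝ} (hβα : β < α) {n : ℕ} {θ w : Vec d}
    (hC : 0 ≤ C) (hz : ‖D.slow (step (α - β) n) θ w‖ ≤ C * rate d p δ α n)
    (hu : ‖D.fast θ w‖ ≤ C * rate d p δ β n) :
    ‖θ - D.θs‖ ≤ C * (1 + D.M) * rate d p δ α n ∧
      ‖w‖ ≤ (C + D.M * (C * (1 + D.M))) * rate d p δ β n := by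
  have hM := D.M_nonneg
  have h0 := rate_nonneg d p δ α n
  have hθ : ‖θ - D.θs‖ ≤ C * (1 + D.M) * rate d p δ α n := by
    rw [← D.slow_add_smul (step (α - β) n) θ w]
    -- Removing the corrector costs nothing: `ρ` turns the `β`-rate of `u` into at most the
    -- `α`-rate.
    have h1 : step (α - β) n * rate d p δ β n ≤ rate d p δ α n := by
      rw [step_mul_rate]
      exact mul_le_of_le_one_left h0 (step_le_one (by linarith) _)
    have h2 : ‖step (α - β) n • D.H (D.fast θ w)‖ ≤ D.M * (C * rate d p δ α n) := by
      rw [norm_smul, Real.norm_eq_abs, abs_of_nonneg (step_pos _ _).le]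
      calc _ ≤ step (α - β) n * (D.M * (C * rate d p δ β n)) :=
            mul_le_mul_of_nonneg_left ((D.norm_H_le _).trans (mul_le_mul_of_nonneg_left hu hM))
              (step_pos _ _).le
        _ = D.M * (C * (step (α - β) n * rate d p δ β n)) := by ring
        _ ≤ _ := by gcongr
    refine (norm_add_le _ _).trans ((add_le_add hz h2).trans (le_of_eq (by ring)))
  refine ⟨hθ, ?_⟩
  have e : w = D.fast θ w - D.G (θ - D.θs) := by simp [fast]
  rw [e]
  refine (norm_sub_le _ _).trans ((add_le_add hu (D.norm_G_le _)).trans ?_)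
  have h3 : D.M * ‖θ - D.θs‖ ≤ D.M * (C * (1 + D.M) * rate d p δ β n) := by
    refine mul_le_mul_of_nonneg_left (hθ.trans ?_) hM
    exact mul_le_mul_of_nonneg_left (rate_anti d p δ hβα.le n) (by positivity)
  linarith

/-- The convergence rate of a decoupled linear two-timescale system with sparse projections. -/
theorem exists_rate_bound (hd : 0 < d) {α β p Rθ Rw : ℝ} (hβ : 0 < β) (hβα : β < α)
    (hα : α < 1) (hp : 1 < p) (hRw : 0 < Rw) (hθs : ‖D.θs‖ < Rθ) {c₀ : ℝ} (hc₀ : 0 < c₀) :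
    ∃ Cθ Cw K κ : ℝ, ∀ δ : ℝ, 0 < δ → δ < 1 →
      ∃ N : ℕ, (N : ℝ) ≤ K * (1 + Real.log (1 / δ)) ^ κ ∧
        ∀ (𝒳 : Type*) (Ω : Type*) [MeasurableSpace 𝒳] [MeasurableSpace Ω] (ν : Measure 𝒳)
          [IsProbabilityMeasure ν] (P : Measure Ω) [IsProbabilityMeasure P]
          (m₁ m₂ : Vec d × Vec d → 𝒳 → Vec d), Measurable (Function.uncurry m₁) →
          Measurable (Function.uncurry m₂) → (∀ q, ∫ y, m₁ q y ∂ν = 0) →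
          (∀ q, ∫ y, m₂ q y ∂ν = 0) → (∀ q y, ‖m₁ q y‖ ≤ c₀ * (1 + ‖q.1‖ + ‖q.2‖)) →
          (∀ q y, ‖m₂ q y‖ ≤ c₀ * (1 + ‖q.1‖ + ‖q.2‖)) → ∀ (x : ℕ → Ω → 𝒳),
          (∀ n, Measurable (x n)) → iIndepFun x P → (∀ n, P.map (x n) = ν) →
          ∀ (it : ℕ → Ω → Vec d × Vec d) (i₀ : Vec d × Vec d), (∀ ω, it 0 ω = i₀) →
          (∀ ω, D.IsPath α β Rθ Rw (fun n => (it n ω).1) (fun n => (it n ω).2)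
            (fun n => m₁ (it n ω) (x n ω)) (fun n => m₂ (it n ω) (x n ω))) →
          1 - δ < P.real {ω | ∀ n ≥ N, ‖(it n ω).1 - D.θs‖ ≤ Cθ * rate d p δ α n ∧
            ‖(it n ω).2‖ ≤ Cw * rate d p δ β n} := by
  have hM := D.one_le_M
  have hM0 := D.M_nonneg
  have hl := D.l_pos
  have hRθ : 0 < Rθ := (norm_nonneg _).trans_lt hθs
  have hd' : (0 : ℝ) < d := by exact_mod_cast hd
  have hθs0 := norm_nonneg D.θs
  -- `R` is the distance from the limits `θs` and `0` to the projection spheres. The transient and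
  -- the multiple of the rate may each use up `r`, and `3 M² (r + r) = R`.
  obtain ⟨R, hR⟩ : ∃ R, R = min (Rθ - ‖D.θs‖) Rw := ⟨_, rfl⟩
  have hR0 : 0 < R := hR ▸ lt_min (by linarith) hRw
  have hR1 : R ≤ Rθ - ‖D.θs‖ := hR ▸ min_le_left _ _
  have hR2 : R ≤ Rw := hR ▸ min_le_right _ _
  obtain ⟨r, hr0, hr1⟩ : ∃ r, 0 < r ∧ 3 * D.M ^ 2 * (r + r) = R :=
    ⟨R / (6 * D.M ^ 2), by positivity, by field_simp; ring⟩
  obtain ⟨B, hB0, hB⟩ : ∃ B, 0 ≤ B ∧ ∀ θ w : Vec d, ‖θ‖ ≤ Rθ → ‖w‖ ≤ Rw → ∀ ρ, 0 ≤ ρ → ρ ≤ 1 →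
      ‖D.slow ρ θ w‖ ≤ B ∧ ‖D.fast θ w‖ ≤ B :=
    ⟨_, by positivity, fun θ w h1 h2 ρ h3 h4 => D.coord_le_of_norm_le hθs.le h1 h2 h3 h4⟩
  obtain ⟨B', hB'0, hB'⟩ : ∃ B', 0 ≤ B' ∧ ‖D.θs‖ + 3 * D.M ^ 2 * (B + r) ≤ B' :=
    ⟨_, by positivity, le_rfl⟩
  obtain ⟨c, hc0, hc⟩ : ∃ c, 0 < c ∧ c₀ * (1 + B' + B') ≤ c := ⟨_, by positivity, le_rfl⟩
  obtain ⟨K, hK0, hK2⟩ : ∃ K : ℝ, 0 ≤ K ∧ 2 * d * (2 * (3 * D.M ^ 2 * c) ^ 2 / D.l) ≤ K ^ 2 :=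
    ⟨√_, Real.sqrt_nonneg _, (Real.sq_sqrt (by positivity)).ge⟩
  obtain ⟨n₁, hn₁⟩ := Filter.eventually_atTop.1 ((D.eventually_late hβ hβα hα).and
    (eventually_tail_le (p := p) (by norm_num : (0 : ℝ) < 1 / 2)))
  obtain ⟨A, hA1, hA⟩ := exists_projection_time hd (by linarith : (0 : ℝ) ≤ p) hβ n₁ (B := B)
    (K := K) hr0
  -- In `1 + 2 K` the transient counts for one rate, the envelope and the noise recursion for `K`
  -- each. The exponent `12 / β` is twice `6 / β`, because the threshold is quadratic in `n₀`.
  refine ⟨(1 + 2 * K) * (1 + D.M), (1 + 2 * K) + D.M * ((1 + 2 * K) * (1 + D.M)),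
    ((B + 1) * A) ^ 2 + 1, 12 / β, fun δ hδ hδ1 => ?_⟩
  obtain ⟨k, n₀, hk2, hn₀, hn₀1, hBk, hsmall, hn₀A⟩ := hA δ hδ hδ1
  have hBkr : 3 * D.M ^ 2 * (B / (k + 1) + r) ≤ R := by
    rw [← hr1]
    exact mul_le_mul_of_nonneg_left (by linarith) (by positivity)
  refine ⟨⌈((B + 1) * ((n₀ : ℝ) + 1)) ^ 2⌉₊, ?_, ?_⟩
  · have hℓ1 : 1 ≤ 1 + Real.log (1 / δ) := by
      have : 0 ≤ Real.log (1 / δ) := Real.log_nonneg (by rw [le_div_iff₀ hδ]; linarith)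
      linarith
    generalize 1 + Real.log (1 / δ) = ℓ at hℓ1 hn₀A ⊢
    have h3 : ℓ ^ (12 / β) = (ℓ ^ (6 / β)) ^ 2 := by
      rw [← Real.rpow_natCast (ℓ ^ (6 / β)) 2, ← Real.rpow_mul (by linarith)]
      congr 1
      push_cast; ring
    have h4 : 1 ≤ ℓ ^ (12 / β) := Real.one_le_rpow hℓ1 (by positivity)
    calc _ ≤ ((B + 1) * ((n₀ : ℝ) + 1)) ^ 2 + 1 := (Nat.ceil_lt_add_one (by positivity)).le
      _ ≤ ((B + 1) * (A * ℓ ^ (6 / β))) ^ 2 + ℓ ^ (12 / β) := by gcongr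
      _ = _ := by rw [h3]; ring
  intro 𝒳 Ω _ _ ν _ P _ m₁ m₂ hm₁ hm₂ h0₁ h0₂ hb₁ hb₂ x hx hind hν it i₀ hi₀ hit
  have hint : ∀ m : Vec d × Vec d → 𝒳 → Vec d, Measurable (Function.uncurry m) →
      (∀ q y, ‖m q y‖ ≤ c₀ * (1 + ‖q.1‖ + ‖q.2‖)) → ∀ q, Integrable (m q) ν := fun m hm hb q =>
    Integrable.of_bound (hm.comp measurable_prodMk_left).aestronglyMeasurable
      (c₀ * (1 + ‖q.1‖ + ‖q.2‖)) (ae_of_all _ fun y => hb q y)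
  have hbc : ∀ m : Vec d × Vec d → 𝒳 → Vec d, (∀ q y, ‖m q y‖ ≤ c₀ * (1 + ‖q.1‖ + ‖q.2‖)) →
      ∀ q y, ‖q.1‖ ≤ B' → ‖q.2‖ ≤ B' → ‖m q y‖ ≤ c := fun m hb q y h1 h2 =>
    (hb q y).trans ((mul_le_mul_of_nonneg_left (by linarith) hc₀.le).trans hc)
  have hmain := D.one_sub_lt_measureReal_envelope hd hβ hβα hα hp hδ hδ1 hk2 hn₀
    (fun n hn => (hn₁ n (hn₀1.trans hn)).1) (hn₁ n₀ hn₀1).2 hB0 hc0 hB' hRθ.le hRw.le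
    (by linarith) (hBkr.trans hR2) hK0 hK2 hsmall hB hm₁ hm₂ (hint m₁ hm₁ hb₁)
    (hint m₂ hm₂ hb₂) h0₁ h0₂ (hbc m₁ hb₁) (hbc m₂ hb₂) hx hind hν hi₀ hit
  refine hmain.trans_le (measureReal_mono ?_)
  intro ω hω n hn
  have hxn : ((B + 1) * ((n₀ : ℝ) + 1)) ^ 2 ≤ (n : ℝ) + 1 := by
    have h1 := Nat.le_ceil (((B + 1) * ((n₀ : ℝ) + 1)) ^ 2)
    have h2 : ((⌈((B + 1) * ((n₀ : ℝ) + 1)) ^ 2⌉₊ : ℕ) : ℝ) ≤ n := by exact_mod_cast hn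
    linarith
  have hn₀n : n₀ ≤ n := by
    have h0 : (1 : ℝ) ≤ (n₀ : ℝ) + 1 := by simp
    have h1 : (n₀ : ℝ) + 1 ≤ (B + 1) * ((n₀ : ℝ) + 1) :=
      le_mul_of_one_le_left (by positivity) (by linarith)
    have h2 := (h1.trans (le_self_pow₀ (h0.trans h1) two_ne_zero)).trans hxn
    have h3 : (n₀ : ℝ) ≤ n := by linarith
    exact_mod_cast h3
  obtain ⟨hz, hu⟩ := hω n hn₀n
  unfold envelope at hz hu
  have hzr := transient_le_rate hd (by linarith : 0 ≤ p) hδ hδ1 hα.le hxn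
  have hur := transient_le_rate hd (by linarith : 0 ≤ p) hδ hδ1 (hβα.trans hα).le hxn
  exact D.iterate_le_of_coord_le (C := 1 + 2 * K) hβα (by linarith) (by linarith) (by linarith)

end Decoupled

end GTD

namespace GTD

/-! ### Expectations of linear statistics -/

lemma integrable_inner_smul {d : ℕ} {𝒳 : Type*} [MeasurableSpace 𝒳] {ν : Measure 𝒳}
    [IsFiniteMeasure ν] {f g : 𝒳 → Vec d} (hf : Measurable f) (hg : Measurable g) {c c' : ℝ}
    (hfb : ∀ y, ‖f y‖ ≤ c) (hgb : ∀ y, ‖g y‖ ≤ c') (w : Vec d) :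
    Integrable (fun y => ⟪g y, w⟫_ℝ • f y) ν := by
  refine Integrable.of_bound (by fun_prop : Measurable fun y => ⟪g y, w⟫_ℝ • f y).aestronglyMeasurable
    (c' * ‖w‖ * c) (ae_of_all _ fun y => ?_)
  have h0 : 0 ≤ c' := (norm_nonneg _).trans (hgb y)
  rw [norm_smul]
  refine mul_le_mul ((norm_inner_le_norm _ _).trans ?_) (hfb y) (norm_nonneg _) (by positivity)
  gcongr
  exact hgb y

/-- Pointwise `⟪g, w⟫ • f = (f gᵀ) w`. The instances give `A`, `Aᵀ` and `C` as mean operators. -/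
lemma integral_inner_smul_eq {d : ℕ} {𝒳 : Type*} [MeasurableSpace 𝒳] {ν : Measure 𝒳}
    [IsFiniteMeasure ν] {f g : 𝒳 → Vec d} (hf : Measurable f) (hg : Measurable g) {c c' : ℝ}
    (hfb : ∀ y, ‖f y‖ ≤ c) (hgb : ∀ y, ‖g y‖ ≤ c') (w : Vec d) :
    ∫ y, ⟪g y, w⟫_ℝ • f y ∂ν =
      WithLp.toLp 2 ((Matrix.of fun i j => ∫ y, f y i * g y j ∂ν) *ᵥ w.ofLp) := by
  have hint := integrable_inner_smul (ν := ν) hf hg hfb hgb w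
  have hcoord : ∀ (h : 𝒳 → Vec d) (c : ℝ), (∀ y, ‖h y‖ ≤ c) → ∀ i y, |h y i| ≤ c :=
    fun h c hb i y => (PiLp.norm_apply_le (h y) i).trans (hb y)
  have hint2 : ∀ i j, Integrable (fun y => f y i * g y j) ν := fun i j => by
    refine Integrable.of_bound (by fun_prop : Measurable fun y => f y i * g y j).aestronglyMeasurable
      (c * c') (ae_of_all _ fun y => ?_)
    rw [norm_mul]
    exact mul_le_mul (hcoord f c hfb i y) (hcoord g c' hgb j y) (norm_nonneg _)
      ((norm_nonneg _).trans (hfb y))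
  ext i
  have h1 := (EuclideanSpace.proj (𝕜 := ℝ) i).integral_comp_comm hint
  have h2 : (∫ y, ⟪g y, w⟫_ℝ • f y ∂ν) i = ∫ y, (⟪g y, w⟫_ℝ • f y) i ∂ν := h1.symm
  rw [h2]
  simp only [PiLp.smul_apply, smul_eq_mul, PiLp.inner_apply, Matrix.mulVec, dotProduct,
    Matrix.of_apply]
  have h3 : ∀ y, (∑ j, inner ℝ (g y j) (w j)) * f y i = ∑ j, f y i * g y j * w j := fun y => by
    rw [Finset.sum_mul]
    refine Finset.sum_congr rfl fun j _ => ?_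
    simp; ring
  simp only [h3]
  rw [integral_finsetSum _ fun j _ => (hint2 i j).mul_const _]
  simp only [integral_mul_const]

/-- The quadratic form attains a positive minimum on the compact unit sphere; homogeneity does the
rest. -/
lemma exists_coercive {V : Type*} [NormedAddCommGroup V] [InnerProductSpace ℝ V]
    [FiniteDimensional ℝ V] (X : V →L[ℝ] V) (hX : ∀ v, v ≠ 0 → 0 < ⟪X v, v⟫_ℝ) :
    ∃ l : ℝ, 0 < l ∧ ∀ v, l * ‖v‖ ^ 2 ≤ ⟪X v, v⟫_ℝ := by
  rcases subsingleton_or_nontrivial V with hV | hV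
  · exact ⟨1, one_pos, fun v => by simp [Subsingleton.elim v 0]⟩
  have : ProperSpace V := FiniteDimensional.proper ℝ V
  obtain ⟨v₀, hv₀, hmin⟩ := (isCompact_sphere (0 : V) 1).exists_isMinOn
    (NormedSpace.sphere_nonempty.2 zero_le_one)
    (f := fun v => ⟪X v, v⟫_ℝ) (by fun_prop)
  have hv₀1 : ‖v₀‖ = 1 := by simpa using hv₀
  refine ⟨⟪X v₀, v₀⟫_ℝ, hX v₀ (by rintro rfl; simp at hv₀1), fun v => ?_⟩
  rcases eq_or_ne v 0 with rfl | hv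
  · simp
  have hn := norm_pos_iff.2 hv
  have h1 := hmin (a := ‖v‖⁻¹ • v) (by simp [norm_smul, hn.ne'])
  simp only [Set.mem_ofPred_eq, map_smul, inner_smul_left, inner_smul_right] at h1
  simp only [conj_trivial] at h1
  calc ⟪X v₀, v₀⟫_ℝ * ‖v‖ ^ 2 ≤ ‖v‖⁻¹ * (‖v‖⁻¹ * ⟪X v, v⟫_ℝ) * ‖v‖ ^ 2 := by gcongr
    _ = _ := by field_simp

/-! ### Second moments of the features and positivity of `A` and `C` -/

namespace PolicyEval

variable {d : ℕ} {S Act : Type*} [MeasurableSpace S] [MeasurableSpace Act]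
  (E : PolicyEval d S Act)

instance : IsMarkovKernel E.chain := by unfold chain; infer_instance

instance : IsProbabilityMeasure E.pairLaw := by unfold pairLaw; infer_instance

lemma measurable_r : Measurable E.r :=
  E.measurable_reward.comp (measurable_id.prodMk E.measurable_π)

lemma map_fst_pairLaw : E.pairLaw.map Prod.fst = E.μ := by
  have := Measure.fst_compProd E.μ E.chain
  exact this

/-- This is the stationarity of `μ`. -/
lemma map_snd_pairLaw : E.pairLaw.map Prod.snd = E.μ := by
  have := Measure.snd_compProd E.μ E.chain
  exact this.trans E.stationary

lemma integral_fst {F : Type*} [NormedAddCommGroup F] [NormedSpace ℝ F] (f : S → F)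
    (hf : AEStronglyMeasurable f E.μ) : ∫ z, f z.1 ∂E.pairLaw = ∫ s, f s ∂E.μ := by
  have h := integral_map (μ := E.pairLaw) (φ := Prod.fst) (f := f) measurable_fst.aemeasurable
    (by rwa [map_fst_pairLaw])
  rw [← h, map_fst_pairLaw]

lemma integral_snd {F : Type*} [NormedAddCommGroup F] [NormedSpace ℝ F] (f : S → F)
    (hf : AEStronglyMeasurable f E.μ) : ∫ z, f z.2 ∂E.pairLaw = ∫ s, f s ∂E.μ := by
  have h := integral_map (μ := E.pairLaw) (φ := Prod.snd) (f := f) measurable_snd.aemeasurable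
    (by rwa [map_snd_pairLaw])
  rw [← h, map_snd_pairLaw]

variable {E}

lemma norm_φ_sub_le (hφ : ∀ s, ‖E.φ s‖ ≤ 1) (z : S × S) : ‖E.φ z.1 - E.γ • E.φ z.2‖ ≤ 2 := by
  refine (norm_sub_le _ _).trans ?_
  rw [norm_smul, Real.norm_eq_abs, abs_of_nonneg E.γ_nonneg]
  have h1 := hφ z.1
  have h2 : E.γ * ‖E.φ z.2‖ ≤ 1 := mul_le_one₀ E.γ_lt_one.le (norm_nonneg _) (hφ z.2)
  linarith

lemma measurable_φ_fst : Measurable fun z : S × S => E.φ z.1 := E.measurable_φ.comp measurable_fst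

lemma measurable_φ_snd : Measurable fun z : S × S => E.φ z.2 := E.measurable_φ.comp measurable_snd

lemma measurable_φ_sub : Measurable fun z : S × S => E.φ z.1 - E.γ • E.φ z.2 :=
  E.measurable_φ_fst.sub (E.measurable_φ_snd.const_smul E.γ)

lemma integral_A (hφ : ∀ s, ‖E.φ s‖ ≤ 1) (θ : Vec d) :
    ∫ z, ⟪E.φ z.1 - E.γ • E.φ z.2, θ⟫_ℝ • E.φ z.1 ∂E.pairLaw =
      Matrix.toEuclideanCLM (𝕜 := ℝ) E.A θ :=
  integral_inner_smul_eq E.measurable_φ_fst E.measurable_φ_sub (fun z => hφ z.1)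
    (norm_φ_sub_le hφ) θ

lemma integral_A_transpose (hφ : ∀ s, ‖E.φ s‖ ≤ 1) (w : Vec d) :
    ∫ z, ⟪E.φ z.1, w⟫_ℝ • (E.φ z.1 - E.γ • E.φ z.2) ∂E.pairLaw =
      Matrix.toEuclideanCLM (𝕜 := ℝ) E.Aᵀ w := by
  rw [integral_inner_smul_eq E.measurable_φ_sub E.measurable_φ_fst (norm_φ_sub_le hφ)
    (fun z => hφ z.1) w]
  have : (Matrix.of fun i j => ∫ z, (E.φ z.1 - E.γ • E.φ z.2) i * E.φ z.1 j ∂E.pairLaw) = E.Aᵀ := by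
    ext i j
    simp only [Matrix.of_apply, Matrix.transpose_apply, A]
    refine integral_congr_ae (ae_of_all _ fun z => ?_)
    simp [mul_comm]
  rw [this]
  rfl

lemma integral_C (hφ : ∀ s, ‖E.φ s‖ ≤ 1) (w : Vec d) :
    ∫ z, ⟪E.φ z.1, w⟫_ℝ • E.φ z.1 ∂E.pairLaw = Matrix.toEuclideanCLM (𝕜 := ℝ) E.C w := by
  have hm := E.measurable_φ
  rw [E.integral_fst (fun s => ⟪E.φ s, w⟫_ℝ • E.φ s)
    (by fun_prop : Measurable fun s => ⟪E.φ s, w⟫_ℝ • E.φ s).aestronglyMeasurable,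
    integral_inner_smul_eq hm hm hφ hφ w]
  rfl

lemma integrable_r_smul (hr : ∀ s, |E.r s| ≤ 1) (hφ : ∀ s, ‖E.φ s‖ ≤ 1) :
    Integrable (fun s => E.r s • E.φ s) E.μ := by
  have hm := E.measurable_φ
  have hm' := E.measurable_r
  refine Integrable.of_bound (by fun_prop : Measurable fun s => E.r s • E.φ s).aestronglyMeasurable
    1 (ae_of_all _ fun s => ?_)
  rw [norm_smul]
  exact mul_le_one₀ (hr s) (norm_nonneg _) (hφ s)

lemma integral_b (hr : ∀ s, |E.r s| ≤ 1) (hφ : ∀ s, ‖E.φ s‖ ≤ 1) :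
    ∫ z, E.r z.1 • E.φ z.1 ∂E.pairLaw = WithLp.toLp 2 E.b := by
  have hint := integrable_r_smul hr hφ
  rw [E.integral_fst (fun s => E.r s • E.φ s) hint.aestronglyMeasurable]
  ext i
  exact ((EuclideanSpace.proj (𝕜 := ℝ) i).integral_comp_comm hint).symm

lemma integrable_r_smul_fst (hr : ∀ s, |E.r s| ≤ 1) (hφ : ∀ s, ‖E.φ s‖ ≤ 1) :
    Integrable (fun z : S × S => E.r z.1 • E.φ z.1) E.pairLaw := by
  have h := integrable_r_smul hr hφ
  rw [← E.map_fst_pairLaw] at h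
  exact h.comp_measurable measurable_fst

lemma integral_sq_pos (hφ : ∀ s, ‖E.φ s‖ ≤ 1) (hE : E.FullRank) {v : Vec d} (hv : v ≠ 0) :
    0 < ∫ s, ⟪E.φ s, v⟫_ℝ ^ 2 ∂E.μ := by
  have hm := E.measurable_φ
  have hint : Integrable (fun s => ⟪E.φ s, v⟫_ℝ ^ 2) E.μ := by
    refine Integrable.of_bound (by fun_prop : Measurable fun s => ⟪E.φ s, v⟫_ℝ ^ 2).aestronglyMeasurable
      (‖v‖ ^ 2) (ae_of_all _ fun s => ?_)
    rw [norm_pow]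
    gcongr
    exact (norm_inner_le_norm _ _).trans (mul_le_of_le_one_left (norm_nonneg _) (hφ s))
  refine lt_of_le_of_ne (integral_nonneg fun s => sq_nonneg _) fun h => hv (hE v ?_)
  have h2 := (integral_eq_zero_iff_of_nonneg (fun s => sq_nonneg ⟪E.φ s, v⟫_ℝ) hint).1 h.symm
  filter_upwards [h2] with s hs
  simpa using hs

lemma inner_C_pos (hφ : ∀ s, ‖E.φ s‖ ≤ 1) (hE : E.FullRank) {v : Vec d} (hv : v ≠ 0) :
    0 < ⟪Matrix.toEuclideanCLM (𝕜 := ℝ) E.C v, v⟫_ℝ := by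
  have hm := E.measurable_φ
  rw [← integral_C hφ, real_inner_comm, ← integral_inner (integrable_inner_smul
    E.measurable_φ_fst E.measurable_φ_fst (fun z => hφ z.1) (fun z => hφ z.1) v)]
  refine (integral_sq_pos hφ hE hv).trans_le (le_of_eq ?_)
  rw [← E.integral_fst (fun s => ⟪E.φ s, v⟫_ℝ ^ 2)
    (by fun_prop : Measurable fun s => ⟪E.φ s, v⟫_ℝ ^ 2).aestronglyMeasurable]
  refine integral_congr_ae (ae_of_all _ fun z => ?_)
  simp only [inner_smul_right, real_inner_comm v]
  ring

/-- With `y = ⟪φ, v⟫` and `y' = ⟪φ', v⟫`, `y (y - γ y') ≥ (1 - γ / 2) y² - (γ / 2) y'²`. By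
stationarity `y` and `y'` have the same second moment, so the mean is at least `(1 - γ) E[y²]`,
which full rank makes positive. -/
lemma inner_A_pos (hφ : ∀ s, ‖E.φ s‖ ≤ 1) (hE : E.FullRank) {v : Vec d} (hv : v ≠ 0) :
    0 < ⟪Matrix.toEuclideanCLM (𝕜 := ℝ) E.A v, v⟫_ℝ := by
  have hm := E.measurable_φ
  have hm1 := E.measurable_φ_fst
  have hm2 := E.measurable_φ_snd
  have hpos := integral_sq_pos hφ hE hv
  have hbound : ∀ s, |⟪E.φ s, v⟫_ℝ| ≤ ‖v‖ := fun s =>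
    (abs_real_inner_le_norm _ _).trans (mul_le_of_le_one_left (norm_nonneg _) (hφ s))
  have hsq : ∀ s, ‖⟪E.φ s, v⟫_ℝ ^ 2‖ ≤ ‖v‖ ^ 2 := fun s => by
    rw [norm_pow]; exact pow_le_pow_left₀ (norm_nonneg _) (hbound s) 2
  have hmeas : AEStronglyMeasurable (fun s => ⟪E.φ s, v⟫_ℝ ^ 2) E.μ :=
    (by fun_prop : Measurable fun s => ⟪E.φ s, v⟫_ℝ ^ 2).aestronglyMeasurable
  have hi1 : Integrable (fun z : S × S => ⟪E.φ z.1, v⟫_ℝ ^ 2) E.pairLaw :=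
    Integrable.of_bound
      (by fun_prop : Measurable fun z : S × S => ⟪E.φ z.1, v⟫_ℝ ^ 2).aestronglyMeasurable _
      (ae_of_all _ fun z => hsq z.1)
  have hi2 : Integrable (fun z : S × S => ⟪E.φ z.2, v⟫_ℝ ^ 2) E.pairLaw :=
    Integrable.of_bound
      (by fun_prop : Measurable fun z : S × S => ⟪E.φ z.2, v⟫_ℝ ^ 2).aestronglyMeasurable _
      (ae_of_all _ fun z => hsq z.2)
  have hiA := integrable_inner_smul (ν := E.pairLaw) hm1 E.measurable_φ_sub (fun z => hφ z.1)
    (norm_φ_sub_le hφ) v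
  rw [← integral_A hφ, real_inner_comm, ← integral_inner hiA]
  have h1 : ∫ z : S × S, ((1 - E.γ / 2) * ⟪E.φ z.1, v⟫_ℝ ^ 2 - E.γ / 2 * ⟪E.φ z.2, v⟫_ℝ ^ 2)
      ∂E.pairLaw = (1 - E.γ) * ∫ s, ⟪E.φ s, v⟫_ℝ ^ 2 ∂E.μ := by
    rw [integral_sub (hi1.const_mul _) (hi2.const_mul _), integral_const_mul, integral_const_mul,
      E.integral_fst _ hmeas, E.integral_snd _ hmeas]
    ring
  have h2 : 0 < (1 - E.γ) * ∫ s, ⟪E.φ s, v⟫_ℝ ^ 2 ∂E.μ :=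
    mul_pos (by linarith [E.γ_lt_one]) hpos
  rw [← h1] at h2
  refine h2.trans_le (integral_mono ((hi1.const_mul _).sub (hi2.const_mul _))
    (hiA.const_inner v) fun z => ?_)
  simp only [inner_smul_right, real_inner_comm v, inner_sub_right]
  nlinarith [mul_nonneg E.γ_nonneg (sq_nonneg (⟪v, E.φ z.1⟫_ℝ - ⟪v, E.φ z.2⟫_ℝ))]

end PolicyEval

/-! ### The mean drifts of the algorithms -/

lemma tdError_eq {d : ℕ} (γ r : ℝ) (φ φ' θ : Vec d) :
    Algorithm.tdError γ r φ φ' θ = r - ⟪φ - γ • φ', θ⟫_ℝ := by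
  simp only [Algorithm.tdError, inner_sub_left, inner_smul_left, conj_trivial]
  ring

namespace PolicyEval

variable {d : ℕ} {S Act : Type*} [MeasurableSpace S] [MeasurableSpace Act]
  {E : PolicyEval d S Act}

lemma integral_incTheta (hr : ∀ s, |E.r s| ≤ 1) (hφ : ∀ s, ‖E.φ s‖ ≤ 1) (alg : Algorithm)
    (θ w : Vec d) :
    ∫ z, alg.incTheta E.γ (E.r z.1) (E.φ z.1) (E.φ z.2) θ w ∂E.pairLaw =
      WithLp.toLp 2 (alg.system E.A E.C E.b).v₁ -
        Matrix.toEuclideanCLM (𝕜 := ℝ) (alg.system E.A E.C E.b).Γ₁ θ -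
        Matrix.toEuclideanCLM (𝕜 := ℝ) (alg.system E.A E.C E.b).W₁ w := by
  have hA := integrable_inner_smul (ν := E.pairLaw) E.measurable_φ_fst E.measurable_φ_sub
    (fun z => hφ z.1) (norm_φ_sub_le hφ) θ
  have hC := integrable_inner_smul (ν := E.pairLaw) E.measurable_φ_fst E.measurable_φ_fst
    (fun z => hφ z.1) (fun z => hφ z.1) w
  have hAt := integrable_inner_smul (ν := E.pairLaw) E.measurable_φ_sub E.measurable_φ_fst
    (norm_φ_sub_le hφ) (fun z => hφ z.1) w
  have hb := integrable_r_smul_fst hr hφ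
  cases alg with
  | gtd0 =>
    simp only [Algorithm.incTheta, Algorithm.system, integral_A_transpose hφ, map_zero, map_neg]
    simp
  | gtd2 =>
    simp only [Algorithm.incTheta, Algorithm.system, integral_A_transpose hφ, map_zero, map_neg]
    simp
  | tdc =>
    -- Writing `-γ φ' = -φ + (φ - γ φ')` produces the two parts of `W₁ = C - Aᵀ`.
    have e : ∀ z : S × S, Algorithm.tdc.incTheta E.γ (E.r z.1) (E.φ z.1) (E.φ z.2) θ w =
        E.r z.1 • E.φ z.1 - ⟪E.φ z.1 - E.γ • E.φ z.2, θ⟫_ℝ • E.φ z.1 -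
          ⟪E.φ z.1, w⟫_ℝ • E.φ z.1 + ⟪E.φ z.1, w⟫_ℝ • (E.φ z.1 - E.γ • E.φ z.2) := fun z => by
      simp only [Algorithm.incTheta, tdError_eq]
      module
    simp only [e]
    have i1 : Integrable (fun z : S × S => E.r z.1 • E.φ z.1 -
      ⟪E.φ z.1 - E.γ • E.φ z.2, θ⟫_ℝ • E.φ z.1) E.pairLaw := hb.sub hA
    have i2 : Integrable (fun z : S × S => E.r z.1 • E.φ z.1 -
      ⟪E.φ z.1 - E.γ • E.φ z.2, θ⟫_ℝ • E.φ z.1 - ⟪E.φ z.1, w⟫_ℝ • E.φ z.1) E.pairLaw := i1.sub hC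
    rw [integral_add i2 hAt, integral_sub i1 hC, integral_sub hb hA, integral_b hr hφ,
      integral_A hφ, integral_C hφ, integral_A_transpose hφ]
    simp only [Algorithm.system, map_sub, sub_apply]
    abel

lemma integral_incW (hr : ∀ s, |E.r s| ≤ 1) (hφ : ∀ s, ‖E.φ s‖ ≤ 1) (alg : Algorithm)
    (θ w : Vec d) :
    ∫ z, alg.incW E.γ (E.r z.1) (E.φ z.1) (E.φ z.2) θ w ∂E.pairLaw =
      WithLp.toLp 2 (alg.system E.A E.C E.b).v₂ -
        Matrix.toEuclideanCLM (𝕜 := ℝ) (alg.system E.A E.C E.b).Γ₂ θ -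
        Matrix.toEuclideanCLM (𝕜 := ℝ) (alg.system E.A E.C E.b).W₂ w := by
  have hA := integrable_inner_smul (ν := E.pairLaw) E.measurable_φ_fst E.measurable_φ_sub
    (fun z => hφ z.1) (norm_φ_sub_le hφ) θ
  have hC := integrable_inner_smul (ν := E.pairLaw) E.measurable_φ_fst E.measurable_φ_fst
    (fun z => hφ z.1) (fun z => hφ z.1) w
  have hb := integrable_r_smul_fst hr hφ
  have i1 : Integrable (fun z : S × S => E.r z.1 • E.φ z.1 -
    ⟪E.φ z.1 - E.γ • E.φ z.2, θ⟫_ℝ • E.φ z.1) E.pairLaw := hb.sub hA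
  cases alg with
  | gtd0 =>
    simp only [Algorithm.incW, tdError_eq, sub_smul]
    rw [integral_sub i1 (integrable_const w), integral_sub hb hA, integral_b hr hφ,
      integral_A hφ]
    simp [Algorithm.system]
  | gtd2 =>
    simp only [Algorithm.incW, tdError_eq, sub_smul]
    rw [integral_sub i1 hC, integral_sub hb hA, integral_b hr hφ, integral_A hφ, integral_C hφ]
    rfl
  | tdc =>
    simp only [Algorithm.incW, tdError_eq, sub_smul]
    rw [integral_sub i1 hC, integral_sub hb hA, integral_b hr hφ, integral_A hφ, integral_C hφ]
    rfl

lemma norm_tdError_le (hr : ∀ s, |E.r s| ≤ 1) (hφ : ∀ s, ‖E.φ s‖ ≤ 1) (z : S × S) (θ : Vec d) :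
    |Algorithm.tdError E.γ (E.r z.1) (E.φ z.1) (E.φ z.2) θ| ≤ 1 + 2 * ‖θ‖ := by
  rw [tdError_eq]
  refine (abs_sub _ _).trans (add_le_add (hr _) ((abs_real_inner_le_norm _ _).trans ?_))
  gcongr
  exact norm_φ_sub_le hφ z

lemma norm_incTheta_le (hr : ∀ s, |E.r s| ≤ 1) (hφ : ∀ s, ‖E.φ s‖ ≤ 1) (alg : Algorithm)
    (z : S × S) (θ w : Vec d) :
    ‖alg.incTheta E.γ (E.r z.1) (E.φ z.1) (E.φ z.2) θ w‖ ≤ 2 * (1 + ‖θ‖ + ‖w‖) := by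
  have hθ := norm_nonneg θ
  have hw := norm_nonneg w
  have h1 : |⟪E.φ z.1, w⟫_ℝ| ≤ ‖w‖ :=
    (abs_real_inner_le_norm _ _).trans (mul_le_of_le_one_left hw (hφ _))
  have h2 : ‖⟪E.φ z.1, w⟫_ℝ • (E.φ z.1 - E.γ • E.φ z.2)‖ ≤ ‖w‖ * 2 := by
    rw [norm_smul]
    exact mul_le_mul h1 (norm_φ_sub_le hφ z) (norm_nonneg _) hw
  cases alg with
  | gtd0 => exact h2.trans (by linarith)
  | gtd2 => exact h2.trans (by linarith)
  | tdc =>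
    have h3 : ‖Algorithm.tdError E.γ (E.r z.1) (E.φ z.1) (E.φ z.2) θ • E.φ z.1‖ ≤ 1 + 2 * ‖θ‖ := by
      rw [norm_smul]
      exact (mul_le_of_le_one_right (norm_nonneg _) (hφ _)).trans (norm_tdError_le hr hφ z θ)
    have h4 : ‖(E.γ * ⟪E.φ z.1, w⟫_ℝ) • E.φ z.2‖ ≤ ‖w‖ := by
      rw [norm_smul, norm_mul, Real.norm_eq_abs, Real.norm_eq_abs, abs_of_nonneg E.γ_nonneg]
      refine (mul_le_of_le_one_right (mul_nonneg E.γ_nonneg (abs_nonneg _)) (hφ _)).trans ?_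
      exact (mul_le_of_le_one_left (abs_nonneg _) E.γ_lt_one.le).trans h1
    exact (norm_sub_le _ _).trans ((add_le_add h3 h4).trans (by linarith))

lemma norm_incW_le (hr : ∀ s, |E.r s| ≤ 1) (hφ : ∀ s, ‖E.φ s‖ ≤ 1) (alg : Algorithm)
    (z : S × S) (θ w : Vec d) :
    ‖alg.incW E.γ (E.r z.1) (E.φ z.1) (E.φ z.2) θ w‖ ≤ 2 * (1 + ‖θ‖ + ‖w‖) := by
  have hθ := norm_nonneg θ
  have hw := norm_nonneg w
  have h1 : |⟪E.φ z.1, w⟫_ℝ| ≤ ‖w‖ :=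
    (abs_real_inner_le_norm _ _).trans (mul_le_of_le_one_left hw (hφ _))
  have h3 := norm_tdError_le hr hφ z θ
  have h4 : ‖(Algorithm.tdError E.γ (E.r z.1) (E.φ z.1) (E.φ z.2) θ - ⟪E.φ z.1, w⟫_ℝ) • E.φ z.1‖ ≤
      1 + 2 * ‖θ‖ + ‖w‖ := by
    rw [norm_smul]
    exact (mul_le_of_le_one_right (norm_nonneg _) (hφ _)).trans
      ((norm_sub_le _ _).trans (add_le_add h3 h1))
  cases alg with
  | gtd0 =>
    have h5 : ‖Algorithm.tdError E.γ (E.r z.1) (E.φ z.1) (E.φ z.2) θ • E.φ z.1‖ ≤ 1 + 2 * ‖θ‖ := by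
      rw [norm_smul]
      exact (mul_le_of_le_one_right (norm_nonneg _) (hφ _)).trans h3
    exact (norm_sub_le _ _).trans ((add_le_add h5 le_rfl).trans (by linarith))
  | gtd2 => exact h4.trans (by linarith)
  | tdc => exact h4.trans (by linarith)

lemma measurable_incTheta (alg : Algorithm) : Measurable fun t : (Vec d × Vec d) × S × S =>
    alg.incTheta E.γ (E.r t.2.1) (E.φ t.2.1) (E.φ t.2.2) t.1.1 t.1.2 := by
  have h1 : Measurable fun t : (Vec d × Vec d) × S × S => E.r t.2.1 :=
    E.measurable_r.comp (measurable_fst.comp measurable_snd)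
  have h2 : Measurable fun t : (Vec d × Vec d) × S × S => E.φ t.2.1 :=
    E.measurable_φ.comp (measurable_fst.comp measurable_snd)
  have h3 : Measurable fun t : (Vec d × Vec d) × S × S => E.φ t.2.2 :=
    E.measurable_φ.comp (measurable_snd.comp measurable_snd)
  cases alg <;> simp only [Algorithm.incTheta, Algorithm.tdError] <;> fun_prop

lemma measurable_incW (alg : Algorithm) : Measurable fun t : (Vec d × Vec d) × S × S =>
    alg.incW E.γ (E.r t.2.1) (E.φ t.2.1) (E.φ t.2.2) t.1.1 t.1.2 := by
  have h1 : Measurable fun t : (Vec d × Vec d) × S × S => E.r t.2.1 :=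
    E.measurable_r.comp (measurable_fst.comp measurable_snd)
  have h2 : Measurable fun t : (Vec d × Vec d) × S × S => E.φ t.2.1 :=
    E.measurable_φ.comp (measurable_fst.comp measurable_snd)
  have h3 : Measurable fun t : (Vec d × Vec d) × S × S => E.φ t.2.2 :=
    E.measurable_φ.comp (measurable_snd.comp measurable_snd)
  cases alg <;> simp only [Algorithm.incW, Algorithm.tdError] <;> fun_prop

end PolicyEval

end GTD

namespace GTD

/-! ### The algorithms as decoupled systems -/

lemma isUnit_det_of_inner_pos {d : ℕ} {M : Matrix (Fin d) (Fin d) ℝ}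
    (hM : ∀ v : Vec d, v ≠ 0 → 0 < ⟪Matrix.toEuclideanCLM (𝕜 := ℝ) M v, v⟫_ℝ) : IsUnit M.det := by
  rw [isUnit_iff_ne_zero]
  intro h
  obtain ⟨v, hv, hMv⟩ := Matrix.exists_mulVec_eq_zero_iff.2 h
  have h1 := hM (WithLp.toLp 2 v) (by simpa using hv)
  rw [Matrix.toEuclideanCLM_toLp, hMv] at h1
  simp at h1

/-- `X₁ = Aᵀ W₂⁻¹ A` is coercive if `A` and `W₂` are. -/
lemma inner_conj_inv_pos {d : ℕ} {A W : Matrix (Fin d) (Fin d) ℝ} (hA : IsUnit A.det)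
    (hW : ∀ v : Vec d, v ≠ 0 → 0 < ⟪Matrix.toEuclideanCLM (𝕜 := ℝ) W v, v⟫_ℝ) {v : Vec d}
    (hv : v ≠ 0) : 0 < ⟪Matrix.toEuclideanCLM (𝕜 := ℝ) (Aᵀ * W⁻¹ * A) v, v⟫_ℝ := by
  have hWd := isUnit_det_of_inner_pos hW
  -- With `u = W⁻¹ A v` the form becomes `⟪A v, u⟫ = ⟪W u, u⟫`, so `W` need not be symmetric.
  set u : Vec d := Matrix.toEuclideanCLM (𝕜 := ℝ) (W⁻¹ * A) v with hu
  have hWu : Matrix.toEuclideanCLM (𝕜 := ℝ) W u = Matrix.toEuclideanCLM (𝕜 := ℝ) A v := by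
    rw [hu, ← mul_apply_eq_comp, ← map_mul, Matrix.mul_nonsing_inv_cancel_left _ _ hWd]
  have hu0 : u ≠ 0 := by
    intro h
    rw [h, map_zero] at hWu
    refine hv ?_
    have : Matrix.toEuclideanCLM (𝕜 := ℝ) (A⁻¹ * A) v = 0 := by
      rw [map_mul, mul_apply_eq_comp, ← hWu, map_zero]
    rwa [Matrix.nonsing_inv_mul _ hA, map_one, one_apply_eq_self] at this
  have h := hW u hu0
  rw [hWu] at h
  have e : ⟪Matrix.toEuclideanCLM (𝕜 := ℝ) (Aᵀ * W⁻¹ * A) v, v⟫_ℝ =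
      ⟪Matrix.toEuclideanCLM (𝕜 := ℝ) A v, u⟫_ℝ := by
    have hstar : Matrix.toEuclideanCLM (𝕜 := ℝ) Aᵀ =
        ContinuousLinearMap.adjoint (Matrix.toEuclideanCLM (𝕜 := ℝ) A) := by
      rw [← ContinuousLinearMap.star_eq_adjoint, ← map_star, Matrix.star_eq_conjTranspose,
        Matrix.conjTranspose_eq_transpose_of_trivial]
    rw [mul_assoc, map_mul, mul_apply_eq_comp, hstar,
      ContinuousLinearMap.adjoint_inner_left, real_inner_comm]
  rwa [e]

namespace Algorithm

variable {d : ℕ} (alg : Algorithm) {A C : Matrix (Fin d) (Fin d) ℝ} {b : Fin d → ℝ}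

/-- For TDC, `A - (C - Aᵀ) C⁻¹ A = Aᵀ C⁻¹ A`, so all three algorithms share one form of the slow
operator. -/
lemma X₁_system (hC : IsUnit C.det) :
    (alg.system A C b).X₁ = Aᵀ * (alg.system A C b).W₂⁻¹ * A := by
  cases alg with
  | gtd0 => simp [system, LinearSystem.X₁]
  | gtd2 => simp [system, LinearSystem.X₁]
  | tdc => simp [system, LinearSystem.X₁, sub_mul, Matrix.mul_nonsing_inv _ hC]

lemma b₁_system (hC : IsUnit C.det) :
    (alg.system A C b).b₁ = (Aᵀ * (alg.system A C b).W₂⁻¹) *ᵥ b := by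
  cases alg with
  | gtd0 => simp [system, LinearSystem.b₁, Matrix.neg_mulVec]
  | gtd2 => simp [system, LinearSystem.b₁, Matrix.neg_mulVec]
  | tdc => simp [system, LinearSystem.b₁, sub_mul, Matrix.mul_nonsing_inv _ hC, Matrix.sub_mulVec]

lemma v₂_system : (alg.system A C b).v₂ = b := by cases alg <;> rfl

lemma Γ₂_system : (alg.system A C b).Γ₂ = A := by cases alg <;> rfl

lemma isUnit_det_W₂ (hC : IsUnit C.det) : IsUnit (alg.system A C b).W₂.det := by
  cases alg with
  | gtd0 => simp [system]
  | gtd2 => exact hC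
  | tdc => exact hC

/-- `θ*` solves `A θ = b`. -/
lemma mulVec_thetaStar (hA : IsUnit A.det) (hC : IsUnit C.det) :
    A *ᵥ (alg.system A C b).thetaStar.ofLp = b := by
  have hW := alg.isUnit_det_W₂ (A := A) (b := b) hC
  unfold LinearSystem.thetaStar
  rw [X₁_system alg hC, b₁_system alg hC]
  set Q := Aᵀ * (alg.system A C b).W₂⁻¹ with hQ
  have hQd : IsUnit Q.det := by
    rw [hQ, Matrix.det_mul, Matrix.det_transpose]
    exact hA.mul (Matrix.isUnit_nonsing_inv_det _ hW)
  rw [Matrix.mul_inv_rev, Matrix.mulVec_mulVec, Matrix.mulVec_mulVec,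
    Matrix.mul_nonsing_inv_cancel_left _ _ hA, Matrix.nonsing_inv_mul _ hQd, Matrix.one_mulVec]

/-- As `A θ* = b`, the mean temporal difference update vanishes at `θ*`. Decoupled systems can
therefore take `w = 0` as the limit. -/
lemma wStar_eq_zero (hA : IsUnit A.det) (hC : IsUnit C.det) : (alg.system A C b).wStar = 0 := by
  unfold LinearSystem.wStar
  rw [v₂_system, Γ₂_system, mulVec_thetaStar alg hA hC, sub_self, Matrix.mulVec_zero]
  rfl

/-- The mean drifts of the algorithms form a decoupled system. -/
lemma exists_decoupled
    (hA : ∀ v : Vec d, v ≠ 0 → 0 < ⟪Matrix.toEuclideanCLM (𝕜 := ℝ) A v, v⟫_ℝ)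
    (hC : ∀ v : Vec d, v ≠ 0 → 0 < ⟪Matrix.toEuclideanCLM (𝕜 := ℝ) C v, v⟫_ℝ) :
    ∃ D : Decoupled d, D.θs = (alg.system A C b).thetaStar ∧
      (∀ θ w, D.driftθ θ w = WithLp.toLp 2 (alg.system A C b).v₁ -
        Matrix.toEuclideanCLM (𝕜 := ℝ) (alg.system A C b).Γ₁ θ -
        Matrix.toEuclideanCLM (𝕜 := ℝ) (alg.system A C b).W₁ w) ∧
      ∀ θ w, D.driftW θ w = WithLp.toLp 2 (alg.system A C b).v₂ -
        Matrix.toEuclideanCLM (𝕜 := ℝ) (alg.system A C b).Γ₂ θ -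
        Matrix.toEuclideanCLM (𝕜 := ℝ) (alg.system A C b).W₂ w := by
  have hAd := isUnit_det_of_inner_pos hA
  have hCd := isUnit_det_of_inner_pos hC
  have hWd := alg.isUnit_det_W₂ (A := A) (b := b) hCd
  have hW : ∀ v : Vec d, v ≠ 0 →
      0 < ⟪Matrix.toEuclideanCLM (𝕜 := ℝ) (alg.system A C b).W₂ v, v⟫_ℝ := by
    cases alg with
    | gtd0 =>
      intro v hv
      have := norm_pos_iff.2 hv
      simp only [system, map_one, one_apply_eq_self, real_inner_self_eq_norm_sq]
      positivity
    | gtd2 => exact hC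
    | tdc => exact hC
  have hX₁ := X₁_system alg (A := A) (b := b) hCd
  have hθs := mulVec_thetaStar alg (A := A) (b := b) hAd hCd
  have hv₁ : (alg.system A C b).v₁ =
      (alg.system A C b).Γ₁ *ᵥ (alg.system A C b).thetaStar.ofLp := by
    cases alg with
    | gtd0 => simp [system]
    | gtd2 => simp [system]
    | tdc => exact hθs.symm
  have hv₂ := v₂_system alg (A := A) (C := C) (b := b)
  have hΓ₂ := Γ₂_system alg (A := A) (C := C) (b := b)
  unfold LinearSystem.X₁ at hX₁
  rw [hΓ₂, sub_eq_iff_eq_add] at hX₁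
  rw [hv₂, hΓ₂, hv₁]
  generalize (alg.system A C b).thetaStar = θs at *
  generalize (alg.system A C b).W₂ = W₂ at *
  generalize (alg.system A C b).W₁ = W₁ at *
  generalize (alg.system A C b).Γ₁ = Γ₁ at *
  obtain ⟨l₁, hl₁, hX⟩ := exists_coercive (Matrix.toEuclideanCLM (𝕜 := ℝ) (Aᵀ * W₂⁻¹ * A))
    fun v hv => inner_conj_inv_pos hAd hW hv
  obtain ⟨l₂, hl₂, hY⟩ := exists_coercive (Matrix.toEuclideanCLM (𝕜 := ℝ) W₂) hW
  set X := Matrix.toEuclideanCLM (𝕜 := ℝ) (Aᵀ * W₂⁻¹ * A) with hXdef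
  set Y := Matrix.toEuclideanCLM (𝕜 := ℝ) W₂ with hYdef
  -- `Y ∘ G = A` recenters `w` at the fast equilibrium belonging to `θ`, and `H ∘ Y = W₁` expresses
  -- the coupling through the fast drift.
  set G := Matrix.toEuclideanCLM (𝕜 := ℝ) (W₂⁻¹ * A) with hGdef
  set H := Matrix.toEuclideanCLM (𝕜 := ℝ) (W₁ * W₂⁻¹) with hHdef
  have hYG : ∀ v, Y (G v) = Matrix.toEuclideanCLM (𝕜 := ℝ) A v := fun v => by
    rw [hYdef, hGdef, ← mul_apply_eq_comp, ← map_mul,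
      Matrix.mul_nonsing_inv_cancel_left _ _ hWd]
  have hHY : ∀ v, H (Y v) = Matrix.toEuclideanCLM (𝕜 := ℝ) W₁ v := fun v => by
    rw [hYdef, hHdef, ← mul_apply_eq_comp, ← map_mul,
      Matrix.nonsing_inv_mul_cancel_right _ _ hWd]
  have hHA : ∀ v, H (Matrix.toEuclideanCLM (𝕜 := ℝ) A v) =
      Matrix.toEuclideanCLM (𝕜 := ℝ) (W₁ * W₂⁻¹ * A) v := fun v => by
    rw [hHdef, ← mul_apply_eq_comp, ← map_mul]
  have nX := norm_nonneg X
  have nY := norm_nonneg Y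
  have nG := norm_nonneg G
  have nH := norm_nonneg H
  refine ⟨{ X := X, Y := Y, G := G, H := H, θs := θs, l := min 1 (min l₁ l₂),
            M := 1 + ‖X‖ + ‖Y‖ + ‖G‖ + ‖H‖, l_pos := by positivity, l_le_one := min_le_left _ _,
            one_le_M := by linarith, norm_X := by linarith, norm_Y := by linarith,
            norm_G := by linarith, norm_H := by linarith,
            coercive_X := fun v => le_trans (mul_le_mul_of_nonneg_right
              ((min_le_right _ _).trans (min_le_left _ _)) (by positivity)) (hX v),
            coercive_Y := fun v => le_trans (mul_le_mul_of_nonneg_right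
              ((min_le_right _ _).trans (min_le_right _ _)) (by positivity)) (hY v) },
    rfl, fun θ w => ?_, fun θ w => ?_⟩
  · simp only [Decoupled.driftθ, Decoupled.fast]
    rw [map_add, hYG, map_add, hHY, hHA, ← Matrix.toEuclideanCLM_toLp, hX₁, map_add, ← hXdef]
    simp only [add_apply, map_sub, WithLp.toLp_ofLp]
    abel
  · simp only [Decoupled.driftW, Decoupled.fast]
    rw [map_add, hYG, ← hθs, ← Matrix.toEuclideanCLM_toLp, map_sub, WithLp.toLp_ofLp]
    abel

end Algorithm

/-- The convergence rate in positive dimension, for coercive `A` and `C`. -/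
lemma exists_rate_bound_of_pos (alg : Algorithm) {d : ℕ} (hd : 0 < d)
    {A C : Matrix (Fin d) (Fin d) ℝ} {b : Fin d → ℝ} {α β p Rθ Rw : ℝ}
    (hβ : 0 < β) (hβα : β < α) (hα : α < 1) (hp : 1 < p) (hRw : 0 < Rw)
    (hθ : ‖(alg.system A C b).thetaStar‖ < Rθ)
    (hA : ∀ v : Vec d, v ≠ 0 → 0 < ⟪Matrix.toEuclideanCLM (𝕜 := ℝ) A v, v⟫_ℝ)
    (hC : ∀ v : Vec d, v ≠ 0 → 0 < ⟪Matrix.toEuclideanCLM (𝕜 := ℝ) C v, v⟫_ℝ) :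
    ∃ Cθ Cw K κ : ℝ, ∀ δ : ℝ, 0 < δ → δ < 1 →
      ∃ N : ℕ, (N : ℝ) ≤ K * (1 + Real.log (1 / δ)) ^ κ ∧
        ∀ (S : Type*) (Act : Type*) [MeasurableSpace S] [MeasurableSpace Act]
          (E : PolicyEval d S Act), E.A = A → E.C = C → E.b = b →
          (∀ s, |E.r s| ≤ 1) → (∀ s, ‖E.φ s‖ ≤ 1) →
        ∀ (Ω : Type*) [MeasurableSpace Ω] (P : Measure Ω) [IsProbabilityMeasure P]
          (x : ℕ → Ω → S × S), (∀ n, Measurable (x n)) → iIndepFun x P →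
          (∀ n, P.map (x n) = E.pairLaw) →
        ∀ θ₀ w₀ : Vec d,
          1 - δ < P.real {ω | ∀ n ≥ N,
            ‖(E.iterates alg α β Rθ Rw (fun m => x m ω) θ₀ w₀ n).1 -
                (alg.system A C b).thetaStar‖ ≤ Cθ * rate d p δ α n ∧
            ‖(E.iterates alg α β Rθ Rw (fun m => x m ω) θ₀ w₀ n).2 -
                (alg.system A C b).wStar‖ ≤ Cw * rate d p δ β n} := by
  obtain ⟨D, hDθ, hD₁, hD₂⟩ := alg.exists_decoupled (b := b) hA hC
  rw [← hDθ, alg.wStar_eq_zero (isUnit_det_of_inner_pos hA) (isUnit_det_of_inner_pos hC)]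
  -- The increments are bounded by `2 (1 + ‖θ‖ + ‖w‖)`, hence so are their means, and the centered
  -- noise by twice that: `c₀ = 4`.
  obtain ⟨Cθ, Cw, K, κ, hmain⟩ := D.exists_rate_bound hd hβ hβα hα hp hRw (Rθ := Rθ)
    (by rw [hDθ]; exact hθ) (c₀ := 4) (by norm_num)
  refine ⟨Cθ, Cw, K, κ, fun δ hδ hδ1 => ?_⟩
  obtain ⟨N, hN, hbound⟩ := hmain δ hδ hδ1
  refine ⟨N, hN, ?_⟩
  rintro S Act _ _ E rfl rfl rfl hr hφ Ω _ P _ x hx hind hlaw θ₀ w₀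
  set f₁ : Vec d × Vec d → S × S → Vec d := fun q z =>
    alg.incTheta E.γ (E.r z.1) (E.φ z.1) (E.φ z.2) q.1 q.2 with hf₁
  set f₂ : Vec d × Vec d → S × S → Vec d := fun q z =>
    alg.incW E.γ (E.r z.1) (E.φ z.1) (E.φ z.2) q.1 q.2 with hf₂
  have hm₁ : Measurable (Function.uncurry f₁) := PolicyEval.measurable_incTheta alg
  have hm₂ : Measurable (Function.uncurry f₂) := PolicyEval.measurable_incW alg
  have hb₁ : ∀ q z, ‖f₁ q z‖ ≤ 2 * (1 + ‖q.1‖ + ‖q.2‖) := fun q z =>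
    PolicyEval.norm_incTheta_le hr hφ alg z q.1 q.2
  have hb₂ : ∀ q z, ‖f₂ q z‖ ≤ 2 * (1 + ‖q.1‖ + ‖q.2‖) := fun q z =>
    PolicyEval.norm_incW_le hr hφ alg z q.1 q.2
  have hmean₁ : ∀ q, ∫ z, f₁ q z ∂E.pairLaw = D.driftθ q.1 q.2 := fun q => by
    rw [hD₁]; exact PolicyEval.integral_incTheta hr hφ alg q.1 q.2
  have hmean₂ : ∀ q, ∫ z, f₂ q z ∂E.pairLaw = D.driftW q.1 q.2 := fun q => by
    rw [hD₂]; exact PolicyEval.integral_incW hr hφ alg q.1 q.2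
  have hint : ∀ f : Vec d × Vec d → S × S → Vec d, Measurable (Function.uncurry f) →
      (∀ q z, ‖f q z‖ ≤ 2 * (1 + ‖q.1‖ + ‖q.2‖)) → ∀ q, Integrable (f q) E.pairLaw :=
    fun f hf hb q => Integrable.of_bound (hf.comp measurable_prodMk_left).aestronglyMeasurable
      (2 * (1 + ‖q.1‖ + ‖q.2‖)) (ae_of_all _ fun z => hb q z)
  have hdm₁ : Measurable fun q : Vec d × Vec d => D.driftθ q.1 q.2 := by
    unfold Decoupled.driftθ Decoupled.fast; fun_prop
  have hdm₂ : Measurable fun q : Vec d × Vec d => D.driftW q.1 q.2 := by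
    unfold Decoupled.driftW Decoupled.fast; fun_prop
  have hcenter : ∀ (f : Vec d × Vec d → S × S → Vec d) (h : Vec d → Vec d → Vec d),
      Measurable (Function.uncurry f) → (∀ q z, ‖f q z‖ ≤ 2 * (1 + ‖q.1‖ + ‖q.2‖)) →
      (∀ q, ∫ z, f q z ∂E.pairLaw = h q.1 q.2) → (∀ q, ∫ z, (f q z - h q.1 q.2) ∂E.pairLaw = 0) ∧
        ∀ q z, ‖f q z - h q.1 q.2‖ ≤ 4 * (1 + ‖q.1‖ + ‖q.2‖) := by
    refine fun f h hf hb hmean => ⟨fun q => ?_, fun q z => ?_⟩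
    · rw [integral_sub (hint f hf hb q) (integrable_const _), hmean]
      simp
    · have h1 : ‖h q.1 q.2‖ ≤ 2 * (1 + ‖q.1‖ + ‖q.2‖) := by
        rw [← hmean]
        simpa using norm_integral_le_of_norm_le_const (μ := E.pairLaw) (ae_of_all _ fun z => hb q z)
      exact (norm_sub_le _ _).trans ((add_le_add (hb q z) h1).trans (by linarith))
  obtain ⟨hc₁, hn₁⟩ := hcenter f₁ D.driftθ hm₁ hb₁ hmean₁
  obtain ⟨hc₂, hn₂⟩ := hcenter f₂ D.driftW hm₂ hb₂ hmean₂
  have hfinal := hbound (S × S) Ω E.pairLaw P (fun q z => f₁ q z - D.driftθ q.1 q.2)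
    (fun q z => f₂ q z - D.driftW q.1 q.2) (hm₁.sub (hdm₁.comp measurable_fst))
    (hm₂.sub (hdm₂.comp measurable_fst)) hc₁ hc₂ hn₁ hn₂ x hx hind hlaw
    (fun n ω => E.iterates alg α β Rθ Rw (fun m => x m ω) θ₀ w₀ n) (θ₀, w₀) (fun ω => rfl)
    (fun ω => ⟨fun n => ?_, fun n => ?_⟩)
  · simpa using hfinal
  · simp only [add_sub_cancel]
    rfl
  · simp only [add_sub_cancel]
    rfl

end GTD

end

/-! ### The theorem -/

open GTD in
theorem corollary1 (alg : Algorithm) (d : ℕ)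
    (A C : Matrix (Fin d) (Fin d) ℝ) (b : Fin d → ℝ) (α β p Rθ Rw : ℝ)
    (hβ : 0 < β) (hβα : β < α) (hα : α < 1) (hp : 1 < p) (hRθ : 0 < Rθ) (hRw : 0 < Rw)
    (hθ : ‖(alg.system A C b).thetaStar‖ < Rθ) :
    ∃ Cθ Cw K κ : ℝ, ∀ δ : ℝ, 0 < δ → δ < 1 →
      ∃ N : ℕ, (N : ℝ) ≤ K * (1 + Real.log (1 / δ)) ^ κ ∧
        ∀ (S : Type*) (Act : Type*) [MeasurableSpace S] [MeasurableSpace Act]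
          (E : PolicyEval d S Act), E.A = A → E.C = C → E.b = b →
          (∀ s, |E.r s| ≤ 1) → (∀ s, ‖E.φ s‖ ≤ 1) → E.FullRank →
        ∀ (Ω : Type*) [MeasurableSpace Ω] (P : Measure Ω) [IsProbabilityMeasure P]
          (x : ℕ → Ω → S × S), (∀ n, Measurable (x n)) → iIndepFun x P →
          (∀ n, P.map (x n) = E.pairLaw) →
        ∀ θ₀ w₀ : Vec d,
          1 - δ < P.real {ω | ∀ n ≥ N,
            ‖(E.iterates alg α β Rθ Rw (fun m => x m ω) θ₀ w₀ n).1 -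
                (alg.system A C b).thetaStar‖ ≤ Cθ * rate d p δ α n ∧
            ‖(E.iterates alg α β Rθ Rw (fun m => x m ω) θ₀ w₀ n).2 -
                (alg.system A C b).wStar‖ ≤ Cw * rate d p δ β n} := by
  have hlog : ∀ δ : ℝ, 0 < δ → δ < 1 → ((0 : ℕ) : ℝ) ≤ 0 * (1 + Real.log (1 / δ)) ^ (0 : ℝ) :=
    fun δ _ _ => by simp
  -- For `d = 0` the argument of the logarithm is `0` and the rate degenerates, but all vectors
  -- vanish.
  rcases Nat.eq_zero_or_pos d with rfl | hd
  · refine ⟨0, 0, 0, 0, fun δ hδ hδ1 => ⟨0, hlog δ hδ hδ1, ?_⟩⟩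
    intro S Act _ _ E _ _ _ _ _ _ Ω _ P _ x _ _ _ θ₀ w₀
    have h0 : ∀ v : Vec 0, ‖v‖ = 0 := fun v => by rw [Subsingleton.elim v 0, norm_zero]
    simp only [h0, zero_mul, le_refl, and_self, implies_true]
    have : P.real {_ω : Ω | True} = 1 := by simp
    rw [this]
    linarith
  -- The constants must be chosen from the matrices before any decision process is given. If `A` or
  -- `C` is not positive, no admissible process has these matrices, and any constants will do.
  · by_cases hpos : (∀ v : Vec d, v ≠ 0 → 0 < ⟪Matrix.toEuclideanCLM (𝕜 := ℝ) A v, v⟫_ℝ) ∧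
        ∀ v : Vec d, v ≠ 0 → 0 < ⟪Matrix.toEuclideanCLM (𝕜 := ℝ) C v, v⟫_ℝ
    · obtain ⟨Cθ, Cw, K, κ, h⟩ := exists_rate_bound_of_pos alg hd hβ hβα hα hp hRw hθ hpos.1 hpos.2
      refine ⟨Cθ, Cw, K, κ, fun δ hδ hδ1 => ?_⟩
      obtain ⟨N, hN, hb⟩ := h δ hδ hδ1
      exact ⟨N, hN, fun S Act _ _ E hA hC hb' hr hφ _ => hb S Act E hA hC hb' hr hφ⟩
    · refine ⟨0, 0, 0, 0, fun δ hδ hδ1 => ⟨0, hlog δ hδ hδ1, ?_⟩⟩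
      rintro S Act _ _ E rfl rfl rfl _ hφ hE
      exact absurd ⟨fun v hv => PolicyEval.inner_A_pos hφ hE hv,
        fun v hv => PolicyEval.inner_C_pos hφ hE hv⟩ hpos
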